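/- Let $n\ge 3$, let $\Omega\subset\mathbb R^n$ be a bounded connected open set with smooth boundary, outward unit normal $\nu$ and surface measure $\sigma$, and let $x_0\in\mathbb R^n\setminus\overline\Omega$. Put $\psi(x)=|x-x_0|$ and $$\Gamma_\pm(x_0)=\{x\in\partial\Omega:\ \pm(x-x_0)\cdot\nu(x)\ge 0\}.$$ There is a constant $C>0$, depending only on $\Omega$ and $x_0$, such that the following holds. For every $T>0$ and $M\ge 0$, with $Q=(0,T)\times\Omega$ and $\Sigma=(0,T)\times\partial\Omega$, there is $\tau_0>0$, depending only on $T$, $\Omega$, $x_0$ and $M$, such that for every (complex-valued) $q\in L^\infty(Q)$ with $\|q\|_{L^\infty(Q)}\le M$, every (complex-valued) $v\in H^1(Q)\cap L^2(0,T;H^2(\Omega))$ with $$v|_\Sigma=0,\qquad v|_{t=0}=0$$ in the sense of traces, and every $\tau>\tau_0$, $$\begin{aligned} &\tau\int_0^T\!\!\int_{\Gamma_+(x_0)}e^{-2(\tau^2t+\tau\psi(x))}|\partial_\nu v|^2|\partial_\nu\psi(x)|\,d\sigma(x)\,dt+\tau^2\int_Q e^{-2(\tau^2t+\tau\psi(x))}|v|^2\,dx\,dt\\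 &\quad\le C\left(\int_Q e^{-2(\tau^2t+\tau\psi(x))}\bigl|(\partial_t-\Delta_x+q)v\bigr|^2\,dx\,dt+\tau\int_0^T\!\!\int_{\Gamma_-(x_0)}e^{-2(\tau^2t+\tau\psi(x))}|\partial_\nu v|^2|\partial_\nu\psi(x)|\,d\sigma(x)\,dt\right). \end{aligned}$$ Here $\partial_\nu v$ is the Neumann trace $\sum_i\nu_i(\partial_{x_i}v)|_\Sigma\in L^2(\Sigma)$. -/

import Mathlib

open Set Filter Topology MeasureTheory
open scoped ContDiff

noncomputable section

/-! ### Smooth bounded domains, outward normal, surface measure -/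

/-- `ρ` is a smooth defining function of `Ω` near the boundary point `p`: near `p` the set `Ω` is
`{ρ < 0}`, and `dρ(p) ≠ 0`. -/
def IsDefiningFunctionAt {n : ℕ} (Ω : Set (EuclideanSpace ℝ (Fin n)))
    (p : EuclideanSpace ℝ (Fin n)) (ρ : EuclideanSpace ℝ (Fin n) → ℝ) : Prop :=
  ContDiff ℝ ∞ ρ ∧ gradient ρ p ≠ 0 ∧ ∀ᶠ x in 𝓝 p, (x ∈ Ω ↔ ρ x < 0)

/-- A bounded connected open set of `ℝⁿ` with smooth boundary (lying locally on one side of it). -/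
structure IsSmoothBoundedDomain {n : ℕ} (Ω : Set (EuclideanSpace ℝ (Fin n))) : Prop where
  isOpen : IsOpen Ω
  isConnected : IsConnected Ω
  isBounded : Bornology.IsBounded Ω
  smooth_boundary : ∀ p ∈ frontier Ω, ∃ ρ, IsDefiningFunctionAt Ω p ρ

open Classical in
/-- The outward unit normal `ν(p) = ∇ρ(p)/|∇ρ(p)|` at a boundary point `p`, where `ρ` is a smooth
defining function of `Ω` near `p`; the value does not depend on the choice of `ρ`. -/
def outwardNormal {n : ℕ} (Ω : Set (EuclideanSpace ℝ (Fin n)))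
    (p : EuclideanSpace ℝ (Fin n)) : EuclideanSpace ℝ (Fin n) :=
  if h : ∃ ρ, IsDefiningFunctionAt Ω p ρ then
    ‖gradient h.choose p‖⁻¹ • gradient h.choose p
  else 0

/-- The surface measure `σ` on `∂Ω`: the (Euclidean normalised) `(n-1)`-dimensional Hausdorff
measure restricted to `∂Ω`. -/
def surfaceMeasure {n : ℕ} (Ω : Set (EuclideanSpace ℝ (Fin n))) :
    Measure (EuclideanSpace ℝ (Fin n)) :=
  (Measure.euclideanHausdorffMeasure (n - 1)).restrict (frontier Ω)

/-- `Γ₊(x₀)`, the set of `x ∈ ∂Ω` with `(x - x₀) · ν(x) ≥ 0`. -/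
def backSet {n : ℕ} (Ω : Set (EuclideanSpace ℝ (Fin n))) (x₀ : EuclideanSpace ℝ (Fin n)) :
    Set (EuclideanSpace ℝ (Fin n)) :=
  {x | x ∈ frontier Ω ∧ 0 ≤ inner ℝ (x - x₀) (outwardNormal Ω x)}

/-- `Γ₋(x₀)`, the set of `x ∈ ∂Ω` with `(x - x₀) · ν(x) ≤ 0`. -/
def frontSet {n : ℕ} (Ω : Set (EuclideanSpace ℝ (Fin n))) (x₀ : EuclideanSpace ℝ (Fin n)) :
    Set (EuclideanSpace ℝ (Fin n)) :=
  {x | x ∈ frontier Ω ∧ inner ℝ (x - x₀) (outwardNormal Ω x) ≤ 0}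

/-- The normal derivative `∂_ν f(x) = df(x)[ν(x)]` of a function differentiable at `x ∈ ∂Ω`. -/
def normalDeriv {n : ℕ} (Ω : Set (EuclideanSpace ℝ (Fin n)))
    (f : EuclideanSpace ℝ (Fin n) → ℝ) (x : EuclideanSpace ℝ (Fin n)) : ℝ :=
  fderiv ℝ f x (outwardNormal Ω x)

/-! ### The space-time cylinder -/

/-- `Q = (0,T) × Ω`. -/
def spaceTimeCyl {n : ℕ} (T : ℝ) (Ω : Set (EuclideanSpace ℝ (Fin n))) :
    Set (ℝ × EuclideanSpace ℝ (Fin n)) :=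
  Ioo 0 T ×ˢ Ω

/-- The measure `dt ⊗ dσ` of the lateral boundary `Σ = (0,T) × ∂Ω`. -/
def lateralMeasure {n : ℕ} (T : ℝ) (Ω : Set (EuclideanSpace ℝ (Fin n))) :
    Measure (ℝ × EuclideanSpace ℝ (Fin n)) :=
  (volume.restrict (Ioo 0 T)).prod (surfaceMeasure Ω)

/-- The time direction of `ℝ × ℝⁿ`. -/
def timeDir (n : ℕ) : ℝ × EuclideanSpace ℝ (Fin n) := (1, 0)

/-- The `i`-th spatial coordinate direction of `ℝ × ℝⁿ`. -/
def spaceDir {n : ℕ} (i : Fin n) : ℝ × EuclideanSpace ℝ (Fin n) :=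
  (0, EuclideanSpace.single i 1)

/-! ### Weak derivatives and Sobolev spaces -/

/-- `g` is the weak derivative of `f` in the direction `e` on the open set `U ⊆ ℝ × ℝⁿ`. -/
def HasWeakDeriv {n : ℕ} (U : Set (ℝ × EuclideanSpace ℝ (Fin n)))
    (e : ℝ × EuclideanSpace ℝ (Fin n)) (f g : ℝ × EuclideanSpace ℝ (Fin n) → ℂ) : Prop :=
  ∀ φ : ℝ × EuclideanSpace ℝ (Fin n) → ℝ,
    ContDiff ℝ ∞ φ → HasCompactSupport φ → tsupport φ ⊆ U →
      ∫ z in U, (fderiv ℝ φ z e) • f z = - ∫ z in U, φ z • g z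

/-- `f` has a weak derivative in the direction `e` on `U` that belongs to `L²(U)`. -/
def HasL2WeakDeriv {n : ℕ} (U : Set (ℝ × EuclideanSpace ℝ (Fin n)))
    (e : ℝ × EuclideanSpace ℝ (Fin n)) (f : ℝ × EuclideanSpace ℝ (Fin n) → ℂ) : Prop :=
  ∃ g, MemLp g 2 (volume.restrict U) ∧ HasWeakDeriv U e f g

open Classical in
/-- The weak derivative of `f` in the direction `e` on `U` (unique up to null sets), for `f` with
`HasL2WeakDeriv U e f`. -/
def weakDeriv {n : ℕ} (U : Set (ℝ × EuclideanSpace ℝ (Fin n)))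
    (e : ℝ × EuclideanSpace ℝ (Fin n)) (f : ℝ × EuclideanSpace ℝ (Fin n) → ℂ) :
    ℝ × EuclideanSpace ℝ (Fin n) → ℂ :=
  if h : HasL2WeakDeriv U e f then h.choose else 0

/-- `f ∈ H¹(Q)`. -/
def MemH1 {n : ℕ} (T : ℝ) (Ω : Set (EuclideanSpace ℝ (Fin n)))
    (f : ℝ × EuclideanSpace ℝ (Fin n) → ℂ) : Prop :=
  MemLp f 2 (volume.restrict (spaceTimeCyl T Ω)) ∧
    HasL2WeakDeriv (spaceTimeCyl T Ω) (timeDir n) f ∧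
    ∀ i, HasL2WeakDeriv (spaceTimeCyl T Ω) (spaceDir i) f

/-- `f ∈ L²(0,T;H¹(Ω))`, with the usual identification of an element of this Bochner space with a
function on `Q`: `f` and its first order weak derivatives in `x` are in `L²(Q)`. -/
def MemL2H1 {n : ℕ} (T : ℝ) (Ω : Set (EuclideanSpace ℝ (Fin n)))
    (f : ℝ × EuclideanSpace ℝ (Fin n) → ℂ) : Prop :=
  MemLp f 2 (volume.restrict (spaceTimeCyl T Ω)) ∧
    ∀ i, HasL2WeakDeriv (spaceTimeCyl T Ω) (spaceDir i) f

/-- `f ∈ L²(0,T;H²(Ω))`: `f` and its weak derivatives in `x` of order at most two are in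
`L²(Q)`. -/
def MemL2H2 {n : ℕ} (T : ℝ) (Ω : Set (EuclideanSpace ℝ (Fin n)))
    (f : ℝ × EuclideanSpace ℝ (Fin n) → ℂ) : Prop :=
  MemL2H1 T Ω f ∧ ∀ i, MemL2H1 T Ω (weakDeriv (spaceTimeCyl T Ω) (spaceDir i) f)

/-- `(∂_t - Δ_x + q) f` on `Q`, in the weak sense. -/
def heatOp {n : ℕ} (T : ℝ) (Ω : Set (EuclideanSpace ℝ (Fin n)))
    (q f : ℝ × EuclideanSpace ℝ (Fin n) → ℂ) (z : ℝ × EuclideanSpace ℝ (Fin n)) : ℂ :=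
  weakDeriv (spaceTimeCyl T Ω) (timeDir n) f z
    - ∑ i, weakDeriv (spaceTimeCyl T Ω) (spaceDir i)
        (weakDeriv (spaceTimeCyl T Ω) (spaceDir i) f) z
    + q z * f z

/-! ### Traces

A trace operator is the continuous extension of the restriction map from functions smooth up to
the boundary. It is described here by its graph. -/

/-- `g` is the trace on `Σ` of `f ∈ L²(0,T;H¹(Ω))`: the trace operator
`L²(0,T;H¹(Ω)) → L²(Σ)` is the continuous extension of `u ↦ u|_Σ`, `u` smooth. -/
def IsLateralTrace {n : ℕ} (T : ℝ) (Ω : Set (EuclideanSpace ℝ (Fin n)))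
    (f g : ℝ × EuclideanSpace ℝ (Fin n) → ℂ) : Prop :=
  MemLp g 2 (lateralMeasure T Ω) ∧
  ∃ u : ℕ → ℝ × EuclideanSpace ℝ (Fin n) → ℂ,
    (∀ k, ContDiff ℝ ∞ (u k)) ∧
    Tendsto (fun k => eLpNorm (fun z => u k z - f z) 2 (volume.restrict (spaceTimeCyl T Ω)))
      atTop (𝓝 0) ∧
    (∀ i, Tendsto (fun k => eLpNorm (fun z => fderiv ℝ (u k) z (spaceDir i)
        - weakDeriv (spaceTimeCyl T Ω) (spaceDir i) f z) 2 (volume.restrict (spaceTimeCyl T Ω)))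
      atTop (𝓝 0)) ∧
    Tendsto (fun k => eLpNorm (fun z => u k z - g z) 2 (lateralMeasure T Ω)) atTop (𝓝 0)

/-- `g` is the trace at `t = 0` of `f ∈ H¹(0,T;L²(Ω))`: the trace operator
`H¹(0,T;L²(Ω)) → L²(Ω)` is the continuous extension of `u ↦ u(0,·)`, `u` smooth. -/
def IsInitialTrace {n : ℕ} (T : ℝ) (Ω : Set (EuclideanSpace ℝ (Fin n)))
    (f : ℝ × EuclideanSpace ℝ (Fin n) → ℂ) (g : EuclideanSpace ℝ (Fin n) → ℂ) : Prop :=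
  MemLp g 2 (volume.restrict Ω) ∧
  ∃ u : ℕ → ℝ × EuclideanSpace ℝ (Fin n) → ℂ,
    (∀ k, ContDiff ℝ ∞ (u k)) ∧
    Tendsto (fun k => eLpNorm (fun z => u k z - f z) 2 (volume.restrict (spaceTimeCyl T Ω)))
      atTop (𝓝 0) ∧
    Tendsto (fun k => eLpNorm (fun z => fderiv ℝ (u k) z (timeDir n)
        - weakDeriv (spaceTimeCyl T Ω) (timeDir n) f z) 2 (volume.restrict (spaceTimeCyl T Ω)))
      atTop (𝓝 0) ∧
    Tendsto (fun k => eLpNorm (fun x => u k (0, x) - g x) 2 (volume.restrict Ω)) atTop (𝓝 0)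

/-- `g` is the Neumann trace `∂_ν f = ∑ᵢ νᵢ (∂ᵢ f)|_Σ` on `Σ` of `f ∈ L²(0,T;H²(Ω))`. -/
def IsNeumannTrace {n : ℕ} (T : ℝ) (Ω : Set (EuclideanSpace ℝ (Fin n)))
    (f g : ℝ × EuclideanSpace ℝ (Fin n) → ℂ) : Prop :=
  ∃ γ : Fin n → ℝ × EuclideanSpace ℝ (Fin n) → ℂ,
    (∀ i, IsLateralTrace T Ω (weakDeriv (spaceTimeCyl T Ω) (spaceDir i) f) (γ i)) ∧
    g =ᵐ[lateralMeasure T Ω] fun z => ∑ i, ((outwardNormal Ω z.2 i : ℝ) : ℂ) * γ i z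

/-! ### The Carleman weight -/

/-- `ψ(x) = |x - x₀|`. -/
def psi {n : ℕ} (x₀ x : EuclideanSpace ℝ (Fin n)) : ℝ := ‖x - x₀‖

/-- `e^{-2(τ² t + τ ψ(x))}`. -/
def carlemanWeight {n : ℕ} (x₀ : EuclideanSpace ℝ (Fin n)) (τ t : ℝ)
    (x : EuclideanSpace ℝ (Fin n)) : ℝ :=
  Real.exp (-2 * (τ ^ 2 * t + τ * psi x₀ x))

end

/-!
Conjugation with the square root of the weight, `w = exp(-(τ²t + τψ)) v`, turns the estimate into
one without weights. As `|∇ψ| = 1`, the zeroth order terms `τ²w` and `τ²|∇ψ|²w` cancel, and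
`∂ₜ - Δ` becomes `P = N - Δ` with the first order operator
`Nw = ∂ₜw - τ(2∇ψ·∇w + (Δψ)w)`. Everything follows from integrations by parts for `w`, which vanishes
on the lateral boundary and at `t = 0`:

* pairing `Pw` with `w` gives `‖∇w‖² ≤ ⟨Pw, w⟩`;
* pairing `Nw` with `ψw` gives `τ‖w‖² ≤ ⟨Nw, ψw⟩`, hence `τ‖w‖ ≤ R‖Nw‖` where `ψ ≤ R`;
* expanding `‖Pw‖² = ‖Nw - Δw‖²`, with the Rellich–Pohozaev identity for
  `∫ Δw (2∇ψ·∇w + (Δψ)w)` and `∫ Δw ∂ₜw ≤ 0`, gives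
  `‖Pw‖² ≥ ‖Nw‖² + 2τ∫_Σ |∂_νw|² ∂_νψ - 4τ∫ D²ψ(∇w, ∇w) + τ∫ (Δ²ψ)w²`.

The Hessian term is bounded by `‖∇w‖²`, which the first estimate and Young's inequality absorb; the
bilaplacian term and the potential are absorbed for large `τ`. This is
`HasParabolicDerivs.carleman`, for real functions; real and imaginary parts are added afterwards.

The analytic work is to justify these integrations by parts. The divergence theorem on `Ω` for the
Hausdorff measure, `IsSmoothBoundedDomain.setIntegral_fderiv`, is reduced by a partition of unity to
a domain lying locally on one side of a level set; there it is Fubini and the fundamental theorem of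
calculus in a direction `e` transversal to the boundary, together with the area formula
`comap_projection_volume_eq_withDensity` for the projection of the level set along `e`. Green's
formula then passes to limits. A function with weak derivative and trace (`WeakTrace`) satisfies it
against smooth functions; the limits of smooth functions that define `IsLateralTrace` satisfy it
against all functions of the former kind (`StrongTrace`). This is enough for every product that
occurs, so no density theorem for products is needed. It also yields the symmetry of the second
derivatives and the vanishing of the tangential derivatives of `w` on the lateral boundary.

The inequality `∫ Δw ∂ₜw ≤ 0` would formally need mixed derivatives `∂ₜ∇w`, which are not in `L²`.
Instead `∂ₜw` is the weak limit of the difference quotients `(w(t) - w(t-h))/h` of the extension of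
`w` by zero, and for these the inequality reads `∫ ∇w(t)·(∇w(t) - ∇w(t-h)) ≥ 0`, which is a
consequence of the invariance of the integral under translation.
-/

noncomputable section

/-! ### Local comparison of measures -/

theorem MeasureTheory.Measure.le_mul_of_locally_le {X : Type*} [TopologicalSpace X]
    [SecondCountableTopology X] [MeasurableSpace X] [BorelSpace X] {μ₁ μ₂ : Measure X}
    {c : ENNReal} (h : ∀ x, ∃ U ∈ 𝓝 x, ∀ A ⊆ U, MeasurableSet A → μ₁ A ≤ c * μ₂ A)
    {A : Set X} (hA : MeasurableSet A) : μ₁ A ≤ c * μ₂ A := by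
  choose U hU hUA using h
  obtain ⟨s, hs, hcov⟩ := TopologicalSpace.countable_cover_nhds (fun x => interior_mem_nhds.2 (hU x))
  rcases s.eq_empty_or_nonempty with rfl | hne
  · have : A = ∅ := by
      have h0 : (univ : Set X) = ∅ := by rw [← hcov]; simp
      exact subset_empty_iff.1 (h0 ▸ subset_univ A)
    simp [this]
  obtain ⟨u, hu⟩ := hs.exists_eq_range hne
  have hcov' : ⋃ k, interior (U (u k)) = univ := by
    rw [← hcov, hu, biUnion_range]
  let V : ℕ → Set X := disjointed fun k => interior (U (u k))
  have hVm : ∀ k, MeasurableSet (V k) :=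
    fun k => MeasurableSet.disjointed (fun k => isOpen_interior.measurableSet) k
  have hVd : Pairwise (Function.onFun Disjoint fun k => A ∩ V k) := fun i j hij =>
    (disjoint_disjointed _ hij).mono inter_subset_right inter_subset_right
  have hAV : A = ⋃ k, A ∩ V k := by
    rw [← inter_iUnion, iUnion_disjointed, hcov', inter_univ]
  rw [hAV, measure_iUnion hVd (fun k => hA.inter (hVm k)),
    measure_iUnion hVd (fun k => hA.inter (hVm k)), ← ENNReal.tsum_mul_left]
  refine ENNReal.tsum_le_tsum fun k => hUA (u k) _ ?_ (hA.inter (hVm k))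
  exact inter_subset_right.trans ((disjointed_subset _ k).trans interior_subset)

/-- Two Borel measures that agree locally up to factors arbitrarily close to `1` are equal. -/
theorem MeasureTheory.Measure.eq_of_locally_le {X : Type*} [TopologicalSpace X]
    [SecondCountableTopology X] [MeasurableSpace X] [BorelSpace X] {μ₁ μ₂ : Measure X} (m : ℕ)
    (h : ∀ c : ℝ, 1 < c → ∀ x, ∃ U ∈ 𝓝 x, ∀ A ⊆ U, MeasurableSet A →
      μ₁ A ≤ ENNReal.ofReal (c ^ m) * μ₂ A ∧ μ₂ A ≤ ENNReal.ofReal (c ^ m) * μ₁ A) :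
    μ₁ = μ₂ := by
  have key : ∀ ν₁ ν₂ : Measure X, (∀ c : ℝ, 1 < c → ∀ A, MeasurableSet A →
      ν₁ A ≤ ENNReal.ofReal (c ^ m) * ν₂ A) → ∀ A, MeasurableSet A → ν₁ A ≤ ν₂ A := by
    intro ν₁ ν₂ H A hA
    have hlim : Tendsto (fun c : ℝ => ENNReal.ofReal (c ^ m) * ν₂ A) (𝓝[>] 1) (𝓝 (ν₂ A)) := by
      have h1 : Tendsto (fun c : ℝ => ENNReal.ofReal (c ^ m)) (𝓝[>] 1) (𝓝 1) := by
        have : Tendsto (fun c : ℝ => ENNReal.ofReal (c ^ m)) (𝓝 1)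
            (𝓝 (ENNReal.ofReal ((1 : ℝ) ^ m))) :=
          (ENNReal.continuous_ofReal.comp (continuous_pow m)).tendsto _
        simpa using this.mono_left nhdsWithin_le_nhds
      have h2 := ENNReal.Tendsto.mul_const (b := ν₂ A) h1 (Or.inl one_ne_zero)
      simpa using h2
    exact ge_of_tendsto hlim (eventually_nhdsWithin_of_forall fun c hc => H c hc A hA)
  refine Measure.ext fun A hA => le_antisymm (key _ _ (fun c hc B hB => ?_) A hA)
    (key _ _ (fun c hc B hB => ?_) A hA)
  · refine Measure.le_mul_of_locally_le (fun x => ?_) hB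
    obtain ⟨U, hU, hUA⟩ := h c hc x
    exact ⟨U, hU, fun A hAU hA => (hUA A hAU hA).1⟩
  · refine Measure.le_mul_of_locally_le (fun x => ?_) hB
    obtain ⟨U, hU, hUA⟩ := h c hc x
    exact ⟨U, hU, fun A hAU hA => (hUA A hAU hA).2⟩

theorem LipschitzOnWith.euclideanHausdorffMeasure_image_le {X Y : Type*} [EMetricSpace X]
    [EMetricSpace Y] [MeasurableSpace X] [BorelSpace X] [MeasurableSpace Y] [BorelSpace Y]
    {K : NNReal} {f : X → Y} {s : Set X} (h : LipschitzOnWith K f s) (d : ℕ) :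
    μHE[d] (f '' s) ≤ (K : ENNReal) ^ d * μHE[d] s := by
  have := h.hausdorffMeasure_image_le (d := d) (Nat.cast_nonneg d)
  rw [ENNReal.rpow_natCast] at this
  simp only [Measure.euclideanHausdorffMeasure_def, Measure.smul_apply, ENNReal.smul_def,
    smul_eq_mul]
  rw [mul_left_comm]
  gcongr

/-! ### Area of level sets projected along a transversal direction -/

section Graph

variable {E : Type*} [NormedAddCommGroup E] [InnerProductSpace ℝ E]

/-- The linear map from the hyperplane `eᗮ` to the hyperplane `aᗮ` that moves points in the
direction `e` (`e` a unit vector with `⟪a, e⟫ ≠ 0`). -/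
def shearMap (e a : E) : (Submodule.span ℝ {e})ᗮ →ₗ[ℝ] E :=
  Submodule.subtype _ - (((inner ℝ a e)⁻¹ • (innerSL ℝ a).toLinearMap) ∘ₗ
    Submodule.subtype _).smulRight e

theorem shearMap_apply (e a : E) (y : (Submodule.span ℝ {e})ᗮ) :
    shearMap e a y = (y : E) - ((inner ℝ a e)⁻¹ * inner ℝ a (y : E)) • e := by
  simp [shearMap]

theorem inner_orthogonal_span_singleton_right (e : E) (y : (Submodule.span ℝ {e})ᗮ) :
    inner ℝ e (y : E) = 0 :=
  Submodule.mem_orthogonal_singleton_iff_inner_right.1 y.2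

theorem inner_orthogonal_span_singleton_left (e : E) (y : (Submodule.span ℝ {e})ᗮ) :
    inner ℝ (y : E) e = 0 := by
  rw [real_inner_comm]; exact inner_orthogonal_span_singleton_right e y

theorem eq_orthogonalProjectionOnto_add_inner_smul {e : E} (he : ‖e‖ = 1) (x : E) :
    x = ((Submodule.span ℝ {e})ᗮ.orthogonalProjectionOnto x : E) + inner ℝ e x • e := by
  have h := Submodule.starProjection_add_starProjection_orthogonal (K := Submodule.span ℝ {e}) x
  rw [Submodule.starProjection_unit_singleton ℝ he x, add_comm] at h
  exact h.symm

/-- The area factor of `shearMap`, by the determinant of a rank one perturbation of the identity. -/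
theorem normDet_shearMap [FiniteDimensional ℝ E] {e a : E} (he : ‖e‖ = 1) (hae : 0 < inner ℝ a e) :
    (shearMap e a).normDet = ‖a‖ / inner ℝ a e := by
  set W := (Submodule.span ℝ {e})ᗮ
  let b := stdOrthonormalBasis ℝ W
  set k := inner ℝ a e
  have h := (shearMap e a).normDet_sq_eq_det_gram b
  let c : Fin (Module.finrank ℝ W) → ℝ := fun i => k⁻¹ * inner ℝ a (b i : E)
  have hgram : Matrix.gram ℝ (fun x => shearMap e a (b x)) =
      1 + Matrix.replicateCol Unit c * Matrix.replicateRow Unit c := by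
    ext i j
    rw [Matrix.gram_apply, shearMap_apply, shearMap_apply, inner_sub_left, inner_sub_right,
      inner_sub_right, inner_smul_left, inner_smul_right, inner_smul_left, inner_smul_right,
      inner_orthogonal_span_singleton_right, inner_orthogonal_span_singleton_left,
      real_inner_self_eq_norm_sq, he]
    have hb : inner ℝ (b i : E) (b j : E) = if i = j then 1 else 0 := by
      rw [← Submodule.coe_inner]; exact orthonormal_iff_ite.1 b.orthonormal i j
    rw [hb]
    simp [Matrix.one_apply, Matrix.mul_apply, c, k]
  rw [hgram, Matrix.det_one_add_replicateCol_mul_replicateRow] at h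
  have hsum : ∑ i, (inner ℝ a (b i : E)) ^ 2 = ‖a‖ ^ 2 - k ^ 2 := by
    have h1 := b.sum_sq_norm_inner_right (W.orthogonalProjectionOnto a)
    have h2 : ∀ i, inner ℝ (b i) (W.orthogonalProjectionOnto a) = inner ℝ a (b i : E) := by
      intro i
      rw [Submodule.coe_inner, real_inner_comm]
      exact Submodule.inner_orthogonalProjectionOnto_eq_of_mem_right (b i) a
    simp only [h2, Real.norm_eq_abs, sq_abs] at h1
    rw [h1]
    have h3 := eq_orthogonalProjectionOnto_add_inner_smul he a
    have h4 : ‖a‖ ^ 2 = ‖(W.orthogonalProjectionOnto a : E)‖ ^ 2 + k ^ 2 := by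
      conv_lhs => rw [h3]
      rw [← real_inner_self_eq_norm_sq, inner_add_left, inner_add_right, inner_add_right,
        inner_smul_left, inner_smul_right, inner_smul_left, inner_smul_right,
        inner_orthogonal_span_singleton_right, inner_orthogonal_span_singleton_left,
        real_inner_self_eq_norm_sq, real_inner_self_eq_norm_sq, he, real_inner_comm a e]
      simp only [conj_trivial, k]
      ring
    rw [h4, add_sub_cancel_right]; rfl
  have hdot : c ⬝ᵥ c = k⁻¹ ^ 2 * (‖a‖ ^ 2 - k ^ 2) := by
    rw [← hsum, Finset.mul_sum, dotProduct]
    exact Finset.sum_congr rfl fun i _ => by simp only [c]; ring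
  rw [hdot] at h
  have h5 : (shearMap e a).normDet ^ 2 = (‖a‖ / k) ^ 2 := by
    have : ((shearMap e a).normDet ^ 2 : ℝ) = 1 + k⁻¹ ^ 2 * (‖a‖ ^ 2 - k ^ 2) := by simpa using h
    rw [this]; field_simp; ring
  exact (pow_left_inj₀ (LinearMap.normDet_nonneg _) (by positivity) two_ne_zero).1 h5

variable [FiniteDimensional ℝ E] [MeasurableSpace E] [BorelSpace E]

/-- Near a regular point `x₀` of `ρ`, the projection along `e` of the level set `{ρ = 0}` onto `eᗮ`
changes the surface measure by a factor arbitrarily close to `⟪∇ρ, e⟫ / ‖∇ρ‖`: followed by the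
linear map from `eᗮ` to the tangent hyperplane, it is almost an isometry. -/
theorem exists_nhds_area_projection {e a x₀ : E} {ρ : E → ℝ} (he : ‖e‖ = 1)
    (hae : 0 < inner ℝ a e) (hρ : HasStrictFDerivAt ρ (innerSL ℝ a) x₀) {c : ℝ} (hc : 1 < c)
    {d : ℕ} (hd : Module.finrank ℝ (Submodule.span ℝ {e})ᗮ = d) :
    ∃ U ∈ 𝓝 x₀, ∀ A ⊆ U, (∀ x ∈ A, ρ x = 0) →
      ENNReal.ofReal (‖a‖ / inner ℝ a e) *
        volume ((Submodule.span ℝ {e})ᗮ.orthogonalProjectionOnto '' A)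
          ≤ ENNReal.ofReal (c ^ d) * μHE[d] A ∧
      μHE[d] A ≤ ENNReal.ofReal (c ^ d) * (ENNReal.ofReal (‖a‖ / inner ℝ a e) *
        volume ((Submodule.span ℝ {e})ᗮ.orthogonalProjectionOnto '' A)) := by
  set W := (Submodule.span ℝ {e})ᗮ with hW
  set k := inner ℝ a e
  have hc0 : 0 < c := by linarith
  have hε : 0 < 1 - c⁻¹ := by
    have := inv_lt_one_of_one_lt₀ hc
    linarith
  have hlo := (hρ.isLittleO.bound (mul_pos hε hae))
  rw [nhds_prod_eq] at hlo
  obtain ⟨U, hU, hUlo⟩ := (eventually_prod_self_iff'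
    (r := fun p : E × E => ‖ρ p.1 - ρ p.2 - innerSL ℝ a (p.1 - p.2)‖ ≤
      (1 - c⁻¹) * k * ‖p.1 - p.2‖)).1 hlo
  refine ⟨U, hU, fun A hAU hA => ?_⟩
  -- `g` moves points of the level set along `e` to the tangent hyperplane at `x₀`
  let g : E → E := fun x => shearMap e a (W.orthogonalProjectionOnto x)
  have hg : ∀ x ∈ A, ∀ y ∈ A, ‖(x - y) - (g x - g y)‖ ≤ (1 - c⁻¹) * ‖x - y‖ := by
    intro x hx y hy
    have h1 := hUlo x (hAU hx) y (hAU hy)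
    simp only [hA x hx, hA y hy, sub_self, zero_sub, norm_neg, innerSL_apply_apply] at h1
    have h2 : (x - y) - (g x - g y) = (k⁻¹ * inner ℝ a (x - y)) • e := by
      have h3 : g x - g y = shearMap e a (W.orthogonalProjectionOnto (x - y)) := by
        simp [g, map_sub]
      have h4 := eq_orthogonalProjectionOnto_add_inner_smul he (x - y)
      rw [h3, shearMap_apply]
      generalize hz : x - y = z at *
      have h5 : inner ℝ a z = inner ℝ a (W.orthogonalProjectionOnto z : E) + inner ℝ e z * k := by
        conv_lhs => rw [h4]
        rw [inner_add_right, inner_smul_right]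
      rw [h5, mul_add]
      nth_rw 1 [h4]
      have h6 : k⁻¹ * (inner ℝ e z * k) = inner ℝ e z := by field_simp
      rw [h6, add_smul]
      abel
    rw [h2, norm_smul, he, mul_one, norm_mul, norm_inv, Real.norm_of_nonneg hae.le]
    calc k⁻¹ * ‖inner ℝ a (x - y)‖ ≤ k⁻¹ * ((1 - c⁻¹) * k * ‖x - y‖) := by gcongr
      _ = _ := by field_simp
  have hup : ∀ x ∈ A, ∀ y ∈ A, ‖g x - g y‖ ≤ c * ‖x - y‖ := by
    intro x hx y hy
    have h1 := hg x hx y hy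
    have h2 : ‖g x - g y‖ ≤ ‖x - y‖ + ‖(x - y) - (g x - g y)‖ := by
      have := norm_sub_le (x - y) ((x - y) - (g x - g y))
      simpa using this
    have h3 : (2 - c⁻¹) ≤ c := by
      have : c * c⁻¹ = 1 := by field_simp
      nlinarith [sq_nonneg (c - 1), inv_pos.2 hc0]
    nlinarith [norm_nonneg (x - y)]
  have hlow : ∀ x ∈ A, ∀ y ∈ A, ‖x - y‖ ≤ c * ‖g x - g y‖ := by
    intro x hx y hy
    have h1 := hg x hx y hy
    have h2 : ‖x - y‖ ≤ ‖g x - g y‖ + ‖(x - y) - (g x - g y)‖ := by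
      have := norm_add_le (g x - g y) ((x - y) - (g x - g y))
      simpa using this
    have h3 : c⁻¹ * ‖x - y‖ ≤ ‖g x - g y‖ := by linarith
    calc ‖x - y‖ = c * (c⁻¹ * ‖x - y‖) := by field_simp
      _ ≤ _ := by gcongr
  have hgA : g '' A = shearMap e a '' (W.orthogonalProjectionOnto '' A) := by
    rw [image_image]
  have hmeas : μHE[d] (g '' A) = ENNReal.ofReal (‖a‖ / k) *
      volume (W.orthogonalProjectionOnto '' A) := by
    rw [hgA, ← normDet_shearMap he hae]
    subst hd
    exact LinearMap.euclideanHausdorffMeasure_image_eq_normDet_mul_volume _ _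
  have hcd : ENNReal.ofReal (c ^ d) = ((c.toNNReal : NNReal) : ENNReal) ^ d := by
    rw [ENNReal.ofReal_pow hc0.le]; rfl
  rw [← hmeas, hcd]
  constructor
  · refine LipschitzOnWith.euclideanHausdorffMeasure_image_le ?_ d
    refine LipschitzOnWith.of_dist_le_mul fun x hx y hy => ?_
    rw [dist_eq_norm, dist_eq_norm, Real.coe_toNNReal _ hc0.le]
    exact hup x hx y hy
  · have hinj : InjOn g A := by
      intro x hx y hy hxy
      have := hlow x hx y hy
      rw [hxy, sub_self, norm_zero, mul_zero] at this
      exact sub_eq_zero.1 (norm_le_zero_iff.1 this)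
    rcases isEmpty_or_nonempty E with hE | hE
    · have : A = ∅ := eq_empty_of_isEmpty A
      simp [this]
    have hAeq : Function.invFunOn g A '' (g '' A) = A := by
      exact hinj.invFunOn_image subset_rfl
    conv_lhs => rw [← hAeq]
    refine LipschitzOnWith.euclideanHausdorffMeasure_image_le ?_ d
    refine LipschitzOnWith.of_dist_le_mul ?_
    rintro _ ⟨x, hx, rfl⟩ _ ⟨y, hy, rfl⟩
    rw [dist_eq_norm, dist_eq_norm, Real.coe_toNNReal _ hc0.le,
      hinj.leftInvOn_invFunOn hx, hinj.leftInvOn_invFunOn hy]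
    exact hlow x hx y hy

end Graph

/-! ### The divergence theorem near a level set -/

section Chart

theorem integral_deriv_eq_zero_of_hasCompactSupport {u : ℝ → ℝ} (hu : ContDiff ℝ 1 u)
    (hc : HasCompactSupport u) : ∫ s, deriv u s = 0 := by
  have hi : Integrable (deriv u) :=
    (hu.continuous_deriv le_rfl).integrable_of_hasCompactSupport hc.deriv
  rw [← intervalIntegral.integral_Iic_add_Ioi (b := 0) hi.integrableOn hi.integrableOn,
    hc.integral_Iic_deriv_eq hu, hc.integral_Ioi_deriv_eq hu]
  simp

/-- The one-dimensional flux formula at a zero of the defining function. -/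
theorem setIntegral_deriv_eq_of_zero {u r : ℝ → ℝ} {I P : Set ℝ} (hu : ContDiff ℝ 1 u)
    (hc : HasCompactSupport u) (huI : tsupport u ⊆ I) (hr : StrictMonoOn r I)
    (hP : ∀ s ∈ I, s ∈ P ↔ r s < 0) (hPm : MeasurableSet P) {s₀ : ℝ} (hs₀ : s₀ ∈ I)
    (hr₀ : r s₀ = 0) : ∫ s in P, deriv u s = u s₀ := by
  rw [← hc.integral_Iic_deriv_eq hu s₀, integral_Iic_eq_integral_Iio,
    ← integral_indicator hPm, ← integral_indicator measurableSet_Iio]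
  congr 1
  ext s
  by_cases hs : s ∈ I
  · have : s ∈ P ↔ s ∈ Iio s₀ := by
      rw [hP s hs, mem_Iio, ← hr₀, hr.lt_iff_lt hs hs₀]
    by_cases h : s ∈ Iio s₀
    · rw [indicator_of_mem h, indicator_of_mem (this.2 h)]
    · rw [indicator_of_notMem h, indicator_of_notMem (fun h' => h (this.1 h'))]
  · have : deriv u s = 0 := by
      have : s ∉ tsupport (deriv u) := fun h => hs (huI (tsupport_deriv_subset h))
      exact image_eq_zero_of_notMem_tsupport this
    simp [indicator_apply, this]

/-- The one-dimensional flux formula on a line that does not meet the boundary. -/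
theorem setIntegral_deriv_eq_zero_of_ne_zero {u r : ℝ → ℝ} {I P : Set ℝ} (hu : ContDiff ℝ 1 u)
    (hc : HasCompactSupport u) (huI : tsupport u ⊆ I) (hr : ContinuousOn r I)
    (hI : IsPreconnected I) (hP : ∀ s ∈ I, s ∈ P ↔ r s < 0) (hPm : MeasurableSet P)
    (h0 : ∀ s ∈ I, r s ≠ 0) : ∫ s in P, deriv u s = 0 := by
  have hd : ∀ s, s ∉ I → deriv u s = 0 := fun s hs =>
    image_eq_zero_of_notMem_tsupport fun h => hs (huI (tsupport_deriv_subset h))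
  by_cases hneg : ∃ s ∈ I, r s < 0
  · obtain ⟨s₁, hs₁, hr₁⟩ := hneg
    have hall : ∀ s ∈ I, r s < 0 := by
      intro s hs
      by_contra hcon
      have hpos : 0 ≤ r s := not_lt.1 hcon
      obtain ⟨t, ht, hrt⟩ := hI.intermediate_value hs₁ hs hr ⟨hr₁.le, hpos⟩
      exact h0 t ht hrt
    rw [← integral_deriv_eq_zero_of_hasCompactSupport hu hc, ← integral_indicator hPm]
    congr 1
    ext s
    by_cases hs : s ∈ I
    · rw [indicator_of_mem ((hP s hs).2 (hall s hs))]
    · simp [hd s hs]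
  · rw [← integral_indicator hPm]
    have : P.indicator (deriv u) = fun _ => 0 := by
      ext s
      by_cases hs : s ∈ I
      · exact indicator_of_notMem (fun h => hneg ⟨s, hs, (hP s hs).1 h⟩) _
      · simp [hd s hs]
    rw [this]; simp

variable {E : Type*} [NormedAddCommGroup E] [InnerProductSpace ℝ E] [FiniteDimensional ℝ E]

theorem inner_gradient_eq_fderiv (ρ : E → ℝ) (x v : E) :
    inner ℝ (gradient ρ x) v = fderiv ℝ ρ x v := by
  rw [gradient, InnerProductSpace.toDual_symm_apply]

theorem hasStrictFDerivAt_innerSL_gradient {ρ : E → ℝ} (hρ : ContDiff ℝ 1 ρ) (x : E) :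
    HasStrictFDerivAt ρ (innerSL ℝ (gradient ρ x)) x := by
  have h := hρ.contDiffAt.hasStrictFDerivAt (x := x) one_ne_zero
  convert! h using 1
  ext v
  exact inner_gradient_eq_fderiv ρ x v

theorem continuous_gradient {ρ : E → ℝ} (hρ : ContDiff ℝ 1 ρ) : Continuous (gradient ρ) :=
  (InnerProductSpace.toDual ℝ E).symm.continuous.comp (hρ.continuous_fderiv one_ne_zero)

variable {e : E} {ρ : E → ℝ} {U : Set E}

theorem strictMonoOn_along_direction (hρ : ContDiff ℝ 1 ρ) (hU : IsOpen U) (hUc : Convex ℝ U)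
    (hpos : ∀ x ∈ U, 0 < inner ℝ (gradient ρ x) e) (y : E) :
    Convex ℝ {s : ℝ | s • e + y ∈ U} ∧ StrictMonoOn (fun s : ℝ => ρ (s • e + y))
      {s : ℝ | s • e + y ∈ U} := by
  have hconv : Convex ℝ {s : ℝ | s • e + y ∈ U} := by
    intro s hs t ht a b ha hb hab
    have := hUc hs ht ha hb hab
    have heq : (a • s + b • t) • e + y = a • (s • e + y) + b • (t • e + y) := by
      have hy : y = a • y + b • y := by rw [← add_smul, hab, one_smul]
      conv_lhs => rw [hy]
      simp only [smul_eq_mul, add_smul, mul_smul, smul_add]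
      abel
    simpa only [mem_ofPred_eq, heq] using this
  have hopen : IsOpen {s : ℝ | s • e + y ∈ U} :=
    hU.preimage (by fun_prop : Continuous fun s : ℝ => s • e + y)
  have hder : ∀ s : ℝ, HasDerivAt (fun s : ℝ => ρ (s • e + y)) (fderiv ℝ ρ (s • e + y) e) s := by
    intro s
    have h1 : HasDerivAt (fun s : ℝ => s • e + y) e s := by
      simpa using ((hasDerivAt_id s).smul_const e).add_const y
    exact ((hρ.differentiable one_ne_zero _).hasFDerivAt).comp_hasDerivAt s h1
  refine ⟨hconv, strictMonoOn_of_deriv_pos hconv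
    (fun s _ => (hder s).continuousAt.continuousWithinAt) fun s hs => ?_⟩
  rw [hopen.interior_eq] at hs
  rw [(hder s).deriv, ← inner_gradient_eq_fderiv]
  exact hpos _ hs

theorem injOn_projection_level_set (he : ‖e‖ = 1) (hρ : ContDiff ℝ 1 ρ) (hU : IsOpen U)
    (hUc : Convex ℝ U) (hpos : ∀ x ∈ U, 0 < inner ℝ (gradient ρ x) e) :
    InjOn (Submodule.span ℝ {e})ᗮ.orthogonalProjectionOnto {x | x ∈ U ∧ ρ x = 0} := by
  intro x hx x' hx' hxx'
  have h1 := eq_orthogonalProjectionOnto_add_inner_smul he x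
  have h2 := eq_orthogonalProjectionOnto_add_inner_smul he x'
  rw [← hxx'] at h2
  set y : E := ((Submodule.span ℝ {e})ᗮ.orthogonalProjectionOnto x : E)
  rw [add_comm] at h1 h2
  have hinj := (strictMonoOn_along_direction hρ hU hUc hpos y).2.injOn
  have hmem : inner ℝ e x ∈ {s : ℝ | s • e + y ∈ U} := by
    change inner ℝ e x • e + y ∈ U; rw [← h1]; exact hx.1
  have hmem' : inner ℝ e x' ∈ {s : ℝ | s • e + y ∈ U} := by
    change inner ℝ e x' • e + y ∈ U; rw [← h2]; exact hx'.1
  have hs : inner ℝ e x = inner ℝ e x' := by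
    refine hinj hmem hmem' ?_
    change ρ (inner ℝ e x • e + y) = ρ (inner ℝ e x' • e + y)
    rw [← h1, ← h2, hx.2, hx'.2]
  rw [h1, h2, hs]

variable [MeasurableSpace E] [BorelSpace E]

/-- The orthogonal splitting `(s, y) ↦ s • e + y` of `E` along a unit vector `e`. -/
def lineSplitting (e : E) (he : ‖e‖ = 1) : ℝ × (Submodule.span ℝ {e})ᗮ ≃ᵐ E :=
  (MeasurableEquiv.prodCongr (LinearIsometryEquiv.toSpanUnitSingleton (𝕜 := ℝ) e
    he).toHomeomorph.toMeasurableEquiv (MeasurableEquiv.refl _)).trans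
    ((Submodule.span ℝ {e}).measurableEquivProd (0 : E)).symm

theorem lineSplitting_apply (e : E) (he : ‖e‖ = 1) (z : ℝ × (Submodule.span ℝ {e})ᗮ) :
    lineSplitting e he z = z.1 • e + (z.2 : E) := by
  rw [lineSplitting, MeasurableEquiv.trans_apply, Submodule.measurableEquivProd_symm_apply]
  simp [MeasurableEquiv.prodCongr]

theorem measurePreserving_lineSplitting (e : E) (he : ‖e‖ = 1) :
    MeasurePreserving (lineSplitting e he) := by
  have h1 := (Submodule.span ℝ {e}).measurePreserving_measurableEquivProd (0 : E)
  rw [InnerProductSpace.euclideanHausdorffMeasure_eq_volume] at h1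
  have h2 : MeasurePreserving (LinearIsometryEquiv.toSpanUnitSingleton (𝕜 := ℝ) e he) :=
    LinearIsometryEquiv.measurePreserving _
  exact h1.symm.comp (h2.prod (MeasurePreserving.id _))

/-- The area formula for the projection of a level set onto the hyperplane `eᗮ`. -/
theorem comap_projection_volume_eq_withDensity {S : Set E} (he : ‖e‖ = 1)
    (hρ : ContDiff ℝ 1 ρ) (hS : MeasurableSet S) (hS0 : ∀ x ∈ S, ρ x = 0)
    (hpos : ∀ x ∈ S, 0 < inner ℝ (gradient ρ x) e)
    (hinj : InjOn (Submodule.span ℝ {e})ᗮ.orthogonalProjectionOnto S)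
    {d : ℕ} (hd : Module.finrank ℝ (Submodule.span ℝ {e})ᗮ = d) :
    Measure.comap (S.domRestrict (Submodule.span ℝ {e})ᗮ.orthogonalProjectionOnto) volume =
      (Measure.comap ((↑) : S → E) μHE[d]).withDensity
        fun x => ENNReal.ofReal (inner ℝ (gradient ρ x) e / ‖gradient ρ x‖) := by
  set W := (Submodule.span ℝ {e})ᗮ
  have hemb : MeasurableEmbedding (S.domRestrict W.orthogonalProjectionOnto) :=
    ContinuousOn.measurableEmbedding hS W.orthogonalProjectionOnto.continuous.continuousOn hinj
  refine Measure.eq_of_locally_le (d + 1) fun c hc x₀ => ?_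
  have hc0 : 0 < c := by linarith
  set a := gradient ρ x₀
  have hk : 0 < inner ℝ a e := hpos x₀ x₀.2
  have ha : 0 < ‖a‖ := by
    rw [norm_pos_iff]; intro h; simp [h] at hk
  set κ : E → ℝ := fun x => inner ℝ (gradient ρ x) e / ‖gradient ρ x‖
  have hκ0 : 0 < κ x₀ := div_pos hk ha
  obtain ⟨U, hU, hUA⟩ := exists_nhds_area_projection he hk
    (hasStrictFDerivAt_innerSL_gradient hρ x₀) hc hd
  have hcont : ContinuousAt κ x₀ := by
    have hg := (continuous_gradient hρ).continuousAt (x := (x₀ : E))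
    exact (hg.inner continuousAt_const).div hg.norm ha.ne'
  have hV : ∀ᶠ x in 𝓝 (x₀ : E), κ x₀ / c < κ x ∧ κ x < c * κ x₀ :=
    (hcont.eventually (lt_mem_nhds (div_lt_self hκ0 hc))).and
      (hcont.eventually (gt_mem_nhds (by nlinarith)))
  refine ⟨Subtype.val ⁻¹' (U ∩ {x | κ x₀ / c < κ x ∧ κ x < c * κ x₀}),
    continuous_subtype_val.continuousAt.preimage_mem_nhds (inter_mem hU hV), fun A hAU hA => ?_⟩
  set B : Set E := Subtype.val '' A
  have hBU : B ⊆ U := by rintro _ ⟨x, hx, rfl⟩; exact (hAU hx).1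
  have hB0 : ∀ x ∈ B, ρ x = 0 := by rintro _ ⟨x, hx, rfl⟩; exact hS0 x x.2
  obtain ⟨h1, h2⟩ := hUA B hBU hB0
  have hm1 : Measure.comap (S.domRestrict W.orthogonalProjectionOnto) volume A =
      volume (W.orthogonalProjectionOnto '' B) := by
    rw [hemb.comap_apply]
    congr 1
    simp only [B, image_image]
    rfl
  have hcm : Measure.comap ((↑) : S → E) μHE[d] A = μHE[d] B :=
    (MeasurableEmbedding.subtype_coe hS).comap_apply _ _
  rw [hm1, withDensity_apply _ hA]
  have hup : ∫⁻ x in A, ENNReal.ofReal (κ x) ∂(Measure.comap ((↑) : S → E) μHE[d]) ≤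
      ENNReal.ofReal (c * κ x₀) * μHE[d] B := by
    rw [← hcm, ← setLIntegral_const]
    exact setLIntegral_mono measurable_const fun x hx => ENNReal.ofReal_le_ofReal (hAU hx).2.2.le
  have hlow : ENNReal.ofReal (κ x₀ / c) * μHE[d] B ≤
      ∫⁻ x in A, ENNReal.ofReal (κ x) ∂(Measure.comap ((↑) : S → E) μHE[d]) := by
    rw [← hcm, ← setLIntegral_const]
    exact setLIntegral_mono' hA fun x hx => ENNReal.ofReal_le_ofReal (hAU hx).2.1.le
  have hJ : ENNReal.ofReal (κ x₀) * ENNReal.ofReal (‖a‖ / inner ℝ a e) = 1 := by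
    rw [← ENNReal.ofReal_mul hκ0.le]
    have : κ x₀ * (‖a‖ / inner ℝ a e) = 1 := by
      change inner ℝ a e / ‖a‖ * (‖a‖ / inner ℝ a e) = 1
      field_simp
    rw [this, ENNReal.ofReal_one]
  constructor
  · calc volume (W.orthogonalProjectionOnto '' B)
        = ENNReal.ofReal (κ x₀) * (ENNReal.ofReal (‖a‖ / inner ℝ a e) *
          volume (W.orthogonalProjectionOnto '' B)) := by rw [← mul_assoc, hJ, one_mul]
      _ ≤ ENNReal.ofReal (κ x₀) * (ENNReal.ofReal (c ^ d) * μHE[d] B) := by gcongr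
      _ = ENNReal.ofReal (c ^ (d + 1)) * (ENNReal.ofReal (κ x₀ / c) * μHE[d] B) := by
          rw [← mul_assoc, ← mul_assoc, ← ENNReal.ofReal_mul hκ0.le,
            ← ENNReal.ofReal_mul (by positivity)]
          congr 2
          field_simp
          ring
      _ ≤ _ := by gcongr
  · calc _ ≤ ENNReal.ofReal (c * κ x₀) * μHE[d] B := hup
      _ ≤ ENNReal.ofReal (c * κ x₀) * (ENNReal.ofReal (c ^ d) *
          (ENNReal.ofReal (‖a‖ / inner ℝ a e) *
            volume (W.orthogonalProjectionOnto '' B))) := by gcongr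
      _ = ENNReal.ofReal (c ^ (d + 1)) * (ENNReal.ofReal (κ x₀) *
          ENNReal.ofReal (‖a‖ / inner ℝ a e)) * volume (W.orthogonalProjectionOnto '' B) := by
          rw [ENNReal.ofReal_mul hc0.le, pow_succ, ENNReal.ofReal_mul (by positivity)]
          ring
      _ = _ := by rw [hJ, mul_one]

/-- The divergence theorem in the direction `e` for functions supported in a convex open set in
which the domain is the sublevel set of a function increasing in the direction `e`. -/
theorem setIntegral_fderiv_eq_level_set {Ω : Set E} (hΩm : MeasurableSet Ω) (he : ‖e‖ = 1)
    (hρ : ContDiff ℝ 1 ρ) (hU : IsOpen U) (hUc : Convex ℝ U)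
    (hpos : ∀ x ∈ U, 0 < inner ℝ (gradient ρ x) e) (hΩ : ∀ x ∈ U, x ∈ Ω ↔ ρ x < 0)
    {d : ℕ} (hd : Module.finrank ℝ (Submodule.span ℝ {e})ᗮ = d)
    {φ : E → ℝ} (hφ : ContDiff ℝ 1 φ) (hφc : HasCompactSupport φ) (hφU : tsupport φ ⊆ U) :
    ∫ x in Ω, fderiv ℝ φ x e =
      ∫ x in {x | x ∈ U ∧ ρ x = 0}, φ x * (inner ℝ (gradient ρ x) e / ‖gradient ρ x‖) ∂μHE[d] := by
  set W := (Submodule.span ℝ {e})ᗮ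
  set S : Set E := {x | x ∈ U ∧ ρ x = 0} with hSdef
  have hS : MeasurableSet S :=
    hU.measurableSet.inter (isClosed_eq hρ.continuous continuous_const).measurableSet
  have hinj : InjOn W.orthogonalProjectionOnto S := injOn_projection_level_set he hρ hU hUc hpos
  set f := S.domRestrict W.orthogonalProjectionOnto
  have hemb : MeasurableEmbedding f :=
    ContinuousOn.measurableEmbedding hS W.orthogonalProjectionOnto.continuous.continuousOn hinj
  -- the value on `S` of `φ`, transported to the hyperplane and extended by zero
  let g : W → ℝ := Function.extend f (fun x : S => φ x) 0
  have hcs : HasCompactSupport fun x => fderiv ℝ φ x e := hφc.fderiv_apply (𝕜 := ℝ) e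
  have hcont : Continuous fun x => fderiv ℝ φ x e :=
    (hφ.continuous_fderiv one_ne_zero).clm_apply continuous_const
  have hint : Integrable (Ω.indicator fun x => fderiv ℝ φ x e) :=
    (hcont.integrable_of_hasCompactSupport hcs).indicator hΩm
  have hΦ := measurePreserving_lineSplitting e he
  have hline : ∀ y : W, ∫ s : ℝ, Ω.indicator (fun x => fderiv ℝ φ x e)
      (lineSplitting e he (s, y)) = g y := by
    intro y
    have hcl : Continuous fun s : ℝ => s • e + (y : E) := by fun_prop
    have hce : Topology.IsClosedEmbedding fun s : ℝ => s • e + (y : E) := by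
      refine Isometry.isClosedEmbedding (Isometry.of_dist_eq fun s t => ?_)
      rw [dist_add_right, dist_eq_norm, ← sub_smul, norm_smul, he, mul_one, dist_eq_norm]
    set u : ℝ → ℝ := fun s => φ (s • e + (y : E))
    have hder : ∀ s : ℝ, HasDerivAt u (fderiv ℝ φ (s • e + (y : E)) e) s := by
      intro s
      have h1 : HasDerivAt (fun s : ℝ => s • e + (y : E)) e s := by
        simpa using ((hasDerivAt_id s).smul_const e).add_const (y : E)
      exact ((hφ.differentiable one_ne_zero _).hasFDerivAt).comp_hasDerivAt s h1
    have hu : ContDiff ℝ 1 u := hφ.comp (by fun_prop)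
    have huc : HasCompactSupport u := hφc.comp_isClosedEmbedding hce
    set I : Set ℝ := {s : ℝ | s • e + (y : E) ∈ U}
    have huI : tsupport u ⊆ I := fun s hs => hφU (tsupport_comp_subset_preimage φ hcl hs)
    obtain ⟨hIc, hmono⟩ := strictMonoOn_along_direction hρ hU hUc hpos (y : E)
    set P : Set ℝ := (fun s : ℝ => s • e + (y : E)) ⁻¹' Ω
    have hPm : MeasurableSet P := hcl.measurable hΩm
    have hP : ∀ s ∈ I, s ∈ P ↔ ρ (s • e + (y : E)) < 0 := fun s hs => hΩ _ hs
    have hlhs : ∫ s : ℝ, Ω.indicator (fun x => fderiv ℝ φ x e) (lineSplitting e he (s, y)) =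
        ∫ s in P, deriv u s := by
      rw [← integral_indicator hPm]
      congr 1
      ext s
      rw [lineSplitting_apply]
      by_cases hs : s • e + (y : E) ∈ Ω
      · rw [indicator_of_mem hs, indicator_of_mem (show s ∈ P from hs), (hder s).deriv]
      · rw [indicator_of_notMem hs, indicator_of_notMem (show s ∉ P from hs)]
    have hproj : ∀ s : ℝ, W.orthogonalProjectionOnto (s • e + (y : E)) = y := by
      intro s
      rw [map_add, map_smul, Submodule.orthogonalProjectionOnto_mem_subspace_eq_self,
        Submodule.orthogonalProjectionOnto_orthogonal_apply_eq_zero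
          (Submodule.mem_span_singleton_self e)]
      simp
    rw [hlhs]
    by_cases hz : ∃ s ∈ I, ρ (s • e + (y : E)) = 0
    · obtain ⟨s₀, hs₀, hr₀⟩ := hz
      rw [setIntegral_deriv_eq_of_zero hu huc huI hmono hP hPm hs₀ hr₀]
      have hy : y = f ⟨s₀ • e + (y : E), hs₀, hr₀⟩ := (hproj s₀).symm
      simp only [g]
      conv_rhs => rw [hy]
      rw [hemb.injective.extend_apply]
    · push Not at hz
      rw [setIntegral_deriv_eq_zero_of_ne_zero hu huc huI (hρ.continuous.comp hcl).continuousOn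
        hIc.isPreconnected hP hPm hz]
      have hy : ¬ ∃ x, f x = y := by
        rintro ⟨⟨x, hxU, hx0⟩, hxy⟩
        have h1 := eq_orthogonalProjectionOnto_add_inner_smul he x
        have hxy' : W.orthogonalProjectionOnto x = y := hxy
        rw [hxy', add_comm] at h1
        refine hz (inner ℝ e x) ?_ ?_
        · change inner ℝ e x • e + (y : E) ∈ U; rw [← h1]; exact hxU
        · rw [← h1]; exact hx0
      simp only [g]
      rw [Function.extend_apply' _ _ _ hy]; rfl
  have hfub : ∫ x in Ω, fderiv ℝ φ x e = ∫ y, g y := by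
    rw [← integral_indicator hΩm, ← hΦ.integral_comp (lineSplitting e he).measurableEmbedding,
      Measure.volume_eq_prod, integral_prod_symm]
    · exact integral_congr_ae (Eventually.of_forall hline)
    · have := (hΦ.integrable_comp_emb (lineSplitting e he).measurableEmbedding).2 hint
      exact this
  have hrange : ∫ y, g y = ∫ y in range f, g y := by
    refine (setIntegral_eq_integral_of_forall_compl_eq_zero fun y hy => ?_).symm
    exact Function.extend_apply' _ _ _ hy
  have hdens := comap_projection_volume_eq_withDensity he hρ hS (fun x hx => hx.2)
    (fun x hx => hpos x hx.1) hinj hd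
  have hmeasκ : Measurable fun x : E => inner ℝ (gradient ρ x) e / ‖gradient ρ x‖ := by
    have := (continuous_gradient hρ).measurable
    exact (this.inner measurable_const).div this.norm
  rw [hfub, hrange, ← hemb.map_comap, hemb.integral_map, hdens,
    integral_withDensity_eq_integral_toReal_smul
      (f := fun x : S => ENNReal.ofReal (inner ℝ (gradient ρ x) e / ‖gradient ρ x‖))
      (hmeasκ.ennreal_ofReal.comp measurable_subtype_coe) (by simp),
    ← integral_subtype_comap hS]
  refine integral_congr_ae (Eventually.of_forall fun x => ?_)
  simp only [g, hemb.injective.extend_apply]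
  rw [ENNReal.toReal_ofReal (div_nonneg (hpos x x.2.1).le (norm_nonneg _)), smul_eq_mul, mul_comm]

end Chart

/-! ### The outward normal and the divergence theorem on a smooth bounded domain -/

section Boundary

theorem eventually_neg_of_inner_gradient_pos {E : Type*} [NormedAddCommGroup E]
    [InnerProductSpace ℝ E] [FiniteDimensional ℝ E] {ρ : E → ℝ} (hρ : ContDiff ℝ 1 ρ) {p e : E}
    (hp : ρ p = 0) (he : 0 < inner ℝ (gradient ρ p) e) :
    ∀ᶠ t : ℝ in 𝓝[>] 0, ρ (p - t • e) < 0 := by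
  have hder : HasDerivAt (fun t : ℝ => ρ (p - t • e)) (fderiv ℝ ρ p (-e)) 0 := by
    have h1 : HasDerivAt (fun t : ℝ => p - t • e) (-e) 0 := by
      simpa using ((hasDerivAt_id (0 : ℝ)).smul_const e).const_sub p
    have h2 : HasFDerivAt ρ (fderiv ℝ ρ p) (p - (0 : ℝ) • e) := by
      simpa using (hρ.differentiable one_ne_zero p).hasFDerivAt
    exact h2.comp_hasDerivAt (0 : ℝ) h1
  have hneg : fderiv ℝ ρ p (-e) < 0 := by
    rw [map_neg, ← inner_gradient_eq_fderiv]; linarith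
  have hsl := (hasDerivAt_iff_tendsto_slope.1 hder).eventually (gt_mem_nhds hneg)
  have hsl' := hsl.filter_mono (nhdsWithin_mono 0 (fun t (ht : 0 < t) => ht.ne'))
  filter_upwards [hsl', self_mem_nhdsWithin] with t ht ht0
  rw [slope_def_field] at ht
  have ht0' : 0 < t - 0 := by simpa using ht0
  have := (div_neg_iff.1 ht).resolve_left (by rintro ⟨_, h⟩; linarith)
  simpa [hp] using this.1

variable {n : ℕ} {Ω : Set (EuclideanSpace ℝ (Fin n))} {p : EuclideanSpace ℝ (Fin n)}
  {ρ ρ' : EuclideanSpace ℝ (Fin n) → ℝ}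

theorem IsDefiningFunctionAt.eq_zero (h : IsDefiningFunctionAt Ω p ρ) (hΩ : IsOpen Ω)
    (hp : p ∈ frontier Ω) : ρ p = 0 := by
  have hpn : p ∉ Ω := by
    rw [hΩ.frontier_eq] at hp; exact hp.2
  refine le_antisymm ?_ (not_lt.1 fun h0 => hpn (h.2.2.self_of_nhds.2 h0))
  have hcl : p ∈ closure Ω := frontier_subset_closure hp
  by_contra hcon
  have h1 : ∀ᶠ x in 𝓝 p, 0 < ρ x :=
    h.1.continuous.continuousAt.eventually (lt_mem_nhds (not_le.1 hcon))
  obtain ⟨x, hx, h2, h3⟩ := ((mem_closure_iff_frequently.1 hcl).and_eventually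
    (h1.and h.2.2)).exists
  have := h3.1 hx
  linarith

theorem IsDefiningFunctionAt.eventually (h : IsDefiningFunctionAt Ω p ρ) :
    ∀ᶠ x in 𝓝 p, IsDefiningFunctionAt Ω x ρ := by
  have hc := (continuous_gradient (h.1.of_le (by simp : (1 : WithTop ℕ∞) ≤ ∞))).continuousAt (x := p)
  filter_upwards [eventually_eventually_nhds.2 h.2.2, hc.eventually_ne h.2.1] with x hx hx'
  exact ⟨h.1, hx', hx⟩

theorem IsDefiningFunctionAt.mem_frontier (h : IsDefiningFunctionAt Ω p ρ) (hΩ : IsOpen Ω)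
    (hp : ρ p = 0) : p ∈ frontier Ω := by
  rw [hΩ.frontier_eq]
  refine ⟨?_, fun hpΩ => ?_⟩
  · have hpos : 0 < inner ℝ (gradient ρ p) (gradient ρ p) := by
      rw [real_inner_self_eq_norm_sq]
      have := norm_pos_iff.2 h.2.1
      positivity
    have h1 := eventually_neg_of_inner_gradient_pos (h.1.of_le (by simp)) hp hpos
    have hlim : Tendsto (fun t : ℝ => p - t • gradient ρ p) (𝓝[>] 0) (𝓝 p) := by
      have : Tendsto (fun t : ℝ => p - t • gradient ρ p) (𝓝 0) (𝓝 (p - (0 : ℝ) • gradient ρ p)) :=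
        (by fun_prop : Continuous fun t : ℝ => p - t • gradient ρ p).tendsto 0
      rw [zero_smul, sub_zero] at this
      exact this.mono_left nhdsWithin_le_nhds
    refine mem_closure_of_tendsto hlim ?_
    filter_upwards [h1, hlim.eventually h.2.2] with t ht ht'
    exact ht'.2 ht
  · have := h.2.2.self_of_nhds.1 hpΩ
    linarith

/-- A direction that points out of the domain according to one defining function does not point into
it according to another. -/
theorem IsDefiningFunctionAt.inner_nonneg (h : IsDefiningFunctionAt Ω p ρ)
    (h' : IsDefiningFunctionAt Ω p ρ') (hΩ : IsOpen Ω) (hp : p ∈ frontier Ω)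
    {e : EuclideanSpace ℝ (Fin n)} (he : 0 < inner ℝ (gradient ρ p) e) :
    0 ≤ inner ℝ (gradient ρ' p) e := by
  by_contra hcon
  have hneg : 0 < inner ℝ (gradient ρ' p) (-e) := by
    rw [inner_neg_right]; linarith
  have h1 := eventually_neg_of_inner_gradient_pos (h.1.of_le (by simp)) (h.eq_zero hΩ hp) he
  -- `-ρ'` has the gradient `-∇ρ'`, so `ρ'` is positive at `p - t e`
  have hm : ContDiff ℝ 1 fun x => -ρ' x := (h'.1.of_le (by simp)).neg
  have hg : inner ℝ (gradient (fun x => -ρ' x) p) e = - inner ℝ (gradient ρ' p) e := by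
    rw [inner_gradient_eq_fderiv, inner_gradient_eq_fderiv]
    have : fderiv ℝ (fun x => -ρ' x) p = - fderiv ℝ ρ' p := fderiv_neg
    rw [this]; rfl
  have h2 := eventually_neg_of_inner_gradient_pos hm (p := p) (e := e)
    (by rw [h'.eq_zero hΩ hp, neg_zero]) (by rw [hg]; linarith)
  have hlim : Tendsto (fun t : ℝ => p - t • e) (𝓝[>] 0) (𝓝 p) := by
    have : Tendsto (fun t : ℝ => p - t • e) (𝓝 0) (𝓝 (p - (0 : ℝ) • e)) :=
      (by fun_prop : Continuous fun t : ℝ => p - t • e).tendsto 0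
    rw [zero_smul, sub_zero] at this
    exact this.mono_left nhdsWithin_le_nhds
  obtain ⟨t, ha, hb, hc, hd⟩ := (h1.and (h2.and ((hlim.eventually h.2.2).and
    (hlim.eventually h'.2.2)))).exists
  have := hd.1 (hc.2 ha)
  linarith

/-- The outward normal does not depend on the defining function. -/
theorem IsDefiningFunctionAt.normalized_gradient_eq (h : IsDefiningFunctionAt Ω p ρ)
    (h' : IsDefiningFunctionAt Ω p ρ') (hΩ : IsOpen Ω) (hp : p ∈ frontier Ω) :
    ‖gradient ρ p‖⁻¹ • gradient ρ p = ‖gradient ρ' p‖⁻¹ • gradient ρ' p := by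
  set a := gradient ρ p with ha
  set b := gradient ρ' p with hb
  have ha0 : 0 < ‖a‖ := norm_pos_iff.2 h.2.1
  have hb0 : 0 < ‖b‖ := norm_pos_iff.2 h'.2.1
  set u := ‖a‖⁻¹ • a
  set w := ‖b‖⁻¹ • b
  have hu : ‖u‖ = 1 := by simp [u, norm_smul, ha0.ne']
  have hw : ‖w‖ = 1 := by simp [w, norm_smul, hb0.ne']
  by_contra hne
  have hlt : inner ℝ u w < 1 := (inner_lt_one_iff_real_of_norm_eq_one hu hw).2 hne
  have hau : a = ‖a‖ • u := by simp [u, smul_smul, ha0.ne']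
  have hbw : b = ‖b‖ • w := by simp [w, smul_smul, hb0.ne']
  have h1 : 0 < inner ℝ a (u - w) := by
    rw [hau, inner_smul_left, inner_sub_right, real_inner_self_eq_norm_sq, hu]
    simp only [conj_trivial]
    exact mul_pos ha0 (by linarith)
  have h2 := h.inner_nonneg h' hΩ hp h1
  rw [← hb, hbw, inner_smul_left, inner_sub_right, real_inner_self_eq_norm_sq, hw,
    real_inner_comm] at h2
  simp only [conj_trivial] at h2
  nlinarith

theorem outwardNormal_eq (h : IsDefiningFunctionAt Ω p ρ) (hΩ : IsOpen Ω) (hp : p ∈ frontier Ω) :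
    outwardNormal Ω p = ‖gradient ρ p‖⁻¹ • gradient ρ p := by
  have hex : ∃ ρ, IsDefiningFunctionAt Ω p ρ := ⟨ρ, h⟩
  rw [outwardNormal, dif_pos hex]
  exact hex.choose_spec.normalized_gradient_eq h hΩ hp

/-- A defining function at `p` describes the domain, its boundary and its normal in a whole
neighbourhood of `p`. -/
theorem IsDefiningFunctionAt.eventually_chart (h : IsDefiningFunctionAt Ω p ρ) (hΩ : IsOpen Ω) :
    ∀ᶠ x in 𝓝 p, (x ∈ Ω ↔ ρ x < 0) ∧ (x ∈ frontier Ω ↔ ρ x = 0) ∧ gradient ρ x ≠ 0 ∧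
      (x ∈ frontier Ω → outwardNormal Ω x = ‖gradient ρ x‖⁻¹ • gradient ρ x) := by
  filter_upwards [h.eventually] with x hx
  exact ⟨hx.2.2.self_of_nhds, ⟨hx.eq_zero hΩ, hx.mem_frontier hΩ⟩, hx.2.1, outwardNormal_eq hx hΩ⟩

namespace IsSmoothBoundedDomain

theorem norm_outwardNormal (hΩ : IsSmoothBoundedDomain Ω) (hp : p ∈ frontier Ω) :
    ‖outwardNormal Ω p‖ = 1 := by
  obtain ⟨ρ, h⟩ := hΩ.smooth_boundary p hp
  rw [outwardNormal_eq h hΩ.isOpen hp, norm_smul, norm_inv, norm_norm,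
    inv_mul_cancel₀ (norm_ne_zero_iff.2 h.2.1)]

theorem continuousOn_outwardNormal (hΩ : IsSmoothBoundedDomain Ω) :
    ContinuousOn (outwardNormal Ω) (frontier Ω) := by
  intro p hp
  obtain ⟨ρ, h⟩ := hΩ.smooth_boundary p hp
  have hc := (continuous_gradient (h.1.of_le (by simp : (1 : WithTop ℕ∞) ≤ ∞))).continuousAt (x := p)
  have hc' : ContinuousAt (fun x => ‖gradient ρ x‖⁻¹ • gradient ρ x) p :=
    (hc.norm.inv₀ (norm_ne_zero_iff.2 h.2.1)).smul hc
  refine hc'.continuousWithinAt.congr_of_eventuallyEq ?_ (outwardNormal_eq h hΩ.isOpen hp)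
  filter_upwards [nhdsWithin_le_nhds (h.eventually_chart hΩ.isOpen), self_mem_nhdsWithin]
    with x hx hx'
  exact hx.2.2.2 hx'

theorem isCompact_closure (hΩ : IsSmoothBoundedDomain Ω) : IsCompact (closure Ω) :=
  hΩ.isBounded.isCompact_closure

theorem isCompact_frontier (hΩ : IsSmoothBoundedDomain Ω) : IsCompact (frontier Ω) :=
  hΩ.isCompact_closure.of_isClosed_subset isClosed_frontier frontier_subset_closure

theorem finrank_orthogonal_span_singleton {e : EuclideanSpace ℝ (Fin n)} (he : ‖e‖ = 1) :
    Module.finrank ℝ (Submodule.span ℝ {e})ᗮ = n - 1 := by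
  have h0 : e ≠ 0 := by rintro rfl; simp at he
  have h1 := (Submodule.span ℝ {e}).finrank_add_finrank_orthogonal
  rw [finrank_span_singleton h0, finrank_euclideanSpace, Fintype.card_fin] at h1
  omega

theorem isFiniteMeasure_surfaceMeasure (hΩ : IsSmoothBoundedDomain Ω) :
    IsFiniteMeasure (surfaceMeasure Ω) := by
  refine ⟨?_⟩
  rw [surfaceMeasure, Measure.restrict_apply_univ]
  refine hΩ.isCompact_frontier.measure_lt_top_of_nhdsWithin fun p hp => ?_
  obtain ⟨ρ, h⟩ := hΩ.smooth_boundary p hp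
  set e := ‖gradient ρ p‖⁻¹ • gradient ρ p
  have hg : 0 < ‖gradient ρ p‖ := norm_pos_iff.2 h.2.1
  have he : ‖e‖ = 1 := by simp [e, norm_smul, hg.ne']
  have hae : 0 < inner ℝ (gradient ρ p) e := by
    rw [inner_smul_right, real_inner_self_eq_norm_sq]; positivity
  obtain ⟨U, hU, hUA⟩ := exists_nhds_area_projection he hae
    (hasStrictFDerivAt_innerSL_gradient (h.1.of_le (by simp)) p) one_lt_two
    (finrank_orthogonal_span_singleton he)
  refine ⟨frontier Ω ∩ (U ∩ {x | x ∈ frontier Ω ↔ ρ x = 0}), ?_, ?_⟩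
  · refine inter_mem self_mem_nhdsWithin (nhdsWithin_le_nhds (inter_mem hU ?_))
    exact (h.eventually_chart hΩ.isOpen).mono fun x hx => hx.2.1
  · refine lt_of_le_of_lt (hUA _ (fun x hx => hx.2.1) fun x hx => hx.2.2.1 hx.1).2 ?_
    refine ENNReal.mul_lt_top ENNReal.ofReal_lt_top (ENNReal.mul_lt_top ENNReal.ofReal_lt_top ?_)
    refine Bornology.IsBounded.measure_lt_top ?_
    refine Bornology.IsBounded.subset ?_ (image_mono inter_subset_left)
    exact (hΩ.isCompact_frontier.image
      (Submodule.span ℝ {e})ᗮ.orthogonalProjectionOnto.continuous).isBounded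

theorem integrable_mul_inner_outwardNormal (hΩ : IsSmoothBoundedDomain Ω)
    {φ : EuclideanSpace ℝ (Fin n) → ℝ} (hφ : Continuous φ) (e : EuclideanSpace ℝ (Fin n)) :
    Integrable (fun x => φ x * inner ℝ (outwardNormal Ω x) e) (surfaceMeasure Ω) := by
  have := hΩ.isFiniteMeasure_surfaceMeasure
  have hcont : ContinuousOn (fun x => φ x * inner ℝ (outwardNormal Ω x) e) (frontier Ω) :=
    hφ.continuousOn.mul (hΩ.continuousOn_outwardNormal.inner continuousOn_const)
  obtain ⟨C, hC⟩ := hΩ.isCompact_frontier.exists_bound_of_continuousOn hcont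
  refine Integrable.of_bound (hcont.aestronglyMeasurable isClosed_frontier.measurableSet) C ?_
  exact (ae_restrict_iff' isClosed_frontier.measurableSet).2 (Eventually.of_forall hC)

theorem exists_ball_divergence_of_pos (hΩ : IsSmoothBoundedDomain Ω) (hp : p ∈ frontier Ω)
    {e : EuclideanSpace ℝ (Fin n)} (he : 0 < inner ℝ (outwardNormal Ω p) e) :
    ∃ r > 0, ∀ φ : EuclideanSpace ℝ (Fin n) → ℝ, ContDiff ℝ 1 φ → HasCompactSupport φ →
      tsupport φ ⊆ Metric.ball p r → ∫ x in Ω, fderiv ℝ φ x e =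
        ∫ x, φ x * inner ℝ (outwardNormal Ω x) e ∂(surfaceMeasure Ω) := by
  obtain ⟨ρ, h⟩ := hΩ.smooth_boundary p hp
  have hρ1 : ContDiff ℝ 1 ρ := h.1.of_le (by simp)
  have hg : 0 < ‖gradient ρ p‖ := norm_pos_iff.2 h.2.1
  have he0 : 0 < ‖e‖ := by
    rw [norm_pos_iff]; rintro rfl; simp at he
  set u := ‖e‖⁻¹ • e
  have hu : ‖u‖ = 1 := by simp [u, norm_smul, he0.ne']
  have heu : e = ‖e‖ • u := by simp [u, smul_smul, he0.ne']
  have hpos : 0 < inner ℝ (gradient ρ p) u := by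
    rw [outwardNormal_eq h hΩ.isOpen hp, heu, inner_smul_left, inner_smul_right] at he
    simp only [conj_trivial] at he
    exact (pos_iff_pos_of_mul_pos ((pos_iff_pos_of_mul_pos he).1 (by positivity))).1 he0
  have hpos' : ∀ᶠ x in 𝓝 p, 0 < inner ℝ (gradient ρ x) u :=
    ((continuous_gradient hρ1).inner continuous_const).continuousAt.eventually (lt_mem_nhds hpos)
  obtain ⟨r, hr, hball⟩ := Metric.eventually_nhds_iff_ball.1
    ((h.eventually_chart hΩ.isOpen).and hpos')
  refine ⟨r, hr, fun φ hφ hφc hφr => ?_⟩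
  have hmain := setIntegral_fderiv_eq_level_set hΩ.isOpen.measurableSet hu hρ1 Metric.isOpen_ball
    (convex_ball p r) (fun x hx => (hball x hx).2) (fun x hx => (hball x hx).1.1)
    (finrank_orthogonal_span_singleton hu) hφ hφc hφr
  have hset : {x | x ∈ Metric.ball p r ∧ ρ x = 0} = frontier Ω ∩ Metric.ball p r := by
    ext x
    constructor
    · rintro ⟨h1, h2⟩; exact ⟨(hball x h1).1.2.1.2 h2, h1⟩
    · rintro ⟨h1, h2⟩; exact ⟨h2, (hball x h2).1.2.1.1 h1⟩
  have hfm : MeasurableSet (frontier Ω ∩ Metric.ball p r) :=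
    isClosed_frontier.measurableSet.inter measurableSet_ball
  have hrhs : ∫ x, φ x * inner ℝ (outwardNormal Ω x) u ∂(surfaceMeasure Ω) =
      ∫ x in {x | x ∈ Metric.ball p r ∧ ρ x = 0},
        φ x * (inner ℝ (gradient ρ x) u / ‖gradient ρ x‖) ∂μHE[n - 1] := by
    rw [hset, surfaceMeasure, setIntegral_eq_of_subset_of_forall_sdiff_eq_zero
      isClosed_frontier.measurableSet
      (inter_subset_left : frontier Ω ∩ Metric.ball p r ⊆ frontier Ω)]
    · refine setIntegral_congr_fun hfm fun x hx => ?_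
      rw [(hball x hx.2).1.2.2.2 hx.1, inner_smul_left, conj_trivial, div_eq_inv_mul]
    · intro x hx
      have : x ∉ tsupport φ := fun hx' => hx.2 ⟨hx.1, hφr hx'⟩
      rw [image_eq_zero_of_notMem_tsupport this, zero_mul]
  rw [← hrhs] at hmain
  rw [heu]
  simp only [map_smul, smul_eq_mul, inner_smul_right]
  rw [integral_const_mul, hmain, ← integral_const_mul]
  congr 1; ext x; ring

theorem exists_ball_divergence (hΩ : IsSmoothBoundedDomain Ω) (hp : p ∈ frontier Ω)
    (e : EuclideanSpace ℝ (Fin n)) :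
    ∃ r > 0, ∀ φ : EuclideanSpace ℝ (Fin n) → ℝ, ContDiff ℝ 1 φ → HasCompactSupport φ →
      tsupport φ ⊆ Metric.ball p r → ∫ x in Ω, fderiv ℝ φ x e =
        ∫ x, φ x * inner ℝ (outwardNormal Ω x) e ∂(surfaceMeasure Ω) := by
  set ν := outwardNormal Ω p
  have hν : inner ℝ ν ν = 1 := by
    rw [real_inner_self_eq_norm_sq, hΩ.norm_outwardNormal hp]; norm_num
  -- `e` is a difference of two directions pointing out of the domain
  set k : ℝ := ‖e‖ + 1
  have hk : 0 < k := by positivity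
  have h1 : 0 < inner ℝ ν (e + k • ν) := by
    rw [inner_add_right, inner_smul_right, hν]
    have := abs_real_inner_le_norm ν e
    rw [hΩ.norm_outwardNormal hp, one_mul] at this
    have := (abs_le.1 this).1
    simp only [k]; linarith
  have h2 : 0 < inner ℝ ν (k • ν) := by
    rw [inner_smul_right, hν]; linarith
  obtain ⟨r₁, hr₁, H₁⟩ := hΩ.exists_ball_divergence_of_pos hp h1
  obtain ⟨r₂, hr₂, H₂⟩ := hΩ.exists_ball_divergence_of_pos hp h2
  refine ⟨min r₁ r₂, lt_min hr₁ hr₂, fun φ hφ hφc hφr => ?_⟩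
  have e1 := H₁ φ hφ hφc (hφr.trans (Metric.ball_subset_ball (min_le_left _ _)))
  have e2 := H₂ φ hφ hφc (hφr.trans (Metric.ball_subset_ball (min_le_right _ _)))
  have hint : ∀ v, Integrable (fun x => fderiv ℝ φ x v) (volume.restrict Ω) := fun v =>
    (((hφ.continuous_fderiv one_ne_zero).clm_apply
      continuous_const).integrable_of_hasCompactSupport (hφc.fderiv_apply (𝕜 := ℝ) v)).integrableOn
  have hl : ∀ x, fderiv ℝ φ x e = fderiv ℝ φ x (e + k • ν) - fderiv ℝ φ x (k • ν) := by
    intro x; rw [← map_sub, add_sub_cancel_right]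
  have hr : ∀ x, φ x * inner ℝ (outwardNormal Ω x) e =
      φ x * inner ℝ (outwardNormal Ω x) (e + k • ν) -
        φ x * inner ℝ (outwardNormal Ω x) (k • ν) := by
    intro x; rw [← mul_sub, ← inner_sub_right, add_sub_cancel_right]
  simp only [hl, hr]
  rw [integral_sub (hint _) (hint _), e1, e2,
    integral_sub (hΩ.integrable_mul_inner_outwardNormal hφ.continuous _)
      (hΩ.integrable_mul_inner_outwardNormal hφ.continuous _)]

/-- The divergence theorem on a smooth bounded domain, for one component of the vector field:
`∫_Ω ∂ₑφ = ∫_{∂Ω} φ ⟪ν, e⟫ dσ`. -/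
theorem setIntegral_fderiv (hΩ : IsSmoothBoundedDomain Ω)
    {φ : EuclideanSpace ℝ (Fin n) → ℝ} (hφ : ContDiff ℝ 1 φ) (e : EuclideanSpace ℝ (Fin n)) :
    ∫ x in Ω, fderiv ℝ φ x e =
      ∫ x, φ x * inner ℝ (outwardNormal Ω x) e ∂(surfaceMeasure Ω) := by
  have hloc : ∀ p ∈ closure Ω, ∃ r > 0, ∀ φ : EuclideanSpace ℝ (Fin n) → ℝ, ContDiff ℝ 1 φ →
      HasCompactSupport φ → tsupport φ ⊆ Metric.ball p r → ∫ x in Ω, fderiv ℝ φ x e =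
        ∫ x, φ x * inner ℝ (outwardNormal Ω x) e ∂(surfaceMeasure Ω) := by
    intro p hp
    by_cases hpΩ : p ∈ Ω
    · obtain ⟨r, hr, hball⟩ := Metric.isOpen_iff.1 hΩ.isOpen p hpΩ
      refine ⟨r, hr, fun φ hφ hφc hφr => ?_⟩
      have hl : ∫ x in Ω, fderiv ℝ φ x e = ∫ x, fderiv ℝ φ x e := by
        refine setIntegral_eq_integral_of_forall_compl_eq_zero fun x hx => ?_
        have : x ∉ tsupport φ := fun hx' => hx (hball (hφr hx'))
        rw [image_eq_zero_of_notMem_tsupport (fun h => this (tsupport_fderiv_subset ℝ h))]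
        rfl
      have hz : ∫ x, fderiv ℝ φ x e = 0 := by
        have := integral_mul_fderiv_eq_neg_fderiv_mul_of_integrable (μ := volume) (𝕜 := ℝ)
          (f := fun _ : EuclideanSpace ℝ (Fin n) => (1 : ℝ)) (g := φ) (v := e) (by simp)
          (by simpa using ((hφ.continuous_fderiv one_ne_zero).clm_apply
            continuous_const).integrable_of_hasCompactSupport (hφc.fderiv_apply (𝕜 := ℝ) e))
          (by simpa using hφ.continuous.integrable_of_hasCompactSupport hφc)
          (fun x _ => by fun_prop) (fun x _ => hφ.differentiable one_ne_zero x)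
        simpa using this
      rw [hl, hz, surfaceMeasure, eq_comm]
      refine setIntegral_eq_zero_of_forall_eq_zero fun x hx => ?_
      have hxn : x ∉ Ω := by rw [hΩ.isOpen.frontier_eq] at hx; exact hx.2
      have : x ∉ tsupport φ := fun hx' => hxn (hball (hφr hx'))
      rw [image_eq_zero_of_notMem_tsupport this, zero_mul]
    · exact hΩ.exists_ball_divergence (by rw [hΩ.isOpen.frontier_eq]; exact ⟨hp, hpΩ⟩) e
  choose! r hr H using hloc
  obtain ⟨s, hs, hcov⟩ := hΩ.isCompact_closure.elim_nhds_subcover (fun p => Metric.ball p (r p))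
    fun p hp => Metric.ball_mem_nhds p (hr p hp)
  obtain ⟨f, hf⟩ := SmoothPartitionOfUnity.exists_isSubordinate
    (modelWithCornersSelf ℝ (EuclideanSpace ℝ (Fin n))) isClosed_closure
    (fun p : s => Metric.ball (p : EuclideanSpace ℝ (Fin n)) (r p))
    (fun p => Metric.isOpen_ball) (by
      intro x hx
      obtain ⟨p, hp, hxp⟩ := mem_iUnion₂.1 (hcov hx)
      exact mem_iUnion.2 ⟨⟨p, hp⟩, hxp⟩)
  have hfs : ∀ p, ContDiff ℝ 1 (f p) := fun p => ((f p).contMDiff.contDiff).of_le (by simp)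
  have hsum : ∀ x ∈ closure Ω, ∑ p, f p x = 1 := by
    intro x hx
    rw [← f.sum_eq_one hx, finsum_eq_sum_of_fintype]
  have hft : ∀ p, tsupport (fun x => f p x * φ x) ⊆ Metric.ball (p : EuclideanSpace ℝ (Fin n)) (r p) :=
    fun p => (tsupport_mul_subset_left).trans (hf p)
  have hfc : ∀ p, HasCompactSupport fun x => f p x * φ x := fun p =>
    Metric.isCompact_of_isClosed_isBounded (isClosed_tsupport _)
      (Metric.isBounded_ball.subset (hft p))
  have hfd : ∀ p, ContDiff ℝ 1 fun x => f p x * φ x := fun p => (hfs p).mul hφ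
  have hint : ∀ p, Integrable (fun x => fderiv ℝ (fun x => f p x * φ x) x e)
      (volume.restrict Ω) := fun p =>
    ((((hfd p).continuous_fderiv one_ne_zero).clm_apply
      continuous_const).integrable_of_hasCompactSupport
        ((hfc p).fderiv_apply (𝕜 := ℝ) e)).integrableOn
  have hl : ∫ x in Ω, fderiv ℝ φ x e =
      ∑ p, ∫ x in Ω, fderiv ℝ (fun x => f p x * φ x) x e := by
    rw [← integral_finsetSum _ fun p _ => hint p]
    refine setIntegral_congr_fun hΩ.isOpen.measurableSet fun x hx => ?_
    have heq : φ =ᶠ[𝓝 x] fun y => ∑ p, f p y * φ y := by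
      filter_upwards [hΩ.isOpen.mem_nhds hx] with y hy
      rw [← Finset.sum_mul, hsum y (subset_closure hy), one_mul]
    rw [heq.fderiv_eq, fderiv_fun_sum fun p _ => (hfd p).differentiable one_ne_zero x]
    simp
  have hrr : ∫ x, φ x * inner ℝ (outwardNormal Ω x) e ∂(surfaceMeasure Ω) =
      ∑ p, ∫ x, (f p x * φ x) * inner ℝ (outwardNormal Ω x) e ∂(surfaceMeasure Ω) := by
    rw [← integral_finsetSum _ fun p _ =>
      hΩ.integrable_mul_inner_outwardNormal (hfd p).continuous e]
    refine setIntegral_congr_fun isClosed_frontier.measurableSet fun x hx => ?_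
    rw [← Finset.sum_mul, ← Finset.sum_mul, hsum x (frontier_subset_closure hx), one_mul]
  rw [hl, hrr]
  refine Finset.sum_congr rfl fun p _ => ?_
  exact H p (hs p p.2) _ (hfd p) (hfc p) (hft p)

end IsSmoothBoundedDomain

end Boundary

/-! ### Products and limits in `L²` -/

section L2

variable {α : Type*} [MeasurableSpace α] {μ : Measure α}

theorem MeasureTheory.MemLp.integrable_fun_mul {f g : α → ℝ} (hf : MemLp f 2 μ)
    (hg : MemLp g 2 μ) : Integrable (fun z => f z * g z) μ :=
  hf.integrable_mul hg

theorem tendsto_integral_mul_of_eLpNorm_tendsto {a : ℕ → α → ℝ} {b c : α → ℝ}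
    (ha : ∀ k, MemLp (a k) 2 μ) (hb : MemLp b 2 μ) (hc : MemLp c 2 μ)
    (h : Tendsto (fun k => eLpNorm (fun z => a k z - b z) 2 μ) atTop (𝓝 0)) :
    Tendsto (fun k => ∫ z, a k z * c z ∂μ) atTop (𝓝 (∫ z, b z * c z ∂μ)) := by
  refine tendsto_integral_of_L1' _ (hb.integrable_fun_mul hc).aestronglyMeasurable (Eventually.of_forall fun k =>
    (ha k).integrable_fun_mul hc) ?_
  have hlim : Tendsto (fun k => eLpNorm (fun z => a k z - b z) 2 μ * eLpNorm c 2 μ) atTop (𝓝 0) := by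
    have := ENNReal.Tendsto.mul_const (b := eLpNorm c 2 μ) h (Or.inr hc.eLpNorm_ne_top)
    simpa using this
  refine tendsto_of_tendsto_of_tendsto_of_le_of_le tendsto_const_nhds hlim (fun _ => zero_le)
    fun k => ?_
  have := eLpNorm_smul_le_mul_eLpNorm (p := 2) (q := 2) (r := 1) (μ := μ) hc.aestronglyMeasurable
    ((ha k).sub hb).aestronglyMeasurable
  refine le_trans (le_of_eq ?_) this
  congr 1
  ext z
  simp [sub_mul]

theorem MeasureTheory.MemLp.mul_of_forall_mem_abs_le {K : Set α} (hK : ∀ᵐ z ∂μ, z ∈ K) {p g : α → ℝ}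
    (hp : AEStronglyMeasurable p μ) {C : ℝ} (hC : ∀ z ∈ K, |p z| ≤ C) (hg : MemLp g 2 μ) :
    MemLp (fun z => p z * g z) 2 μ := by
  refine MemLp.of_le_mul (c := C) hg (hp.mul hg.aestronglyMeasurable) ?_
  filter_upwards [hK] with z hz
  rw [norm_mul]
  gcongr
  exact hC z hz

theorem MeasureTheory.MemLp.continuous_mul [TopologicalSpace α] [OpensMeasurableSpace α]
    [SecondCountableTopology α] {K : Set α} (hK : ∀ᵐ z ∂μ, z ∈ K) (hKc : IsCompact K) {p g : α → ℝ}
    (hp : Continuous p) (hg : MemLp g 2 μ) : MemLp (fun z => p z * g z) 2 μ := by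
  obtain ⟨C, hC⟩ := hKc.exists_bound_of_continuousOn hp.continuousOn
  exact hg.mul_of_forall_mem_abs_le hK hp.aestronglyMeasurable hC

theorem tendsto_eLpNorm_mul_sub [TopologicalSpace α] [OpensMeasurableSpace α]
    [SecondCountableTopology α] {K : Set α} (hK : ∀ᵐ z ∂μ, z ∈ K) (hKc : IsCompact K)
    {p : α → ℝ} (hp : Continuous p) {a : ℕ → α → ℝ} {b : α → ℝ}
    (h : Tendsto (fun k => eLpNorm (fun z => a k z - b z) 2 μ) atTop (𝓝 0)) :
    Tendsto (fun k => eLpNorm (fun z => p z * a k z - p z * b z) 2 μ) atTop (𝓝 0) := by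
  obtain ⟨C, hC⟩ := hKc.exists_bound_of_continuousOn hp.continuousOn
  have hlim : Tendsto (fun k => ENNReal.ofReal C * eLpNorm (fun z => a k z - b z) 2 μ) atTop
      (𝓝 0) := by
    have := ENNReal.Tendsto.const_mul (a := ENNReal.ofReal C) h (Or.inr ENNReal.ofReal_ne_top)
    simpa using this
  refine tendsto_of_tendsto_of_tendsto_of_le_of_le tendsto_const_nhds hlim (fun _ => zero_le)
    fun k => ?_
  refine eLpNorm_le_mul_eLpNorm_of_ae_le_mul ?_ 2
  filter_upwards [hK] with z hz
  rw [← mul_sub, norm_mul]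
  gcongr
  exact hC z hz

end L2

/-! ### Green's formula in the cylinder for functions with weak derivatives -/

section Cylinder

variable {n : ℕ} {Ω : Set (EuclideanSpace ℝ (Fin n))} {T : ℝ}

theorem volume_restrict_spaceTimeCyl (T : ℝ) (Ω : Set (EuclideanSpace ℝ (Fin n))) :
    (volume.restrict (spaceTimeCyl T Ω) : Measure (ℝ × EuclideanSpace ℝ (Fin n))) =
      (volume.restrict (Ioo 0 T)).prod (volume.restrict Ω) := by
  rw [spaceTimeCyl, Measure.volume_eq_prod, Measure.prod_restrict]

theorem IsSmoothBoundedDomain.isCompact_cylinder (hΩ : IsSmoothBoundedDomain Ω) (T : ℝ) :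
    IsCompact (Icc 0 T ×ˢ closure Ω) :=
  isCompact_Icc.prod hΩ.isCompact_closure

theorem IsSmoothBoundedDomain.measurableSet_spaceTimeCyl (hΩ : IsSmoothBoundedDomain Ω) (T : ℝ) :
    MeasurableSet (spaceTimeCyl T Ω) :=
  measurableSet_Ioo.prod hΩ.isOpen.measurableSet

theorem IsSmoothBoundedDomain.isOpen_spaceTimeCyl (hΩ : IsSmoothBoundedDomain Ω) (T : ℝ) :
    IsOpen (spaceTimeCyl T Ω) :=
  isOpen_Ioo.prod hΩ.isOpen

theorem spaceTimeCyl_subset (T : ℝ) (Ω : Set (EuclideanSpace ℝ (Fin n))) :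
    spaceTimeCyl T Ω ⊆ Icc 0 T ×ˢ closure Ω :=
  prod_mono Ioo_subset_Icc_self subset_closure

theorem IsSmoothBoundedDomain.ae_mem_cylinder (hΩ : IsSmoothBoundedDomain Ω) (T : ℝ) :
    ∀ᵐ z ∂(volume.restrict (spaceTimeCyl T Ω)), z ∈ Icc 0 T ×ˢ closure Ω :=
  (ae_restrict_mem (hΩ.measurableSet_spaceTimeCyl T)).mono fun _ hz => spaceTimeCyl_subset T Ω hz

theorem lateralMeasure_eq_restrict (T : ℝ) (Ω : Set (EuclideanSpace ℝ (Fin n)))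
    [SFinite (surfaceMeasure Ω)] :
    lateralMeasure T Ω = (((volume : Measure ℝ).prod (surfaceMeasure Ω)).restrict
      (Ioo 0 T ×ˢ frontier Ω)) := by
  rw [lateralMeasure, ← Measure.prod_restrict]
  congr 1
  rw [surfaceMeasure, Measure.restrict_restrict isClosed_frontier.measurableSet, inter_self]

theorem IsSmoothBoundedDomain.ae_mem_lateral (hΩ : IsSmoothBoundedDomain Ω) (T : ℝ) :
    ∀ᵐ z ∂(lateralMeasure T Ω), z ∈ Ioo 0 T ×ˢ frontier Ω := by
  have := hΩ.isFiniteMeasure_surfaceMeasure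
  rw [lateralMeasure_eq_restrict]
  exact ae_restrict_mem (measurableSet_Ioo.prod isClosed_frontier.measurableSet)

theorem IsSmoothBoundedDomain.ae_lateral_mem_cylinder (hΩ : IsSmoothBoundedDomain Ω) (T : ℝ) :
    ∀ᵐ z ∂(lateralMeasure T Ω), z ∈ Icc 0 T ×ˢ closure Ω :=
  (hΩ.ae_mem_lateral T).mono fun _ hz => ⟨Ioo_subset_Icc_self hz.1, frontier_subset_closure hz.2⟩

theorem IsSmoothBoundedDomain.isFiniteMeasure_cylinder (hΩ : IsSmoothBoundedDomain Ω) (T : ℝ) :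
    IsFiniteMeasure (volume.restrict (spaceTimeCyl T Ω)) :=
  ⟨by
    rw [Measure.restrict_apply_univ]
    exact lt_of_le_of_lt (measure_mono (spaceTimeCyl_subset T Ω))
      (hΩ.isCompact_cylinder T).measure_lt_top⟩

theorem IsSmoothBoundedDomain.isFiniteMeasure_lateralMeasure (hΩ : IsSmoothBoundedDomain Ω)
    (T : ℝ) : IsFiniteMeasure (lateralMeasure T Ω) := by
  have := hΩ.isFiniteMeasure_surfaceMeasure
  rw [lateralMeasure]
  infer_instance

/-- The `i`-th component of the outward normal, as a function on `ℝ × ℝⁿ`. -/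
def normalComp (Ω : Set (EuclideanSpace ℝ (Fin n))) (i : Fin n)
    (z : ℝ × EuclideanSpace ℝ (Fin n)) : ℝ :=
  outwardNormal Ω z.2 i

theorem IsSmoothBoundedDomain.aestronglyMeasurable_normalComp (hΩ : IsSmoothBoundedDomain Ω)
    (T : ℝ) (i : Fin n) : AEStronglyMeasurable (normalComp Ω i) (lateralMeasure T Ω) := by
  have := hΩ.isFiniteMeasure_surfaceMeasure
  have h1 : AEStronglyMeasurable (fun x => outwardNormal Ω x i) (surfaceMeasure Ω) :=
    ContinuousOn.aestronglyMeasurable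
      ((EuclideanSpace.proj (𝕜 := ℝ) i).continuous.comp_continuousOn hΩ.continuousOn_outwardNormal)
      isClosed_frontier.measurableSet
  exact h1.comp_snd

theorem IsSmoothBoundedDomain.ae_abs_normalComp_le (hΩ : IsSmoothBoundedDomain Ω) (T : ℝ)
    (i : Fin n) : ∀ᵐ z ∂(lateralMeasure T Ω), |normalComp Ω i z| ≤ 1 := by
  filter_upwards [hΩ.ae_mem_lateral T] with z hz
  rw [← hΩ.norm_outwardNormal hz.2, ← Real.norm_eq_abs]
  exact PiLp.norm_apply_le _ _

theorem IsSmoothBoundedDomain.memLp_mul_normalComp (hΩ : IsSmoothBoundedDomain Ω) {i : Fin n}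
    {β : ℝ × EuclideanSpace ℝ (Fin n) → ℝ} (hβ : MemLp β 2 (lateralMeasure T Ω)) :
    MemLp (fun z => β z * normalComp Ω i z) 2 (lateralMeasure T Ω) := by
  refine MemLp.of_le hβ (hβ.aestronglyMeasurable.mul (hΩ.aestronglyMeasurable_normalComp T i)) ?_
  filter_upwards [hΩ.ae_abs_normalComp_le T i] with z hz
  rw [norm_mul]
  exact mul_le_of_le_one_right (norm_nonneg _) hz

theorem IsSmoothBoundedDomain.memLp_continuous_mul (hΩ : IsSmoothBoundedDomain Ω)
    {p g : ℝ × EuclideanSpace ℝ (Fin n) → ℝ} (hp : Continuous p)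
    (hg : MemLp g 2 (volume.restrict (spaceTimeCyl T Ω))) :
    MemLp (fun z => p z * g z) 2 (volume.restrict (spaceTimeCyl T Ω)) :=
  hg.continuous_mul (hΩ.ae_mem_cylinder T) (hΩ.isCompact_cylinder T) hp

theorem IsSmoothBoundedDomain.memLp_lateral_continuous_mul (hΩ : IsSmoothBoundedDomain Ω)
    {p g : ℝ × EuclideanSpace ℝ (Fin n) → ℝ} (hp : Continuous p)
    (hg : MemLp g 2 (lateralMeasure T Ω)) :
    MemLp (fun z => p z * g z) 2 (lateralMeasure T Ω) :=
  hg.continuous_mul (hΩ.ae_lateral_mem_cylinder T) (hΩ.isCompact_cylinder T) hp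

theorem IsSmoothBoundedDomain.memLp_of_continuous (hΩ : IsSmoothBoundedDomain Ω)
    {p : ℝ × EuclideanSpace ℝ (Fin n) → ℝ} (hp : Continuous p) :
    MemLp p 2 (volume.restrict (spaceTimeCyl T Ω)) := by
  have := hΩ.isFiniteMeasure_cylinder T
  simpa using hΩ.memLp_continuous_mul (T := T) hp (memLp_const (1 : ℝ))

theorem IsSmoothBoundedDomain.memLp_lateral_of_continuous (hΩ : IsSmoothBoundedDomain Ω)
    {p : ℝ × EuclideanSpace ℝ (Fin n) → ℝ} (hp : Continuous p) :
    MemLp p 2 (lateralMeasure T Ω) := by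
  have := hΩ.isFiniteMeasure_lateralMeasure T
  simpa using hΩ.memLp_lateral_continuous_mul (T := T) hp (memLp_const (1 : ℝ))

theorem memLp_time_mul {μ : Measure (ℝ × EuclideanSpace ℝ (Fin n))}
    {θ : ℝ → ℝ} (hθ : Measurable θ) (hb : ∃ C, ∀ t, |θ t| ≤ C)
    {g : ℝ × EuclideanSpace ℝ (Fin n) → ℝ} (hg : MemLp g 2 μ) :
    MemLp (fun z => θ z.1 * g z) 2 μ := by
  obtain ⟨C, hC⟩ := hb
  exact hg.mul_of_forall_mem_abs_le (K := univ) (by simp)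
    (hθ.comp measurable_fst).aestronglyMeasurable (fun z _ => hC z.1)

/-- The partial derivative `∂ᵢ` in the space variables of a function on `ℝ × ℝⁿ`. -/
def spaceDeriv (i : Fin n) (p : ℝ × EuclideanSpace ℝ (Fin n) → ℝ)
    (z : ℝ × EuclideanSpace ℝ (Fin n)) : ℝ :=
  fderiv ℝ p z (spaceDir i)

theorem contDiff_spaceDeriv {p : ℝ × EuclideanSpace ℝ (Fin n) → ℝ} (hp : ContDiff ℝ ∞ p)
    (i : Fin n) : ContDiff ℝ ∞ (spaceDeriv i p) :=
  (hp.fderiv_right (m := ∞) (by simp)).clm_apply contDiff_const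

theorem spaceDeriv_mul {p q : ℝ × EuclideanSpace ℝ (Fin n) → ℝ} (hp : ContDiff ℝ ∞ p)
    (hq : ContDiff ℝ ∞ q) (i : Fin n) (z : ℝ × EuclideanSpace ℝ (Fin n)) :
    spaceDeriv i (fun z => p z * q z) z = p z * spaceDeriv i q z + spaceDeriv i p z * q z := by
  have hp' := hp.differentiable (by simp) z
  have hq' := hq.differentiable (by simp) z
  simp only [spaceDeriv]
  rw [fderiv_fun_mul hp' hq']
  simp [mul_comm]

/-- The divergence theorem in the cylinder, with a weight that depends on time only. -/
theorem IsSmoothBoundedDomain.setIntegral_cylinder_spaceDeriv (hΩ : IsSmoothBoundedDomain Ω)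
    {p : ℝ × EuclideanSpace ℝ (Fin n) → ℝ} (hp : ContDiff ℝ ∞ p) (i : Fin n)
    {θ : ℝ → ℝ} (hθ : Measurable θ) (hb : ∃ C, ∀ t, |θ t| ≤ C) :
    ∫ z in spaceTimeCyl T Ω, θ z.1 * spaceDeriv i p z =
      ∫ z, θ z.1 * (p z * normalComp Ω i z) ∂(lateralMeasure T Ω) := by
  have := hΩ.isFiniteMeasure_surfaceMeasure
  have := hΩ.isFiniteMeasure_cylinder T
  have := hΩ.isFiniteMeasure_lateralMeasure T
  have hi1 : Integrable (fun z => θ z.1 * spaceDeriv i p z)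
      (volume.restrict (spaceTimeCyl T Ω)) :=
    (memLp_time_mul hθ hb
      (hΩ.memLp_of_continuous (contDiff_spaceDeriv hp i).continuous)).integrable one_le_two
  have hi2 : Integrable (fun z => θ z.1 * (p z * normalComp Ω i z)) (lateralMeasure T Ω) :=
    (memLp_time_mul hθ hb (hΩ.memLp_mul_normalComp
      (hΩ.memLp_lateral_of_continuous hp.continuous))).integrable one_le_two
  rw [volume_restrict_spaceTimeCyl] at hi1 ⊢
  rw [lateralMeasure] at hi2 ⊢
  rw [integral_prod _ hi1, integral_prod _ hi2]
  congr 1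
  ext t
  dsimp only
  rw [integral_const_mul, integral_const_mul]
  congr 1
  have hslice : ContDiff ℝ 1 fun x => p (t, x) :=
    (hp.of_le (by simp)).comp (contDiff_const.prodMk contDiff_id)
  have h := hΩ.setIntegral_fderiv hslice (EuclideanSpace.single i 1)
  simp only [EuclideanSpace.inner_single_right] at h
  have hl : ∀ x, fderiv ℝ (fun x => p (t, x)) x (EuclideanSpace.single i 1) =
      spaceDeriv i p (t, x) := by
    intro x
    have h1 : HasFDerivAt (fun x : EuclideanSpace ℝ (Fin n) => (t, x))
        (ContinuousLinearMap.inr ℝ ℝ (EuclideanSpace ℝ (Fin n))) x := by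
      exact hasFDerivAt_prodMk_right t x
    have h2 := (hp.differentiable (by simp) (t, x)).hasFDerivAt.comp x h1
    have h3 : fderiv ℝ (fun x => p (t, x)) x = _ := h2.fderiv
    rw [h3]
    rfl
  simp only [hl] at h
  rw [h]
  congr 1
  ext x
  simp [normalComp]

/-- `G` is the weak derivative `∂ᵢg` in the cylinder of the `L²` function `g`, and `β` is the trace
of `g` on the lateral boundary: Green's formula holds against products of a bounded function of
time with a function smooth up to the boundary. -/
def WeakTrace (T : ℝ) (Ω : Set (EuclideanSpace ℝ (Fin n))) (i : Fin n)
    (g G β : ℝ × EuclideanSpace ℝ (Fin n) → ℝ) : Prop :=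
  MemLp g 2 (volume.restrict (spaceTimeCyl T Ω)) ∧
  MemLp G 2 (volume.restrict (spaceTimeCyl T Ω)) ∧ MemLp β 2 (lateralMeasure T Ω) ∧
  ∀ p : ℝ × EuclideanSpace ℝ (Fin n) → ℝ, ContDiff ℝ ∞ p → ∀ θ : ℝ → ℝ, Measurable θ →
    (∃ C, ∀ t, |θ t| ≤ C) →
      ∫ z in spaceTimeCyl T Ω, θ z.1 * (p z * G z + spaceDeriv i p z * g z) =
        ∫ z, θ z.1 * (p z * (β z * normalComp Ω i z)) ∂(lateralMeasure T Ω)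

/-- `F = ∂ᵢf` in the cylinder and `α` is the trace of `f`, in the sense that Green's formula holds
against everything that satisfies it against smooth functions. -/
def StrongTrace (T : ℝ) (Ω : Set (EuclideanSpace ℝ (Fin n))) (i : Fin n)
    (f F α : ℝ × EuclideanSpace ℝ (Fin n) → ℝ) : Prop :=
  MemLp f 2 (volume.restrict (spaceTimeCyl T Ω)) ∧
  MemLp F 2 (volume.restrict (spaceTimeCyl T Ω)) ∧ MemLp α 2 (lateralMeasure T Ω) ∧
  ∀ g G β, WeakTrace T Ω i g G β →
    ∫ z in spaceTimeCyl T Ω, (f z * G z + F z * g z) =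
      ∫ z, α z * (β z * normalComp Ω i z) ∂(lateralMeasure T Ω)

variable {i : Fin n} {f F α f' F' α' g G β : ℝ × EuclideanSpace ℝ (Fin n) → ℝ}

theorem WeakTrace.contDiff_mul (h : WeakTrace T Ω i g G β) (hΩ : IsSmoothBoundedDomain Ω)
    {a : ℝ × EuclideanSpace ℝ (Fin n) → ℝ} (ha : ContDiff ℝ ∞ a) :
    WeakTrace T Ω i (fun z => a z * g z) (fun z => a z * G z + spaceDeriv i a z * g z)
      (fun z => a z * β z) := by
  obtain ⟨h1, h2, h3, h4⟩ := h
  refine ⟨hΩ.memLp_continuous_mul ha.continuous h1,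
    (hΩ.memLp_continuous_mul ha.continuous h2).add
      (hΩ.memLp_continuous_mul (contDiff_spaceDeriv ha i).continuous h1),
    hΩ.memLp_lateral_continuous_mul ha.continuous h3, fun p hp θ hθ hb => ?_⟩
  have := h4 (fun z => p z * a z) (hp.mul ha) θ hθ hb
  simp only [spaceDeriv_mul hp ha] at this
  convert! this using 1
  · congr 1; ext z; ring
  · congr 1; ext z; ring

theorem WeakTrace.time_mul (h : WeakTrace T Ω i g G β) {θ : ℝ → ℝ} (hθ : Measurable θ)
    (hb : ∃ C, ∀ t, |θ t| ≤ C) :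
    WeakTrace T Ω i (fun z => θ z.1 * g z) (fun z => θ z.1 * G z) (fun z => θ z.1 * β z) := by
  obtain ⟨h1, h2, h3, h4⟩ := h
  refine ⟨memLp_time_mul hθ hb h1, memLp_time_mul hθ hb h2, memLp_time_mul hθ hb h3,
    fun p hp θ' hθ' hb' => ?_⟩
  obtain ⟨C, hC⟩ := hb
  obtain ⟨C', hC'⟩ := hb'
  have := h4 p hp (fun t => θ' t * θ t) (hθ'.mul hθ) ⟨C' * C, fun t => by
    rw [abs_mul]
    exact mul_le_mul (hC' t) (hC t) (abs_nonneg _) ((abs_nonneg _).trans (hC' t))⟩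
  convert! this using 1
  · congr 1; ext z; ring
  · congr 1; ext z; ring

theorem WeakTrace.of_contDiff (hΩ : IsSmoothBoundedDomain Ω) (T : ℝ) (i : Fin n)
    {u : ℝ × EuclideanSpace ℝ (Fin n) → ℝ} (hu : ContDiff ℝ ∞ u) :
    WeakTrace T Ω i u (spaceDeriv i u) u := by
  refine ⟨hΩ.memLp_of_continuous hu.continuous,
    hΩ.memLp_of_continuous (contDiff_spaceDeriv hu i).continuous,
    hΩ.memLp_lateral_of_continuous hu.continuous, fun p hp θ hθ hb => ?_⟩
  have := hΩ.setIntegral_cylinder_spaceDeriv (T := T) (hp.mul hu) i hθ hb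
  simp only [spaceDeriv_mul hp hu] at this
  rw [this]
  congr 1; ext z; ring

theorem StrongTrace.add (h : StrongTrace T Ω i f F α) (h' : StrongTrace T Ω i f' F' α')
    (hΩ : IsSmoothBoundedDomain Ω) :
    StrongTrace T Ω i (fun z => f z + f' z) (fun z => F z + F' z) (fun z => α z + α' z) := by
  obtain ⟨h1, h2, h3, h4⟩ := h
  obtain ⟨h1', h2', h3', h4'⟩ := h'
  refine ⟨h1.add h1', h2.add h2', h3.add h3', fun g G β hg => ?_⟩
  have e1 := h4 g G β hg
  have e2 := h4' g G β hg
  have hν := hΩ.memLp_mul_normalComp (i := i) hg.2.2.1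
  have i1 : Integrable (fun z => f z * G z + F z * g z) (volume.restrict (spaceTimeCyl T Ω)) :=
    (h1.integrable_fun_mul hg.2.1).add (h2.integrable_fun_mul hg.1)
  have i2 : Integrable (fun z => f' z * G z + F' z * g z) (volume.restrict (spaceTimeCyl T Ω)) :=
    (h1'.integrable_fun_mul hg.2.1).add (h2'.integrable_fun_mul hg.1)
  calc _ = ∫ z in spaceTimeCyl T Ω, ((f z * G z + F z * g z) + (f' z * G z + F' z * g z)) := by
        congr 1; ext z; ring
    _ = ∫ z, (α z * (β z * normalComp Ω i z) + α' z * (β z * normalComp Ω i z))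
          ∂(lateralMeasure T Ω) := by
        rw [integral_add i1 i2, e1, e2,
          ← integral_add (h3.integrable_fun_mul hν) (h3'.integrable_fun_mul hν)]
    _ = _ := by congr 1; ext z; ring

theorem StrongTrace.contDiff_mul (h : StrongTrace T Ω i f F α) (hΩ : IsSmoothBoundedDomain Ω)
    {a : ℝ × EuclideanSpace ℝ (Fin n) → ℝ} (ha : ContDiff ℝ ∞ a) :
    StrongTrace T Ω i (fun z => a z * f z) (fun z => a z * F z + spaceDeriv i a z * f z)
      (fun z => a z * α z) := by
  obtain ⟨h1, h2, h3, h4⟩ := h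
  refine ⟨hΩ.memLp_continuous_mul ha.continuous h1,
    (hΩ.memLp_continuous_mul ha.continuous h2).add
      (hΩ.memLp_continuous_mul (contDiff_spaceDeriv ha i).continuous h1),
    hΩ.memLp_lateral_continuous_mul ha.continuous h3, fun g G β hg => ?_⟩
  have := h4 _ _ _ (hg.contDiff_mul hΩ ha)
  convert! this using 1
  · congr 1; ext z; ring
  · congr 1; ext z; ring

/-- Green's formula in the strong sense, applied to smooth functions cut off in time. -/
theorem StrongTrace.weakTrace (h : StrongTrace T Ω i f F α) (hΩ : IsSmoothBoundedDomain Ω) :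
    WeakTrace T Ω i f F α := by
  obtain ⟨h1, h2, h3, h4⟩ := h
  refine ⟨h1, h2, h3, fun p hp θ hθ hb => ?_⟩
  have := h4 _ _ _ ((WeakTrace.of_contDiff hΩ T i hp).time_mul hθ hb)
  convert! this using 1
  · congr 1; ext z; ring
  · congr 1; ext z; ring

theorem HasL2WeakDeriv.weakDeriv_spec {e : ℝ × EuclideanSpace ℝ (Fin n)}
    {f : ℝ × EuclideanSpace ℝ (Fin n) → ℂ} (h : HasL2WeakDeriv (spaceTimeCyl T Ω) e f) :
    MemLp (weakDeriv (spaceTimeCyl T Ω) e f) 2 (volume.restrict (spaceTimeCyl T Ω)) ∧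
      HasWeakDeriv (spaceTimeCyl T Ω) e f (weakDeriv (spaceTimeCyl T Ω) e f) := by
  rw [weakDeriv, dif_pos h]
  exact h.choose_spec

theorem tendsto_eLpNorm_clm_sub {μ : Measure (ℝ × EuclideanSpace ℝ (Fin n))} {L : ℂ →L[ℝ] ℝ}
    (hL : ∀ c, |L c| ≤ ‖c‖) {u : ℕ → ℝ × EuclideanSpace ℝ (Fin n) → ℂ}
    {f : ℝ × EuclideanSpace ℝ (Fin n) → ℂ}
    (h : Tendsto (fun k => eLpNorm (fun z => u k z - f z) 2 μ) atTop (𝓝 0)) :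
    Tendsto (fun k => eLpNorm (fun z => L (u k z) - L (f z)) 2 μ) atTop (𝓝 0) := by
  refine tendsto_of_tendsto_of_tendsto_of_le_of_le tendsto_const_nhds h (fun _ => zero_le)
    fun k => eLpNorm_mono fun z => ?_
  rw [← map_sub]
  exact hL _

theorem fderiv_clm_comp_apply (L : ℂ →L[ℝ] ℝ) {u : ℝ × EuclideanSpace ℝ (Fin n) → ℂ}
    (hu : ContDiff ℝ ∞ u) (z : ℝ × EuclideanSpace ℝ (Fin n)) (e : ℝ × EuclideanSpace ℝ (Fin n)) :
    fderiv ℝ (fun z => L (u z)) z e = L (fderiv ℝ u z e) := by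
  have h := L.hasFDerivAt.comp z (hu.differentiable (by simp) z).hasFDerivAt
  have h' : fderiv ℝ (fun z => L (u z)) z = _ := h.fderiv
  rw [h']
  rfl

/-- The real and imaginary parts of a function with a lateral trace satisfy Green's formula in the
strong sense, by passing to the limit in the formula for the smooth approximations. -/
theorem IsLateralTrace.strongTrace {f g : ℝ × EuclideanSpace ℝ (Fin n) → ℂ}
    (h : IsLateralTrace T Ω f g) (hΩ : IsSmoothBoundedDomain Ω) (hf : MemL2H1 T Ω f)
    {L : ℂ →L[ℝ] ℝ} (hL : ∀ c, |L c| ≤ ‖c‖) (i : Fin n) :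
    StrongTrace T Ω i (fun z => L (f z))
      (fun z => L (weakDeriv (spaceTimeCyl T Ω) (spaceDir i) f z)) (fun z => L (g z)) := by
  obtain ⟨hg, u, hu, h1, h2, h3⟩ := h
  have hD := (HasL2WeakDeriv.weakDeriv_spec (hf.2 i)).1
  have m1 : MemLp (fun z => L (f z)) 2 (volume.restrict (spaceTimeCyl T Ω)) :=
    L.comp_memLp' hf.1
  have m2 : MemLp (fun z => L (weakDeriv (spaceTimeCyl T Ω) (spaceDir i) f z)) 2
      (volume.restrict (spaceTimeCyl T Ω)) := L.comp_memLp' hD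
  have m3 : MemLp (fun z => L (g z)) 2 (lateralMeasure T Ω) := L.comp_memLp' hg
  refine ⟨m1, m2, m3, fun a A β ha => ?_⟩
  have hus : ∀ k, ContDiff ℝ ∞ fun z => L (u k z) := fun k => L.contDiff.comp (hu k)
  have hν := hΩ.memLp_mul_normalComp (i := i) ha.2.2.1
  have mk1 : ∀ k, MemLp (fun z => L (u k z)) 2 (volume.restrict (spaceTimeCyl T Ω)) :=
    fun k => hΩ.memLp_of_continuous (hus k).continuous
  have mk2 : ∀ k, MemLp (spaceDeriv i fun z => L (u k z)) 2 (volume.restrict (spaceTimeCyl T Ω)) :=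
    fun k => hΩ.memLp_of_continuous (contDiff_spaceDeriv (hus k) i).continuous
  have t1 := tendsto_integral_mul_of_eLpNorm_tendsto mk1 m1 ha.2.1 (tendsto_eLpNorm_clm_sub hL h1)
  have t2 := tendsto_integral_mul_of_eLpNorm_tendsto mk2 m2 ha.1 (by
    have := tendsto_eLpNorm_clm_sub hL (h2 i)
    simpa only [spaceDeriv, fderiv_clm_comp_apply L (hu _)] using this)
  have t3 := tendsto_integral_mul_of_eLpNorm_tendsto
    (fun k => hΩ.memLp_lateral_of_continuous (T := T) (hus k).continuous) m3 hν
    (tendsto_eLpNorm_clm_sub hL h3)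
  have heq : ∀ k, (∫ z in spaceTimeCyl T Ω, L (u k z) * A z) +
      (∫ z in spaceTimeCyl T Ω, spaceDeriv i (fun z => L (u k z)) z * a z) =
      ∫ z, L (u k z) * (β z * normalComp Ω i z) ∂(lateralMeasure T Ω) := by
    intro k
    have := ha.2.2.2 _ (hus k) (fun _ => 1) measurable_const ⟨1, by simp⟩
    simp only [one_mul] at this
    rw [← this, integral_add ((mk1 k).integrable_fun_mul ha.2.1) ((mk2 k).integrable_fun_mul ha.1)]
  have := tendsto_nhds_unique ((t1.add t2).congr heq) t3
  rw [← this, integral_add (m1.integrable_fun_mul ha.2.1) (m2.integrable_fun_mul ha.1)]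

end Cylinder

/-! ### Square integrals and increments in time -/

section Squares

variable {α : Type*} [MeasurableSpace α] {μ : Measure α}

theorem MeasureTheory.MemLp.ofReal_integral_sq {a : α → ℝ} (ha : MemLp a 2 μ) :
    ENNReal.ofReal (∫ z, a z ^ 2 ∂μ) = eLpNorm a 2 μ ^ 2 := by
  rw [ha.eLpNorm_eq_integral_rpow_norm (by simp) (by simp)]
  rw [← ENNReal.ofReal_pow (by positivity), ← Real.rpow_natCast, ← Real.rpow_mul (by positivity)]
  simp

theorem tendsto_integral_sq_of_eLpNorm_tendsto {a : ℕ → α → ℝ} {b : α → ℝ}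
    (ha : ∀ k, MemLp (a k) 2 μ) (hb : MemLp b 2 μ)
    (h : Tendsto (fun k => eLpNorm (fun z => a k z - b z) 2 μ) atTop (𝓝 0)) :
    Tendsto (fun k => ∫ z, a k z ^ 2 ∂μ) atTop (𝓝 (∫ z, b z ^ 2 ∂μ)) := by
  have h1 : Tendsto (fun k => ∫ z, (a k z - b z) ^ 2 ∂μ) atTop (𝓝 0) := by
    have h2 : Tendsto (fun k => (eLpNorm (fun z => a k z - b z) 2 μ ^ 2).toReal) atTop (𝓝 0) := by
      have := (ENNReal.tendsto_toReal (by simp)).comp (((ENNReal.continuous_pow 2).tendsto 0).comp h)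
      simpa [Function.comp_def] using this
    refine h2.congr fun k => ?_
    have hab : MemLp (fun z => a k z - b z) 2 μ := (ha k).sub hb
    rw [← hab.ofReal_integral_sq, ENNReal.toReal_ofReal]
    exact integral_nonneg fun z => sq_nonneg _
  have h2 := tendsto_integral_mul_of_eLpNorm_tendsto ha hb hb h
  have h3 := (h1.add (h2.const_mul 2)).sub_const (∫ z, b z ^ 2 ∂μ)
  have hlim : 0 + 2 * (∫ z, b z * b z ∂μ) - ∫ z, b z ^ 2 ∂μ = ∫ z, b z ^ 2 ∂μ := by
    simp only [← sq]; ring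
  rw [hlim] at h3
  refine h3.congr fun k => ?_
  have hab : MemLp (fun z => a k z - b z) 2 μ := (ha k).sub hb
  have i1 := hab.integrable_sq
  have i2 := (ha k).integrable_fun_mul hb
  have i3 : Integrable (fun z => (a k z - b z) ^ 2 + 2 * (a k z * b z)) μ :=
    i1.add (i2.const_mul 2)
  rw [← integral_const_mul, ← integral_add i1 (i2.const_mul 2), ← integral_sub i3 hb.integrable_sq]
  congr 1; ext z; ring

/-- Young's inequality for a pairing in `L²`. -/
theorem two_mul_integral_mul_le {a b : α → ℝ} (ha : MemLp a 2 μ) (hb : MemLp b 2 μ) {l : ℝ}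
    (hl : 0 < l) : 2 * ∫ z, a z * b z ∂μ ≤ l * (∫ z, a z ^ 2 ∂μ) + l⁻¹ * ∫ z, b z ^ 2 ∂μ := by
  rw [← integral_const_mul, ← integral_const_mul, ← integral_const_mul,
    ← integral_add (ha.integrable_sq.const_mul l) (hb.integrable_sq.const_mul l⁻¹)]
  refine integral_mono ((ha.integrable_fun_mul hb).const_mul 2)
    ((ha.integrable_sq.const_mul l).add (hb.integrable_sq.const_mul l⁻¹)) fun z => ?_
  have h1 : l * a z ^ 2 + l⁻¹ * b z ^ 2 - 2 * (a z * b z) = l⁻¹ * (l * a z - b z) ^ 2 := by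
    field_simp; ring
  have h2 : 0 ≤ l⁻¹ * (l * a z - b z) ^ 2 := by positivity
  dsimp only
  linarith

end Squares

section OneDim

theorem sq_intervalIntegral_le {g : ℝ → ℝ} (hg : Continuous g) {a b : ℝ} (hab : a ≤ b) :
    (∫ s in a..b, g s) ^ 2 ≤ (b - a) * ∫ s in a..b, g s ^ 2 := by
  rcases hab.eq_or_lt with rfl | hlt
  · simp
  set I := ∫ s in a..b, g s
  set J := ∫ s in a..b, g s ^ 2
  have hpos : 0 < b - a := by linarith
  have h0 : 0 ≤ ∫ s in a..b, (g s - I / (b - a)) ^ 2 :=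
    intervalIntegral.integral_nonneg hab fun s _ => sq_nonneg _
  have h1 : ∫ s in a..b, (g s - I / (b - a)) ^ 2 =
      J - 2 * (I / (b - a)) * I + (b - a) * (I / (b - a)) ^ 2 := by
    have : ∀ s, (g s - I / (b - a)) ^ 2 =
        g s ^ 2 - 2 * (I / (b - a)) * g s + (I / (b - a)) ^ 2 := fun s => by ring
    simp only [this]
    rw [intervalIntegral.integral_add, intervalIntegral.integral_sub,
      intervalIntegral.integral_const_mul, intervalIntegral.integral_const, smul_eq_mul]
    all_goals exact Continuous.intervalIntegrable (by fun_prop) _ _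
  rw [h1] at h0
  have h2 : J - 2 * (I / (b - a)) * I + (b - a) * (I / (b - a)) ^ 2 = J - I ^ 2 / (b - a) := by
    field_simp; ring
  rw [h2, sub_nonneg, div_le_iff₀ hpos] at h0
  linarith

/-- The increments over a time `h` of a function on `(0, T)` extended by zero; the jump at `t = 0`
contributes the last term. -/
theorem integral_sq_sub_delay_le {g : ℝ → ℝ} (hg : ContDiff ℝ 1 g) {T h : ℝ} (hh : 0 < h)
    (hhT : h < T) :
    ∫ t in Ioo 0 T, (g t - (Ioo 0 T).indicator g (t - h)) ^ 2 ≤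
      2 * h ^ 2 * (∫ t in Ioo 0 T, deriv g t ^ 2) + 2 * h * g 0 ^ 2 := by
  have hT : 0 < T := hh.trans hhT
  have hg' : Continuous (deriv g) := hg.continuous_deriv le_rfl
  have hd : ∀ a b, ∫ s in a..b, deriv g s = g b - g a := fun a b =>
    intervalIntegral.integral_deriv_eq_sub (fun s _ => hg.differentiable one_ne_zero s)
      (hg'.intervalIntegrable _ _)
  have hI : ∀ a b, IntervalIntegrable (fun s => deriv g s ^ 2) volume a b := fun a b =>
    (hg'.pow 2).intervalIntegrable _ _
  set G : ℝ → ℝ := fun t => ∫ s in (0 : ℝ)..t, deriv g s ^ 2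
  have hGc : Continuous G := intervalIntegral.continuous_primitive hI 0
  have hGmono : ∀ a b, 0 ≤ a → a ≤ b → G a ≤ G b := fun a b ha hab =>
    intervalIntegral.integral_mono_interval le_rfl ha hab
      (Eventually.of_forall fun s => sq_nonneg _) (hI 0 b)
  have hsub : ∀ a b, ∫ s in a..b, deriv g s ^ 2 = G b - G a := fun a b =>
    (intervalIntegral.integral_interval_sub_left (hI 0 b) (hI 0 a)).symm
  -- pointwise bounds before and after the time `h`
  have hb1 : ∀ t ∈ Ioc 0 h, (g t - (Ioo 0 T).indicator g (t - h)) ^ 2 ≤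
      2 * h * G t + 2 * g 0 ^ 2 := by
    intro t ht
    rw [indicator_of_notMem (by simp only [mem_Ioo, not_and]; intro h1; linarith [ht.2]), sub_zero]
    have h1 := sq_intervalIntegral_le hg' ht.1.le
    rw [hd, hsub] at h1
    have hG0 : G 0 = 0 := by simp [G]
    have hGt : 0 ≤ G t := by rw [← hG0]; exact hGmono 0 t le_rfl ht.1.le
    rw [hG0] at h1
    have h2 : (t - 0) * (G t - 0) ≤ h * G t := by
      simp only [sub_zero]; exact mul_le_mul_of_nonneg_right ht.2 hGt
    nlinarith [sq_nonneg (g t - g 0 - g 0)]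
  have hb2 : ∀ t ∈ Ioc h T, (g t - (Ioo 0 T).indicator g (t - h)) ^ 2 ≤
      2 * h * (G t - G (t - h)) := by
    intro t ht
    rw [indicator_of_mem (by constructor <;> linarith [ht.1, ht.2])]
    have h1 := sq_intervalIntegral_le hg' (by linarith : t - h ≤ t)
    rw [hd, hsub] at h1
    have h2 := hGmono (t - h) t (by linarith [ht.1]) (by linarith)
    nlinarith
  have hmeas : AEStronglyMeasurable (fun t => (g t - (Ioo 0 T).indicator g (t - h)) ^ 2)
      (volume : Measure ℝ) := by
    have h1 : Measurable ((Ioo 0 T).indicator g) :=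
      hg.continuous.measurable.indicator measurableSet_Ioo
    have h2 : Measurable fun t => (Ioo 0 T).indicator g (t - h) := by
      exact h1.comp (measurable_id.sub_const h)
    exact ((hg.continuous.measurable.sub h2).pow_const 2).aestronglyMeasurable
  have hi1' : IntegrableOn (fun t => 2 * h * G t + 2 * g 0 ^ 2) (Ioc 0 h) :=
    (Continuous.intervalIntegrable (by fun_prop) 0 h).1
  have hi2' : IntegrableOn (fun t => 2 * h * (G t - G (t - h))) (Ioc h T) :=
    (Continuous.intervalIntegrable (by fun_prop) h T).1
  have hi1 : IntegrableOn (fun t => (g t - (Ioo 0 T).indicator g (t - h)) ^ 2) (Ioc 0 h) := by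
    refine Integrable.mono' hi1' hmeas.restrict ?_
    filter_upwards [ae_restrict_mem measurableSet_Ioc] with t ht
    rw [Real.norm_of_nonneg (sq_nonneg _)]
    exact hb1 t ht
  have hi2 : IntegrableOn (fun t => (g t - (Ioo 0 T).indicator g (t - h)) ^ 2) (Ioc h T) := by
    refine Integrable.mono' hi2' hmeas.restrict ?_
    filter_upwards [ae_restrict_mem measurableSet_Ioc] with t ht
    rw [Real.norm_of_nonneg (sq_nonneg _)]
    exact hb2 t ht
  have hsplit : ∫ t in Ioo 0 T, (g t - (Ioo 0 T).indicator g (t - h)) ^ 2 =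
      (∫ t in Ioc 0 h, (g t - (Ioo 0 T).indicator g (t - h)) ^ 2) +
        ∫ t in Ioc h T, (g t - (Ioo 0 T).indicator g (t - h)) ^ 2 := by
    rw [← integral_Ioc_eq_integral_Ioo, ← Ioc_union_Ioc_eq_Ioc hh.le hhT.le,
      setIntegral_union (Ioc_disjoint_Ioc_of_le le_rfl) measurableSet_Ioc hi1 hi2]
  have hGT : ∫ t in Ioo 0 T, deriv g t ^ 2 = G T := by
    rw [← integral_Ioc_eq_integral_Ioo, ← intervalIntegral.integral_of_le hT.le]
  have e1 : ∫ t in Ioc 0 h, (2 * h * G t + 2 * g 0 ^ 2) =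
      2 * h * (∫ t in (0 : ℝ)..h, G t) + 2 * h * g 0 ^ 2 := by
    rw [← intervalIntegral.integral_of_le hh.le, intervalIntegral.integral_add
      (Continuous.intervalIntegrable (by fun_prop) _ _) (by simp),
      intervalIntegral.integral_const_mul, intervalIntegral.integral_const, smul_eq_mul]
    ring
  have e2 : ∫ t in Ioc h T, 2 * h * (G t - G (t - h)) =
      2 * h * ((∫ t in h..T, G t) - ∫ t in (0 : ℝ)..(T - h), G t) := by
    rw [← intervalIntegral.integral_of_le hhT.le, intervalIntegral.integral_const_mul,
      intervalIntegral.integral_sub (Continuous.intervalIntegrable (by fun_prop) _ _)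
        (Continuous.intervalIntegrable (by fun_prop) _ _),
      intervalIntegral.integral_comp_sub_right (fun t => G t) h, sub_self]
  have e3 : (∫ t in (0 : ℝ)..h, G t) + ((∫ t in h..T, G t) - ∫ t in (0 : ℝ)..(T - h), G t) =
      ∫ t in (T - h)..T, G t := by
    rw [← add_sub_assoc, intervalIntegral.integral_add_adjacent_intervals
      (hGc.intervalIntegrable _ _) (hGc.intervalIntegrable _ _),
      intervalIntegral.integral_interval_sub_left (hGc.intervalIntegrable _ _)
        (hGc.intervalIntegrable _ _)]
  have e4 : ∫ t in (T - h)..T, G t ≤ h * G T := by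
    have : ∫ t in (T - h)..T, G t ≤ ∫ t in (T - h)..T, G T :=
      intervalIntegral.integral_mono_on (by linarith) (hGc.intervalIntegrable _ _) (by simp)
        fun t ht => hGmono t T (by linarith [ht.1]) ht.2
    rw [intervalIntegral.integral_const, smul_eq_mul] at this
    linarith
  rw [hsplit, hGT]
  have f1 := setIntegral_mono_on hi1 hi1' measurableSet_Ioc hb1
  have f2 := setIntegral_mono_on hi2 hi2' measurableSet_Ioc hb2
  rw [e1] at f1
  rw [e2] at f2
  nlinarith

end OneDim

/-! ### Delayed functions and vanishing initial values -/

section Time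

variable {n : ℕ} {Ω : Set (EuclideanSpace ℝ (Fin n))} {T : ℝ}

instance isAddHaarMeasure_volume_spaceTime :
    (volume : Measure (ℝ × EuclideanSpace ℝ (Fin n))).IsAddHaarMeasure := by
  rw [Measure.volume_eq_prod]; infer_instance

/-- The function `g` on the cylinder, extended by zero and delayed by the time `h`. -/
def delayed (T : ℝ) (Ω : Set (EuclideanSpace ℝ (Fin n))) (h : ℝ)
    (g : ℝ × EuclideanSpace ℝ (Fin n) → ℝ) (z : ℝ × EuclideanSpace ℝ (Fin n)) : ℝ :=
  (spaceTimeCyl T Ω).indicator g (z - (h, 0))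

theorem IsSmoothBoundedDomain.memLp_delayed (hΩ : IsSmoothBoundedDomain Ω) (h : ℝ)
    {g : ℝ × EuclideanSpace ℝ (Fin n) → ℝ} (hg : MemLp g 2 (volume.restrict (spaceTimeCyl T Ω))) :
    MemLp (delayed T Ω h g) 2 (volume : Measure (ℝ × EuclideanSpace ℝ (Fin n))) :=
  ((memLp_indicator_iff_restrict (hΩ.measurableSet_spaceTimeCyl T)).2 hg).comp_measurePreserving
    (measurePreserving_sub_right volume _)

theorem IsSmoothBoundedDomain.memLp_delayed_restrict (hΩ : IsSmoothBoundedDomain Ω) (h : ℝ)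
    {g : ℝ × EuclideanSpace ℝ (Fin n) → ℝ} (hg : MemLp g 2 (volume.restrict (spaceTimeCyl T Ω))) :
    MemLp (delayed T Ω h g) 2 (volume.restrict (spaceTimeCyl T Ω)) :=
  (hΩ.memLp_delayed h hg).restrict _

theorem IsSmoothBoundedDomain.eLpNorm_delayed_le (hΩ : IsSmoothBoundedDomain Ω) (h : ℝ)
    {g : ℝ × EuclideanSpace ℝ (Fin n) → ℝ}
    (hg : AEStronglyMeasurable g (volume.restrict (spaceTimeCyl T Ω))) :
    eLpNorm (delayed T Ω h g) 2 (volume.restrict (spaceTimeCyl T Ω)) ≤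
      eLpNorm g 2 (volume.restrict (spaceTimeCyl T Ω)) := by
  have hQ := hΩ.measurableSet_spaceTimeCyl T
  calc _ ≤ eLpNorm (delayed T Ω h g) 2 volume := eLpNorm_restrict_le _ _ _ _
    _ = eLpNorm ((spaceTimeCyl T Ω).indicator g) 2 volume :=
        eLpNorm_comp_measurePreserving ((aestronglyMeasurable_indicator_iff hQ).2 hg)
          (measurePreserving_sub_right volume _)
    _ = _ := eLpNorm_indicator_eq_eLpNorm_restrict hQ

/-- Change of variables for an integral against a delayed function. -/
theorem IsSmoothBoundedDomain.setIntegral_mul_delayed (hΩ : IsSmoothBoundedDomain Ω) {h : ℝ}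
    (hh : 0 ≤ h) (p g : ℝ × EuclideanSpace ℝ (Fin n) → ℝ) :
    ∫ z in spaceTimeCyl T Ω, p z * delayed T Ω h g z =
      ∫ z in spaceTimeCyl T Ω, (Iio T).indicator 1 (z.1 + h) * (p (z + (h, 0)) * g z) := by
  have hQ := hΩ.measurableSet_spaceTimeCyl T
  rw [← integral_indicator hQ, ← integral_indicator hQ,
    ← integral_add_right_eq_self _ ((h, 0) : ℝ × EuclideanSpace ℝ (Fin n))]
  congr 1
  ext z
  by_cases hz : z ∈ spaceTimeCyl T Ω
  · rw [indicator_of_mem hz]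
    by_cases ht : z.1 + h < T
    · have hz' : z + (h, 0) ∈ spaceTimeCyl T Ω := by
        refine ⟨⟨?_, ht⟩, ?_⟩
        · have := hz.1.1
          change 0 < z.1 + h
          linarith
        · change z.2 + 0 ∈ Ω
          rw [add_zero]; exact hz.2
      rw [indicator_of_mem hz', indicator_of_mem (show z.1 + h ∈ Iio T from ht), delayed,
        add_sub_cancel_right, indicator_of_mem hz]
      simp
    · have hz' : z + (h, 0) ∉ spaceTimeCyl T Ω := fun hz' => ht hz'.1.2
      rw [indicator_of_notMem hz', indicator_of_notMem (show z.1 + h ∉ Iio T from ht), zero_mul]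
  · rw [indicator_of_notMem hz, indicator_apply_eq_zero]
    intro _
    rw [delayed, add_sub_cancel_right, indicator_of_notMem hz, mul_zero]

theorem fderiv_comp_add_right_apply (p : ℝ × EuclideanSpace ℝ (Fin n) → ℝ)
    (c z e : ℝ × EuclideanSpace ℝ (Fin n)) :
    fderiv ℝ (fun z => p (z + c)) z e = fderiv ℝ p (z + c) e := by
  rw [fderiv_comp_add_right]

/-- A function with zero lateral trace can be delayed: Green's formula for the delayed function is the
one for the original function, tested with a translate that is cut off at time `T - h`. -/
theorem WeakTrace.delayed (hΩ : IsSmoothBoundedDomain Ω) {i : Fin n}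
    {g G : ℝ × EuclideanSpace ℝ (Fin n) → ℝ} (hg : WeakTrace T Ω i g G fun _ => 0) {h : ℝ}
    (hh : 0 ≤ h) :
    WeakTrace T Ω i (delayed T Ω h g) (delayed T Ω h G) fun _ => 0 := by
  obtain ⟨h1, h2, h3, h4⟩ := hg
  refine ⟨hΩ.memLp_delayed_restrict h h1, hΩ.memLp_delayed_restrict h h2, h3,
    fun p hp θ hθ hb => ?_⟩
  have hsh : ContDiff ℝ ∞ fun z : ℝ × EuclideanSpace ℝ (Fin n) => p (z + (h, 0)) :=
    hp.comp (contDiff_id.add contDiff_const)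
  have hθ' : Measurable fun t => (Iio T).indicator (1 : ℝ → ℝ) (t + h) * θ (t + h) :=
    ((measurable_one.indicator measurableSet_Iio).mul hθ).comp (measurable_id.add_const h)
  have hb' : ∃ C, ∀ t, |(Iio T).indicator (1 : ℝ → ℝ) (t + h) * θ (t + h)| ≤ C := by
    obtain ⟨C, hC⟩ := hb
    refine ⟨C, fun t => ?_⟩
    rw [abs_mul]
    have h1 : |(Iio T).indicator (1 : ℝ → ℝ) (t + h)| ≤ 1 := by
      by_cases ht : t + h ∈ Iio T <;> simp [ht]
    calc _ ≤ 1 * |θ (t + h)| := by gcongr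
      _ ≤ C := by rw [one_mul]; exact hC _
  have hkey := h4 _ hsh _ hθ' hb'
  simp only [zero_mul, mul_zero, integral_zero] at hkey ⊢
  have e1 := hΩ.setIntegral_mul_delayed (T := T) hh (fun z => θ z.1 * p z) G
  have e2 := hΩ.setIntegral_mul_delayed (T := T) hh (fun z => θ z.1 * spaceDeriv i p z) g
  have m1 : MemLp (fun z => θ z.1 * p z) 2 (volume.restrict (spaceTimeCyl T Ω)) :=
    memLp_time_mul hθ hb (hΩ.memLp_of_continuous hp.continuous)
  have m2 : MemLp (fun z => θ z.1 * spaceDeriv i p z) 2 (volume.restrict (spaceTimeCyl T Ω)) :=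
    memLp_time_mul hθ hb (hΩ.memLp_of_continuous (contDiff_spaceDeriv hp i).continuous)
  have m1' : MemLp (fun z => (Iio T).indicator (1 : ℝ → ℝ) (z.1 + h) * θ (z.1 + h) *
      p (z + (h, 0))) 2 (volume.restrict (spaceTimeCyl T Ω)) :=
    memLp_time_mul hθ' hb' (hΩ.memLp_of_continuous hsh.continuous)
  have m2' : MemLp (fun z => (Iio T).indicator (1 : ℝ → ℝ) (z.1 + h) * θ (z.1 + h) *
      spaceDeriv i p (z + (h, 0))) 2 (volume.restrict (spaceTimeCyl T Ω)) :=
    memLp_time_mul hθ' hb' (hΩ.memLp_of_continuous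
      ((contDiff_spaceDeriv hp i).continuous.comp (continuous_id.add continuous_const)))
  calc _ = (∫ z in spaceTimeCyl T Ω, (θ z.1 * p z) * _root_.delayed T Ω h G z) +
        ∫ z in spaceTimeCyl T Ω, (θ z.1 * spaceDeriv i p z) * _root_.delayed T Ω h g z := by
        rw [← integral_add (m1.integrable_fun_mul (hΩ.memLp_delayed_restrict h h2))
          (m2.integrable_fun_mul (hΩ.memLp_delayed_restrict h h1))]
        congr 1; ext z; ring
    _ = (∫ z in spaceTimeCyl T Ω, (Iio T).indicator (1 : ℝ → ℝ) (z.1 + h) * θ (z.1 + h) *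
          p (z + (h, 0)) * G z) + ∫ z in spaceTimeCyl T Ω,
          (Iio T).indicator (1 : ℝ → ℝ) (z.1 + h) * θ (z.1 + h) *
          spaceDeriv i p (z + (h, 0)) * g z := by
        rw [e1, e2]
        congr 1
        · congr 1; ext z; simp only [Prod.fst_add]; ring
        · congr 1; ext z; simp only [Prod.fst_add]; ring
    _ = 0 := by
        rw [← integral_add (m1'.integrable_fun_mul h2) (m2'.integrable_fun_mul h1), ← hkey]
        congr 1; ext z
        simp only [spaceDeriv, fderiv_comp_add_right_apply]
        ring

/-- The increment in time of an `L²` function that vanishes before the time `0` pairs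
nonnegatively with the function, since `2 g (g - g_h) ≥ g² - g_h²` and the delayed function `g_h`
has at most the norm of `g`. -/
theorem IsSmoothBoundedDomain.setIntegral_mul_sub_delayed_nonneg (hΩ : IsSmoothBoundedDomain Ω)
    {g : ℝ × EuclideanSpace ℝ (Fin n) → ℝ} (hg : MemLp g 2 (volume.restrict (spaceTimeCyl T Ω)))
    {η : EuclideanSpace ℝ (Fin n) → ℝ} (hη : Continuous η) (hη0 : ∀ x ∈ Ω, 0 ≤ η x) {h : ℝ}
    (hh : 0 ≤ h) : 0 ≤ ∫ z in spaceTimeCyl T Ω, η z.2 * g z * (g z - delayed T Ω h g z) := by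
  have hQ := hΩ.measurableSet_spaceTimeCyl T
  have hd := hΩ.memLp_delayed_restrict (T := T) h hg
  have hη2 : Continuous fun z : ℝ × EuclideanSpace ℝ (Fin n) => η z.2 := hη.comp continuous_snd
  have i1 : Integrable (fun z => η z.2 * g z * g z) (volume.restrict (spaceTimeCyl T Ω)) :=
    (hΩ.memLp_continuous_mul hη2 hg).integrable_fun_mul hg
  have i2 : Integrable (fun z => η z.2 * delayed T Ω h g z * delayed T Ω h g z)
      (volume.restrict (spaceTimeCyl T Ω)) :=
    (hΩ.memLp_continuous_mul hη2 hd).integrable_fun_mul hd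
  have i3 : Integrable (fun z => η z.2 * g z * (g z - delayed T Ω h g z))
      (volume.restrict (spaceTimeCyl T Ω)) :=
    (hΩ.memLp_continuous_mul hη2 hg).integrable_fun_mul (hg.sub hd)
  have hle : ∫ z in spaceTimeCyl T Ω, η z.2 * delayed T Ω h g z * delayed T Ω h g z ≤
      ∫ z in spaceTimeCyl T Ω, η z.2 * g z * g z := by
    have e1 : ∫ z in spaceTimeCyl T Ω, η z.2 * delayed T Ω h g z * delayed T Ω h g z =
        ∫ z in spaceTimeCyl T Ω, (Iio T).indicator 1 (z.1 + h) * (η z.2 * g z * g z) := by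
      rw [hΩ.setIntegral_mul_delayed hh]
      refine setIntegral_congr_fun hQ fun z hz => ?_
      simp only [Prod.snd_add, add_zero]
      rw [delayed, add_sub_cancel_right, indicator_of_mem hz]
    rw [e1]
    have hnn : ∀ z ∈ spaceTimeCyl T Ω, 0 ≤ η z.2 * g z * g z := fun z hz => by
      rw [mul_assoc]; exact mul_nonneg (hη0 _ hz.2) (mul_self_nonneg _)
    have hbd : ∀ z : ℝ × EuclideanSpace ℝ (Fin n), z ∈ spaceTimeCyl T Ω →
        (Iio T).indicator 1 (z.1 + h) * (η z.2 * g z * g z) ≤ η z.2 * g z * g z := by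
      intro z hz
      by_cases ht : z.1 + h ∈ Iio T
      · simp [ht]
      · rw [indicator_of_notMem ht, zero_mul]; exact hnn z hz
    refine setIntegral_mono_on ?_ i1 hQ hbd
    refine Integrable.mono i1 ?_ ?_
    · refine AEStronglyMeasurable.mul ?_ i1.aestronglyMeasurable
      exact (((measurable_one.indicator measurableSet_Iio).comp
        (measurable_id.add_const h)).comp measurable_fst).aestronglyMeasurable
    · refine Eventually.of_forall fun z => ?_
      by_cases ht : z.1 + h ∈ Iio T <;> simp [ht]
      positivity
  have : (∫ z in spaceTimeCyl T Ω, η z.2 * g z * g z) -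
      (∫ z in spaceTimeCyl T Ω, η z.2 * delayed T Ω h g z * delayed T Ω h g z) ≤
      2 * ∫ z in spaceTimeCyl T Ω, η z.2 * g z * (g z - delayed T Ω h g z) := by
    rw [← integral_const_mul, ← integral_sub i1 i2]
    refine setIntegral_mono_on (i1.sub i2) (i3.const_mul 2) hQ fun z hz => ?_
    have := mul_nonneg (hη0 _ hz.2) (sq_nonneg (g z - delayed T Ω h g z))
    linarith
  linarith

/-- `wt` is the time derivative of `w` in the cylinder and `w` vanishes at `t = 0`, both in the
sense of approximation by smooth functions that vanish at `t = 0`. -/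
def InitialZero (T : ℝ) (Ω : Set (EuclideanSpace ℝ (Fin n)))
    (w wt : ℝ × EuclideanSpace ℝ (Fin n) → ℝ) : Prop :=
  MemLp w 2 (volume.restrict (spaceTimeCyl T Ω)) ∧
  MemLp wt 2 (volume.restrict (spaceTimeCyl T Ω)) ∧
  ∃ u : ℕ → ℝ × EuclideanSpace ℝ (Fin n) → ℝ, (∀ k, ContDiff ℝ ∞ (u k)) ∧
    (∀ k x, u k (0, x) = 0) ∧
    Tendsto (fun k => eLpNorm (fun z => u k z - w z) 2 (volume.restrict (spaceTimeCyl T Ω)))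
      atTop (𝓝 0) ∧
    Tendsto (fun k => eLpNorm (fun z => fderiv ℝ (u k) z (timeDir n) - wt z) 2
      (volume.restrict (spaceTimeCyl T Ω))) atTop (𝓝 0)

/-- The approximating functions are made to vanish at `t = 0` by subtracting their initial values,
which tend to zero in `L²(Ω)`. -/
theorem IsInitialTrace.initialZero {f : ℝ × EuclideanSpace ℝ (Fin n) → ℂ}
    (h : IsInitialTrace T Ω f 0) (hf : MemH1 T Ω f)
    {L : ℂ →L[ℝ] ℝ} (hL : ∀ c, |L c| ≤ ‖c‖) :
    InitialZero T Ω (fun z => L (f z))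
      (fun z => L (weakDeriv (spaceTimeCyl T Ω) (timeDir n) f z)) := by
  obtain ⟨-, u, hu, h1, h2, h3⟩ := h
  have m1 : MemLp (fun z => L (f z)) 2 (volume.restrict (spaceTimeCyl T Ω)) :=
    L.comp_memLp' hf.1
  have hproj : ContDiff ℝ ∞ fun z : ℝ × EuclideanSpace ℝ (Fin n) => ((0 : ℝ), z.2) := by fun_prop
  have hLu : ∀ k, ContDiff ℝ ∞ fun z => L (u k z) := fun k => L.contDiff.comp (hu k)
  have hLu0 : ∀ k, ContDiff ℝ ∞ fun z : ℝ × EuclideanSpace ℝ (Fin n) => L (u k (0, z.2)) :=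
    fun k => (hLu k).comp hproj
  refine ⟨m1, L.comp_memLp' (HasL2WeakDeriv.weakDeriv_spec hf.2.1).1,
    fun k z => L (u k z) - L (u k (0, z.2)), fun k => (hLu k).sub (hLu0 k), fun k x => sub_self _,
    ?_, ?_⟩
  · have t1 := tendsto_eLpNorm_clm_sub hL h1
    have t2 : Tendsto (fun k => volume (Ioo 0 T) ^ (1 / 2 : ENNReal).toReal *
        eLpNorm (fun x => u k (0, x)) 2 (volume.restrict Ω)) atTop (𝓝 0) := by
      have := ENNReal.Tendsto.const_mul (a := volume (Ioo 0 T) ^ (1 / 2 : ENNReal).toReal) h3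
        (Or.inr (by simp))
      simpa using this
    have t3 := t1.add t2
    rw [add_zero] at t3
    refine tendsto_of_tendsto_of_tendsto_of_le_of_le tendsto_const_nhds t3 (fun _ => zero_le)
      fun k => ?_
    have n1 : AEStronglyMeasurable (fun z => L (u k z) - L (f z))
        (volume.restrict (spaceTimeCyl T Ω)) :=
      (hLu k).continuous.aestronglyMeasurable.sub m1.aestronglyMeasurable
    have n2 : AEStronglyMeasurable (fun z : ℝ × EuclideanSpace ℝ (Fin n) => L (u k (0, z.2)))
        (volume.restrict (spaceTimeCyl T Ω)) := (hLu0 k).continuous.aestronglyMeasurable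
    have hle : eLpNorm (fun z : ℝ × EuclideanSpace ℝ (Fin n) => L (u k (0, z.2))) 2
        (volume.restrict (spaceTimeCyl T Ω)) ≤ volume (Ioo 0 T) ^ (1 / 2 : ENNReal).toReal *
        eLpNorm (fun x => u k (0, x)) 2 (volume.restrict Ω) := by
      have hm : AEStronglyMeasurable (fun x : EuclideanSpace ℝ (Fin n) => u k (0, x))
          (volume.restrict Ω) := ((hu k).continuous.comp (by fun_prop)).aestronglyMeasurable
      calc _ ≤ eLpNorm ((fun x => u k (0, x)) ∘ Prod.snd) 2
            (volume.restrict (spaceTimeCyl T Ω)) := eLpNorm_mono fun z => hL _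
        _ = _ := by
          have hmap : Measure.map Prod.snd ((volume.restrict (Ioo 0 T)).prod
              ((volume : Measure (EuclideanSpace ℝ (Fin n))).restrict Ω)) =
              volume (Ioo 0 T) • volume.restrict Ω := by
            rw [Measure.map_snd_prod, Measure.restrict_apply_univ]
          rw [volume_restrict_spaceTimeCyl, ← eLpNorm_map_measure (by
            rw [hmap]; exact hm.smul_measure _) measurable_snd.aemeasurable, hmap,
            eLpNorm_smul_measure_of_ne_top (by simp), smul_eq_mul]
    have hsub := (eLpNorm_sub_le n1 n2 one_le_two).trans (add_le_add_right hle _)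
    refine le_trans (le_of_eq ?_) hsub
    congr 1; ext z; simp only [Pi.sub_apply]; ring
  · have := tendsto_eLpNorm_clm_sub hL h2
    refine this.congr fun k => ?_
    congr 1
    ext z
    have hd := ((hLu0 k).differentiable (by simp) z)
    rw [fderiv_fun_sub ((hLu k).differentiable (by simp) z) hd, sub_apply,
      fderiv_clm_comp_apply L (hu _)]
    have hcomp : HasFDerivAt (fun z : ℝ × EuclideanSpace ℝ (Fin n) => ((0 : ℝ), z.2))
        ((0 : ℝ × EuclideanSpace ℝ (Fin n) →L[ℝ] ℝ).prod (ContinuousLinearMap.snd ℝ ℝ _)) z :=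
      (hasFDerivAt_const (0 : ℝ) z).prodMk hasFDerivAt_snd
    have h0 := (((hLu k).differentiable (by simp) (0, z.2)).hasFDerivAt.comp z hcomp).fderiv
    have h0' : fderiv ℝ (fun z : ℝ × EuclideanSpace ℝ (Fin n) => L (u k (0, z.2))) z = _ := h0
    rw [h0']
    have hz : ((0 : ℝ), (0 : EuclideanSpace ℝ (Fin n))) = 0 := rfl
    simp [timeDir, hz]

theorem contDiff_timeDeriv {p : ℝ × EuclideanSpace ℝ (Fin n) → ℝ} (hp : ContDiff ℝ ∞ p) :
    ContDiff ℝ ∞ fun z => fderiv ℝ p z (timeDir n) :=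
  (hp.fderiv_right (m := ∞) (by simp)).clm_apply contDiff_const

theorem timeDeriv_mul {p q : ℝ × EuclideanSpace ℝ (Fin n) → ℝ} (hp : ContDiff ℝ ∞ p)
    (hq : ContDiff ℝ ∞ q) (z : ℝ × EuclideanSpace ℝ (Fin n)) :
    fderiv ℝ (fun z => p z * q z) z (timeDir n) =
      p z * fderiv ℝ q z (timeDir n) + fderiv ℝ p z (timeDir n) * q z := by
  have hp' := hp.differentiable (by simp) z
  have hq' := hq.differentiable (by simp) z
  rw [fderiv_fun_mul hp' hq']
  simp [mul_comm]

theorem InitialZero.contDiff_mul {w wt : ℝ × EuclideanSpace ℝ (Fin n) → ℝ}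
    (h : InitialZero T Ω w wt) (hΩ : IsSmoothBoundedDomain Ω)
    {a : ℝ × EuclideanSpace ℝ (Fin n) → ℝ} (ha : ContDiff ℝ ∞ a) :
    InitialZero T Ω (fun z => a z * w z)
      (fun z => a z * wt z + fderiv ℝ a z (timeDir n) * w z) := by
  obtain ⟨m1, m2, u, hu, h0, h1, h2⟩ := h
  have hat := contDiff_timeDeriv ha
  refine ⟨hΩ.memLp_continuous_mul ha.continuous m1, (hΩ.memLp_continuous_mul ha.continuous m2).add
    (hΩ.memLp_continuous_mul hat.continuous m1), fun k z => a z * u k z, fun k => ha.mul (hu k),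
    fun k x => by simp [h0 k x],
    tendsto_eLpNorm_mul_sub (hΩ.ae_mem_cylinder T) (hΩ.isCompact_cylinder T) ha.continuous h1,
    ?_⟩
  · have t1 := tendsto_eLpNorm_mul_sub (hΩ.ae_mem_cylinder T) (hΩ.isCompact_cylinder T)
      ha.continuous h2
    have t2 := tendsto_eLpNorm_mul_sub (hΩ.ae_mem_cylinder T) (hΩ.isCompact_cylinder T)
      hat.continuous h1
    have t3 := t1.add t2
    rw [add_zero] at t3
    refine tendsto_of_tendsto_of_tendsto_of_le_of_le tendsto_const_nhds t3 (fun _ => zero_le)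
      fun k => ?_
    have n1 : MemLp (fun z => a z * fderiv ℝ (u k) z (timeDir n) - a z * wt z) 2
        (volume.restrict (spaceTimeCyl T Ω)) :=
      (hΩ.memLp_of_continuous (ha.continuous.mul (contDiff_timeDeriv (hu k)).continuous)).sub
        (hΩ.memLp_continuous_mul ha.continuous m2)
    have n2 : MemLp (fun z => fderiv ℝ a z (timeDir n) * u k z - fderiv ℝ a z (timeDir n) * w z) 2
        (volume.restrict (spaceTimeCyl T Ω)) :=
      (hΩ.memLp_of_continuous (hat.continuous.mul (hu k).continuous)).sub
        (hΩ.memLp_continuous_mul hat.continuous m1)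
    refine le_trans (le_of_eq ?_) (eLpNorm_add_le n1.aestronglyMeasurable n2.aestronglyMeasurable
      one_le_two)
    congr 1
    ext z
    simp only [timeDeriv_mul ha (hu k), Pi.add_apply]
    ring

end Time

/-! ### Difference quotients in time -/

section TimeDerivative

variable {n : ℕ} {Ω : Set (EuclideanSpace ℝ (Fin n))} {T : ℝ}

theorem hasDerivAt_timeSlice {u : ℝ × EuclideanSpace ℝ (Fin n) → ℝ} (hu : ContDiff ℝ ∞ u)
    (x : EuclideanSpace ℝ (Fin n)) (t : ℝ) :
    HasDerivAt (fun s => u (s, x)) (fderiv ℝ u (t, x) (timeDir n)) t := by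
  have h1 : HasFDerivAt (fun s : ℝ => (s, x))
      (ContinuousLinearMap.inl ℝ ℝ (EuclideanSpace ℝ (Fin n))) t := hasFDerivAt_prodMk_left t x
  have h2 := ((hu.differentiable (by simp) (t, x)).hasFDerivAt.comp t h1).hasDerivAt
  exact h2

theorem delayed_apply_of_mem {h : ℝ} (g : ℝ × EuclideanSpace ℝ (Fin n) → ℝ)
    {x : EuclideanSpace ℝ (Fin n)} (hx : x ∈ Ω) (t : ℝ) :
    delayed T Ω h g (t, x) = (Ioo 0 T).indicator (fun s => g (s, x)) (t - h) := by
  have hz : ((t, x) : ℝ × EuclideanSpace ℝ (Fin n)) - (h, 0) = (t - h, x) := by simp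
  rw [delayed, hz]
  by_cases ht : t - h ∈ Ioo 0 T
  · rw [indicator_of_mem ht, indicator_of_mem (show (t - h, x) ∈ spaceTimeCyl T Ω from ⟨ht, hx⟩)]
  · rw [indicator_of_notMem ht, indicator_of_notMem fun h => ht h.1]

theorem delayed_sub (h : ℝ) (f g : ℝ × EuclideanSpace ℝ (Fin n) → ℝ)
    (z : ℝ × EuclideanSpace ℝ (Fin n)) :
    delayed T Ω h (fun z => f z - g z) z = delayed T Ω h f z - delayed T Ω h g z := by
  rw [delayed, delayed, delayed, indicator_sub]

theorem IsSmoothBoundedDomain.setIntegral_sq_sub_delayed_le (hΩ : IsSmoothBoundedDomain Ω)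
    {u : ℝ × EuclideanSpace ℝ (Fin n) → ℝ} (hu : ContDiff ℝ ∞ u) (h0 : ∀ x, u (0, x) = 0) {h : ℝ}
    (hh : 0 < h) (hhT : h < T) :
    ∫ z in spaceTimeCyl T Ω, (u z - delayed T Ω h u z) ^ 2 ≤
      2 * h ^ 2 * ∫ z in spaceTimeCyl T Ω, fderiv ℝ u z (timeDir n) ^ 2 := by
  have m1 := hΩ.memLp_of_continuous (T := T) hu.continuous
  have m2 := hΩ.memLp_of_continuous (T := T) (contDiff_timeDeriv hu).continuous
  have i1 := (m1.sub (hΩ.memLp_delayed_restrict h m1)).integrable_sq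
  have i2 := m2.integrable_sq
  rw [volume_restrict_spaceTimeCyl] at i1 i2 ⊢
  simp only [Pi.sub_apply] at i1
  rw [integral_prod_symm _ i1, integral_prod_symm _ i2, ← integral_const_mul]
  refine integral_mono_ae i1.integral_prod_right (i2.integral_prod_right.const_mul _) ?_
  filter_upwards [ae_restrict_mem hΩ.isOpen.measurableSet] with x hx
  have hg : ContDiff ℝ 1 fun t => u (t, x) :=
    (hu.of_le (by simp)).comp (contDiff_id.prodMk contDiff_const)
  have := integral_sq_sub_delay_le hg hh hhT
  simp only [h0, (hasDerivAt_timeSlice hu x _).deriv] at this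
  simpa only [delayed_apply_of_mem u hx, ne_eq, OfNat.ofNat_ne_zero, not_false_eq_true, zero_pow,
    mul_zero, add_zero] using this

theorem InitialZero.sub_contDiff {w wt : ℝ × EuclideanSpace ℝ (Fin n) → ℝ}
    (h : InitialZero T Ω w wt) (hΩ : IsSmoothBoundedDomain Ω)
    {v : ℝ × EuclideanSpace ℝ (Fin n) → ℝ} (hv : ContDiff ℝ ∞ v) (hv0 : ∀ x, v (0, x) = 0) :
    InitialZero T Ω (fun z => w z - v z) fun z => wt z - fderiv ℝ v z (timeDir n) := by
  obtain ⟨m1, m2, u, hu, h0, h1, h2⟩ := h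
  refine ⟨m1.sub (hΩ.memLp_of_continuous hv.continuous),
    m2.sub (hΩ.memLp_of_continuous (contDiff_timeDeriv hv).continuous),
    fun k z => u k z - v z, fun k => (hu k).sub hv, fun k x => by simp [h0 k x, hv0 x], ?_, ?_⟩
  · refine h1.congr fun k => ?_
    congr 1; ext z; ring
  · refine h2.congr fun k => ?_
    congr 1; ext z
    rw [fderiv_fun_sub ((hu k).differentiable (by simp) z) (hv.differentiable (by simp) z),
      sub_apply]
    ring

/-- The difference quotients in time of `w` are bounded in `L²` by its time derivative. -/
theorem InitialZero.setIntegral_sq_sub_delayed_le {w wt : ℝ × EuclideanSpace ℝ (Fin n) → ℝ}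
    (hw : InitialZero T Ω w wt) (hΩ : IsSmoothBoundedDomain Ω) {h : ℝ} (hh : 0 < h) (hhT : h < T) :
    ∫ z in spaceTimeCyl T Ω, (w z - delayed T Ω h w z) ^ 2 ≤
      2 * h ^ 2 * ∫ z in spaceTimeCyl T Ω, wt z ^ 2 := by
  obtain ⟨m1, m2, u, hu, h0, h1, h2⟩ := hw
  have mu := fun k => hΩ.memLp_of_continuous (T := T) (hu k).continuous
  have mdt := fun k => hΩ.memLp_of_continuous (T := T) (contDiff_timeDeriv (hu k)).continuous
  have md : ∀ k, MemLp (fun z => u k z - w z) 2 (volume.restrict (spaceTimeCyl T Ω)) :=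
    fun k => (mu k).sub m1
  have t : Tendsto (fun k => eLpNorm (fun z => (u k z - delayed T Ω h (u k) z) -
      (w z - delayed T Ω h w z)) 2 (volume.restrict (spaceTimeCyl T Ω))) atTop (𝓝 0) := by
    have t3 := h1.add h1
    rw [add_zero] at t3
    refine tendsto_of_tendsto_of_tendsto_of_le_of_le tendsto_const_nhds t3 (fun _ => zero_le)
      fun k => ?_
    have hsub := (eLpNorm_sub_le (md k).aestronglyMeasurable
      (hΩ.memLp_delayed_restrict h (md k)).aestronglyMeasurable one_le_two).trans
      (add_le_add_right (hΩ.eLpNorm_delayed_le h (md k).aestronglyMeasurable) _)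
    refine le_trans (le_of_eq ?_) hsub
    congr 1; ext z; simp only [Pi.sub_apply, delayed_sub]; ring
  have t1 := tendsto_integral_sq_of_eLpNorm_tendsto
    (fun k => (mu k).sub (hΩ.memLp_delayed_restrict h (mu k)))
    (m1.sub (hΩ.memLp_delayed_restrict h m1)) t
  have t2 := (tendsto_integral_sq_of_eLpNorm_tendsto mdt m2 h2).const_mul (2 * h ^ 2)
  exact le_of_tendsto_of_tendsto' t1 t2 fun k =>
    hΩ.setIntegral_sq_sub_delayed_le (hu k) (h0 k) hh hhT

/-- The difference quotients in time of a smooth function that vanishes at `t = 0` converge to its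
time derivative. -/
theorem IsSmoothBoundedDomain.tendsto_setIntegral_mul_sub_delayed_div
    (hΩ : IsSmoothBoundedDomain Ω)
    {f u : ℝ × EuclideanSpace ℝ (Fin n) → ℝ} (hf : MemLp f 2 (volume.restrict (spaceTimeCyl T Ω)))
    (hu : ContDiff ℝ ∞ u) (h0 : ∀ x, u (0, x) = 0) :
    Tendsto (fun h => ∫ z in spaceTimeCyl T Ω, f z * ((u z - delayed T Ω h u z) / h)) (𝓝[>] 0)
      (𝓝 (∫ z in spaceTimeCyl T Ω, f z * fderiv ℝ u z (timeDir n))) := by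
  have := hΩ.isFiniteMeasure_cylinder T
  obtain ⟨C, hC⟩ := (hΩ.isCompact_cylinder T).exists_bound_of_continuousOn
    (contDiff_timeDeriv hu).continuous.continuousOn
  have hQ := hΩ.measurableSet_spaceTimeCyl T
  have m1 := hΩ.memLp_of_continuous (T := T) hu.continuous
  have hlip : ∀ x ∈ Ω, ∀ s ∈ Icc 0 T, ∀ t ∈ Icc 0 T, |u (t, x) - u (s, x)| ≤ C * |t - s| := by
    intro x hx s hs t ht
    exact (convex_Icc 0 T).norm_image_sub_le_of_norm_hasDerivWithin_le
      (fun r _ => (hasDerivAt_timeSlice hu x r).hasDerivWithinAt)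
      (fun r hr => hC (r, x) ⟨hr, subset_closure hx⟩) hs ht
  refine tendsto_integral_filter_of_dominated_convergence (fun z => ‖f z‖ * C) ?_ ?_ ?_ ?_
  · refine Eventually.of_forall fun h => hf.aestronglyMeasurable.mul ?_
    simp only [div_eq_mul_inv]
    exact (m1.sub (hΩ.memLp_delayed_restrict h m1)).aestronglyMeasurable.mul
      aestronglyMeasurable_const
  · filter_upwards [self_mem_nhdsWithin] with h hh
    have hh : 0 < h := hh
    filter_upwards [ae_restrict_mem hQ] with z hz
    obtain ⟨t, x⟩ := z
    obtain ⟨ht, hx⟩ := hz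
    simp only at ht hx
    have hC0 : 0 ≤ C := (norm_nonneg _).trans (hC (t, x) ⟨Ioo_subset_Icc_self ht, subset_closure hx⟩)
    rw [norm_mul]
    refine mul_le_mul_of_nonneg_left ?_ (norm_nonneg _)
    rw [delayed_apply_of_mem u hx, norm_div, Real.norm_of_nonneg hh.le, div_le_iff₀ hh]
    by_cases hth : t - h ∈ Ioo 0 T
    · rw [indicator_of_mem hth]
      refine (hlip x hx _ (Ioo_subset_Icc_self hth) t (Ioo_subset_Icc_self ht)).trans (le_of_eq ?_)
      rw [sub_sub_cancel, abs_of_pos hh]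
    · rw [indicator_of_notMem hth, ← h0 x]
      refine (hlip x hx 0 ⟨le_rfl, by linarith [ht.1, ht.2]⟩ t (Ioo_subset_Icc_self ht)).trans ?_
      rw [sub_zero, abs_of_pos ht.1]
      refine mul_le_mul_of_nonneg_left ?_ hC0
      by_contra hlt
      exact hth ⟨by linarith, by linarith [ht.2]⟩
  · exact (hf.integrable one_le_two).norm.mul_const C
  · filter_upwards [ae_restrict_mem hQ] with z hz
    obtain ⟨t, x⟩ := z
    obtain ⟨ht, hx⟩ := hz
    simp only at ht hx
    refine Tendsto.const_mul _ ?_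
    have hneg : Tendsto (fun h : ℝ => -h) (𝓝[>] 0) (𝓝[≠] 0) := by
      refine tendsto_nhdsWithin_iff.2 ⟨?_, ?_⟩
      · have : Tendsto (fun h : ℝ => -h) (𝓝 0) (𝓝 0) := by simpa using tendsto_neg (0 : ℝ)
        exact this.mono_left nhdsWithin_le_nhds
      · filter_upwards [self_mem_nhdsWithin] with h hh
        exact neg_ne_zero.2 (ne_of_gt hh)
    have hs := (hasDerivAt_timeSlice hu x t).tendsto_slope_zero.comp hneg
    refine hs.congr' ?_
    filter_upwards [Ioo_mem_nhdsGT ht.1] with h hh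
    rw [delayed_apply_of_mem u hx, indicator_of_mem (by constructor <;> linarith [hh.1, hh.2, ht.2])]
    have hne : h ≠ 0 := ne_of_gt hh.1
    simp only [Function.comp_apply, smul_eq_mul, ← sub_eq_add_neg]
    field_simp
    ring

/-- The difference quotients in time of `w` converge weakly to `wt`; this is the consequence needed
for the time derivative of `w`. -/
theorem InitialZero.integral_mul_nonneg {w wt f : ℝ × EuclideanSpace ℝ (Fin n) → ℝ}
    (hw : InitialZero T Ω w wt) (hΩ : IsSmoothBoundedDomain Ω) (hT : 0 < T)
    (hf : MemLp f 2 (volume.restrict (spaceTimeCyl T Ω)))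
    (hpos : ∀ h, 0 < h → 0 ≤ ∫ z in spaceTimeCyl T Ω, f z * (w z - delayed T Ω h w z)) :
    0 ≤ ∫ z in spaceTimeCyl T Ω, f z * wt z := by
  have hw' := hw
  obtain ⟨m1, m2, u, hu, h0, h1, h2⟩ := hw
  have mu := fun k => hΩ.memLp_of_continuous (T := T) (hu k).continuous
  have mdt := fun k => hΩ.memLp_of_continuous (T := T) (contDiff_timeDeriv (hu k)).continuous
  set F := ∫ z in spaceTimeCyl T Ω, f z ^ 2 with hF
  set e : ℕ → ℝ := fun k => ∫ z in spaceTimeCyl T Ω, (wt z - fderiv ℝ (u k) z (timeDir n)) ^ 2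
    with he
  -- the difference quotients of `w` are compared with those of a smooth approximation `u k`; the
  -- error is bounded uniformly in the step, so that the step can tend to zero for fixed `k`
  have hstep : ∀ l : ℝ, 0 < l → ∀ k, -(l * F + l⁻¹ * (2 * e k)) ≤
      2 * ∫ z in spaceTimeCyl T Ω, f z * fderiv ℝ (u k) z (timeDir n) := by
    intro l hl k
    have hlim := (hΩ.tendsto_setIntegral_mul_sub_delayed_div hf (hu k) (h0 k)).const_mul 2
    refine ge_of_tendsto hlim ?_
    filter_upwards [Ioo_mem_nhdsGT hT] with h hh
    have hb := (hw'.sub_contDiff hΩ (hu k) (h0 k)).setIntegral_sq_sub_delayed_le hΩ hh.1 hh.2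
    have md : MemLp (fun z => w z - u k z) 2 (volume.restrict (spaceTimeCyl T Ω)) :=
      m1.sub (mu k)
    have mD : MemLp (fun z => h⁻¹ * (w z - u k z - delayed T Ω h (fun z => w z - u k z) z)) 2
        (volume.restrict (spaceTimeCyl T Ω)) :=
      (md.sub (hΩ.memLp_delayed_restrict h md)).const_mul h⁻¹
    have hy := two_mul_integral_mul_le hf mD hl
    have hD : ∫ z in spaceTimeCyl T Ω,
        (h⁻¹ * (w z - u k z - delayed T Ω h (fun z => w z - u k z) z)) ^ 2 ≤ 2 * e k := by
      simp only [mul_pow]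
      rw [integral_const_mul]
      calc _ ≤ h⁻¹ ^ 2 * (2 * h ^ 2 * e k) := by gcongr
        _ = _ := by have := hh.1.ne'; field_simp
    have hl' : 0 < l⁻¹ := inv_pos.2 hl
    have hmul := mul_le_mul_of_nonneg_left hD hl'.le
    have hp := hpos h hh.1
    have iw : Integrable (fun z => f z * (w z - delayed T Ω h w z))
        (volume.restrict (spaceTimeCyl T Ω)) :=
      hf.integrable_fun_mul (m1.sub (hΩ.memLp_delayed_restrict h m1))
    have iD := hf.integrable_fun_mul mD
    have hsplit : ∫ z in spaceTimeCyl T Ω, f z * ((u k z - delayed T Ω h (u k) z) / h) =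
        h⁻¹ * (∫ z in spaceTimeCyl T Ω, f z * (w z - delayed T Ω h w z)) -
        ∫ z in spaceTimeCyl T Ω,
          f z * (h⁻¹ * (w z - u k z - delayed T Ω h (fun z => w z - u k z) z)) := by
      rw [← integral_const_mul, ← integral_sub (iw.const_mul _) iD]
      congr 1; ext z
      simp only [delayed_sub]
      ring
    rw [hsplit]
    have hp' : 0 ≤ h⁻¹ * ∫ z in spaceTimeCyl T Ω, f z * (w z - delayed T Ω h w z) :=
      mul_nonneg (inv_nonneg.2 hh.1.le) hp
    linarith
  -- then `k → ∞`, and `l → 0`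
  have tek : Tendsto e atTop (𝓝 0) := by
    have := tendsto_integral_sq_of_eLpNorm_tendsto (b := fun _ => (0 : ℝ))
      (μ := volume.restrict (spaceTimeCyl T Ω)) (fun k => (m2.sub (mdt k))) MemLp.zero' (by
        refine h2.congr fun k => ?_
        rw [← eLpNorm_neg]
        congr 1; ext z; simp)
    simpa using this
  have tf : Tendsto (fun k => ∫ z in spaceTimeCyl T Ω, f z * fderiv ℝ (u k) z (timeDir n)) atTop
      (𝓝 (∫ z in spaceTimeCyl T Ω, f z * wt z)) := by
    have := tendsto_integral_mul_of_eLpNorm_tendsto mdt m2 hf h2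
    simpa only [mul_comm] using this
  have hl : ∀ l : ℝ, 0 < l → -(l * F) ≤ 2 * ∫ z in spaceTimeCyl T Ω, f z * wt z := by
    intro l hl
    have t := ((tek.const_mul 2).const_mul l⁻¹).const_add (l * F) |>.neg
    simp only [mul_zero, add_zero] at t
    exact le_of_tendsto_of_tendsto' t (tf.const_mul 2) (hstep l hl)
  by_contra! hneg
  have hF0 : 0 ≤ F := integral_nonneg fun z => sq_nonneg _
  set I := ∫ z in spaceTimeCyl T Ω, f z * wt z
  have := hl (-I / (F + 1)) (by apply div_pos <;> linarith)
  have h3 : -I / (F + 1) * F ≤ -I := by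
    rw [div_mul_eq_mul_div, div_le_iff₀ (by linarith)]
    nlinarith
  linarith

theorem InitialZero.integral_weight_mul_nonneg {w wt : ℝ × EuclideanSpace ℝ (Fin n) → ℝ}
    (hw : InitialZero T Ω w wt) (hΩ : IsSmoothBoundedDomain Ω) (hT : 0 < T)
    {η : EuclideanSpace ℝ (Fin n) → ℝ} (hη : Continuous η) (hη0 : ∀ x ∈ Ω, 0 ≤ η x) :
    0 ≤ ∫ z in spaceTimeCyl T Ω, η z.2 * w z * wt z :=
  hw.integral_mul_nonneg hΩ hT (hΩ.memLp_continuous_mul (hη.comp continuous_snd) hw.1)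
    fun _ hh => hΩ.setIntegral_mul_sub_delayed_nonneg hw.1 hη hη0 hh.le

end TimeDerivative

/-! ### Symmetry of second derivatives and the gradient on the lateral boundary -/

section SecondDerivatives

variable {n : ℕ} {Ω : Set (EuclideanSpace ℝ (Fin n))} {T : ℝ}

theorem spaceDeriv_comm {p : ℝ × EuclideanSpace ℝ (Fin n) → ℝ} (hp : ContDiff ℝ ∞ p) (i j : Fin n) :
    spaceDeriv i (spaceDeriv j p) = spaceDeriv j (spaceDeriv i p) := by
  ext z
  have hd : Differentiable ℝ (fderiv ℝ p) :=
    (hp.fderiv_right (m := ∞) (by simp)).differentiable (by simp)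
  have key : ∀ e e' : ℝ × EuclideanSpace ℝ (Fin n),
      fderiv ℝ (fun z => fderiv ℝ p z e) z e' = fderiv ℝ (fderiv ℝ p) z e' e := by
    intro e e'
    rw [fderiv_clm_apply (hd z) (differentiableAt_const e)]
    simp
  have hs : IsSymmSndFDerivAt ℝ p z :=
    (show ContDiff ℝ 2 p from contDiff_infty.1 hp 2).contDiffAt.isSymmSndFDerivAt (by simp)
  change fderiv ℝ (fun z => fderiv ℝ p z (spaceDir j)) z (spaceDir i) =
    fderiv ℝ (fun z => fderiv ℝ p z (spaceDir i)) z (spaceDir j)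
  rw [key, key]
  exact hs _ _

/-- `w` is a real function on the cylinder that vanishes at `t = 0` and on the lateral boundary,
with time derivative `wt`, first and second order space derivatives `D i`, `W i j` in `L²`, where
`γ i` is the lateral trace of `D i`. -/
structure HasParabolicDerivs (T : ℝ) (Ω : Set (EuclideanSpace ℝ (Fin n)))
    (w wt : ℝ × EuclideanSpace ℝ (Fin n) → ℝ) (D : Fin n → ℝ × EuclideanSpace ℝ (Fin n) → ℝ)
    (W : Fin n → Fin n → ℝ × EuclideanSpace ℝ (Fin n) → ℝ)
    (γ : Fin n → ℝ × EuclideanSpace ℝ (Fin n) → ℝ) : Prop where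
  initial : InitialZero T Ω w wt
  lateral : ∀ i, StrongTrace T Ω i w (D i) fun _ => 0
  second : ∀ i j, StrongTrace T Ω j (D i) (W i j) (γ i)

variable {w wt : ℝ × EuclideanSpace ℝ (Fin n) → ℝ} {D : Fin n → ℝ × EuclideanSpace ℝ (Fin n) → ℝ}
  {W : Fin n → Fin n → ℝ × EuclideanSpace ℝ (Fin n) → ℝ}
  {γ : Fin n → ℝ × EuclideanSpace ℝ (Fin n) → ℝ}

theorem HasParabolicDerivs.contDiff_mul (h : HasParabolicDerivs T Ω w wt D W γ)
    (hΩ : IsSmoothBoundedDomain Ω) {a : ℝ × EuclideanSpace ℝ (Fin n) → ℝ} (ha : ContDiff ℝ ∞ a) :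
    HasParabolicDerivs T Ω (fun z => a z * w z)
      (fun z => a z * wt z + fderiv ℝ a z (timeDir n) * w z)
      (fun i z => a z * D i z + spaceDeriv i a z * w z)
      (fun i j z => a z * W i j z + spaceDeriv j a z * D i z +
        (spaceDeriv i a z * D j z + spaceDeriv j (spaceDeriv i a) z * w z))
      (fun i z => a z * γ i z) where
  initial := h.initial.contDiff_mul hΩ ha
  lateral i := by simpa using (h.lateral i).contDiff_mul hΩ ha
  second i j := by
    simpa using ((h.second i j).contDiff_mul hΩ ha).add
      ((h.lateral j).contDiff_mul hΩ (contDiff_spaceDeriv ha i)) hΩ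

/-- Two applications of Green's formula. The volume term is symmetric in `i` and `j`. -/
theorem HasParabolicDerivs.setIntegral_mul_second (h : HasParabolicDerivs T Ω w wt D W γ)
    (hΩ : IsSmoothBoundedDomain Ω) {p : ℝ × EuclideanSpace ℝ (Fin n) → ℝ} (hp : ContDiff ℝ ∞ p)
    (i j : Fin n) :
    ∫ z in spaceTimeCyl T Ω, p z * W i j z =
      (∫ z in spaceTimeCyl T Ω, spaceDeriv i (spaceDeriv j p) z * w z) +
        ∫ z, p z * (γ i z * normalComp Ω j z) ∂(lateralMeasure T Ω) := by
  obtain ⟨a1, a2, a3, a4⟩ := (h.second i j).weakTrace hΩ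
  obtain ⟨b1, b2, b3, b4⟩ := (h.lateral i).weakTrace hΩ
  have hpj := contDiff_spaceDeriv hp j
  have hpij := contDiff_spaceDeriv hpj i
  have e1 := a4 p hp (fun _ => 1) measurable_const ⟨1, by simp⟩
  have e2 := b4 _ hpj (fun _ => 1) measurable_const ⟨1, by simp⟩
  simp only [one_mul, zero_mul, mul_zero, integral_zero] at e1 e2
  rw [integral_add ((hΩ.memLp_of_continuous hp.continuous).integrable_fun_mul a2)
    ((hΩ.memLp_of_continuous hpj.continuous).integrable_fun_mul a1)] at e1
  rw [integral_add ((hΩ.memLp_of_continuous hpj.continuous).integrable_fun_mul b2)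
    ((hΩ.memLp_of_continuous hpij.continuous).integrable_fun_mul b1)] at e2
  linarith

theorem HasParabolicDerivs.setIntegral_mul_second_sub (h : HasParabolicDerivs T Ω w wt D W γ)
    (hΩ : IsSmoothBoundedDomain Ω) {p : ℝ × EuclideanSpace ℝ (Fin n) → ℝ} (hp : ContDiff ℝ ∞ p)
    (i j : Fin n) :
    ∫ z in spaceTimeCyl T Ω, p z * (W i j z - W j i z) =
      ∫ z, p z * (γ i z * normalComp Ω j z - γ j z * normalComp Ω i z) ∂(lateralMeasure T Ω) := by
  have e1 := h.setIntegral_mul_second hΩ hp i j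
  have e2 := h.setIntegral_mul_second hΩ hp j i
  rw [spaceDeriv_comm hp] at e2
  have m := hΩ.memLp_of_continuous (T := T) hp.continuous
  have m' := hΩ.memLp_lateral_of_continuous (T := T) hp.continuous
  have q1 := hΩ.memLp_mul_normalComp (i := j) (h.second i i).2.2.1
  have q2 := hΩ.memLp_mul_normalComp (i := i) (h.second j j).2.2.1
  simp only [mul_sub]
  rw [integral_sub (m.integrable_fun_mul (h.second i j).2.1)
    (m.integrable_fun_mul (h.second j i).2.1),
    integral_sub (m'.integrable_fun_mul q1) (m'.integrable_fun_mul q2)]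
  linarith

/-- Symmetry of the second order derivatives. -/
theorem HasParabolicDerivs.second_symm (h : HasParabolicDerivs T Ω w wt D W γ)
    (hΩ : IsSmoothBoundedDomain Ω) (i j : Fin n) :
    W i j =ᵐ[volume.restrict (spaceTimeCyl T Ω)] W j i := by
  have := hΩ.isFiniteMeasure_cylinder T
  have hint : Integrable (fun z => W i j z - W j i z) (volume.restrict (spaceTimeCyl T Ω)) :=
    ((h.second i j).2.1.sub (h.second j i).2.1).integrable one_le_two
  have key := (hΩ.isOpen_spaceTimeCyl T).ae_eq_zero_of_integral_contDiff_smul_eq_zero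
    (μ := volume.restrict (spaceTimeCyl T Ω)) (hint.locallyIntegrable.locallyIntegrableOn _) ?_
  · filter_upwards [key, ae_restrict_mem (hΩ.measurableSet_spaceTimeCyl T)] with z hz hzQ
    exact sub_eq_zero.1 (hz hzQ)
  · intro p hp _ hsupp
    simp only [smul_eq_mul]
    rw [h.setIntegral_mul_second_sub hΩ hp]
    refine integral_eq_zero_of_ae ?_
    filter_upwards [hΩ.ae_mem_lateral T] with z hz
    have hzQ : z ∉ spaceTimeCyl T Ω := fun hz' => by
      have h1 := hz.2
      rw [hΩ.isOpen.frontier_eq] at h1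
      exact h1.2 hz'.2
    rw [image_eq_zero_of_notMem_tsupport fun hz' => hzQ (hsupp hz')]
    simp

/-- The tangential derivatives of `w` vanish on the lateral boundary. -/
theorem HasParabolicDerivs.trace_comm (h : HasParabolicDerivs T Ω w wt D W γ)
    (hΩ : IsSmoothBoundedDomain Ω) (i j : Fin n) :
    ∀ᵐ z ∂(lateralMeasure T Ω), γ i z * normalComp Ω j z = γ j z * normalComp Ω i z := by
  have := hΩ.isFiniteMeasure_lateralMeasure T
  have hint : Integrable (fun z => γ i z * normalComp Ω j z - γ j z * normalComp Ω i z)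
      (lateralMeasure T Ω) :=
    ((hΩ.memLp_mul_normalComp (i := j) (h.second i i).2.2.1).sub
      (hΩ.memLp_mul_normalComp (i := i) (h.second j j).2.2.1)).integrable one_le_two
  have key := ae_eq_zero_of_integral_contDiff_smul_eq_zero hint.locallyIntegrable ?_
  · filter_upwards [key] with z hz
    exact sub_eq_zero.1 hz
  · intro p hp _
    simp only [smul_eq_mul]
    rw [← h.setIntegral_mul_second_sub hΩ hp]
    refine integral_eq_zero_of_ae ?_
    filter_upwards [h.second_symm hΩ i j] with z hz
    simp [hz]

theorem IsSmoothBoundedDomain.ae_sum_normalComp_sq (hΩ : IsSmoothBoundedDomain Ω) (T : ℝ) :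
    ∀ᵐ z ∂(lateralMeasure T Ω), ∑ i, normalComp Ω i z ^ 2 = 1 := by
  filter_upwards [hΩ.ae_mem_lateral T] with z hz
  have := EuclideanSpace.norm_sq_eq (outwardNormal Ω z.2)
  rw [hΩ.norm_outwardNormal hz.2] at this
  simpa [normalComp] using this.symm

/-- On the lateral boundary the gradient of `w` is normal. -/
theorem HasParabolicDerivs.trace_eq (h : HasParabolicDerivs T Ω w wt D W γ)
    (hΩ : IsSmoothBoundedDomain Ω) :
    ∀ᵐ z ∂(lateralMeasure T Ω), ∀ i,
      γ i z = normalComp Ω i z * ∑ j, normalComp Ω j z * γ j z := by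
  have hc : ∀ᵐ z ∂(lateralMeasure T Ω), ∀ i j,
      γ i z * normalComp Ω j z = γ j z * normalComp Ω i z := by
    rw [ae_all_iff]; intro i; rw [ae_all_iff]; exact h.trace_comm hΩ i
  filter_upwards [hc, hΩ.ae_sum_normalComp_sq T] with z hz hν i
  calc γ i z = γ i z * ∑ j, normalComp Ω j z ^ 2 := by rw [hν, mul_one]
    _ = _ := by
      rw [Finset.mul_sum, Finset.mul_sum]
      refine Finset.sum_congr rfl fun j _ => ?_
      rw [sq, ← mul_assoc, hz i j]
      ring

end SecondDerivatives

/-! ### Multiplier identities -/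

section Multipliers

variable {n : ℕ} {Ω : Set (EuclideanSpace ℝ (Fin n))} {T : ℝ} {i : Fin n}

theorem StrongTrace.pair {f F α g G β : ℝ × EuclideanSpace ℝ (Fin n) → ℝ}
    (hf : StrongTrace T Ω i f F α) (hg : WeakTrace T Ω i g G β) (hΩ : IsSmoothBoundedDomain Ω) :
    Integrable (fun z => f z * G z + F z * g z) (volume.restrict (spaceTimeCyl T Ω)) ∧
    Integrable (fun z => α z * (β z * normalComp Ω i z)) (lateralMeasure T Ω) ∧
    ∫ z in spaceTimeCyl T Ω, (f z * G z + F z * g z) =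
      ∫ z, α z * (β z * normalComp Ω i z) ∂(lateralMeasure T Ω) :=
  ⟨(hf.1.integrable_fun_mul hg.2.1).add (hf.2.1.integrable_fun_mul hg.1),
    hf.2.2.1.integrable_fun_mul (hΩ.memLp_mul_normalComp hg.2.2.1), hf.2.2.2 _ _ _ hg⟩

theorem StrongTrace.pair_zero {f F α g G : ℝ × EuclideanSpace ℝ (Fin n) → ℝ}
    (hf : StrongTrace T Ω i f F α) (hg : WeakTrace T Ω i g G fun _ => 0) :
    Integrable (fun z => f z * G z + F z * g z) (volume.restrict (spaceTimeCyl T Ω)) ∧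
    ∫ z in spaceTimeCyl T Ω, (f z * G z + F z * g z) = 0 :=
  ⟨(hf.1.integrable_fun_mul hg.2.1).add (hf.2.1.integrable_fun_mul hg.1), by
    simpa using hf.2.2.2 _ _ _ hg⟩

variable {w wt : ℝ × EuclideanSpace ℝ (Fin n) → ℝ} {D : Fin n → ℝ × EuclideanSpace ℝ (Fin n) → ℝ}
  {W : Fin n → Fin n → ℝ × EuclideanSpace ℝ (Fin n) → ℝ}
  {γ : Fin n → ℝ × EuclideanSpace ℝ (Fin n) → ℝ}

theorem HasParabolicDerivs.weakTrace_mul (h : HasParabolicDerivs T Ω w wt D W γ)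
    (hΩ : IsSmoothBoundedDomain Ω) {a : ℝ × EuclideanSpace ℝ (Fin n) → ℝ} (ha : ContDiff ℝ ∞ a)
    (i : Fin n) :
    WeakTrace T Ω i (fun z => a z * w z) (fun z => a z * D i z + spaceDeriv i a z * w z)
      fun _ => 0 := by
  simpa using ((h.lateral i).weakTrace hΩ).contDiff_mul hΩ ha

/-- Integration by parts of `∂ᵢ(a w²)`. -/
theorem HasParabolicDerivs.integral_transport (h : HasParabolicDerivs T Ω w wt D W γ)
    (hΩ : IsSmoothBoundedDomain Ω) {a : ℝ × EuclideanSpace ℝ (Fin n) → ℝ} (ha : ContDiff ℝ ∞ a)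
    (i : Fin n) :
    Integrable (fun z => 2 * (a z * D i z * w z) + spaceDeriv i a z * w z * w z)
      (volume.restrict (spaceTimeCyl T Ω)) ∧
    ∫ z in spaceTimeCyl T Ω, (2 * (a z * D i z * w z) + spaceDeriv i a z * w z * w z) = 0 := by
  have := (h.lateral i).pair_zero (h.weakTrace_mul hΩ ha i)
  have he : ∀ z, 2 * (a z * D i z * w z) + spaceDeriv i a z * w z * w z =
      w z * (a z * D i z + spaceDeriv i a z * w z) + D i z * (a z * w z) := fun z => by ring
  simpa only [he] using this

theorem integral_sum_eq_zero {μ : Measure (ℝ × EuclideanSpace ℝ (Fin n))}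
    {E : Fin n → ℝ × EuclideanSpace ℝ (Fin n) → ℝ}
    (h : ∀ i, Integrable (E i) μ ∧ ∫ z, E i z ∂μ = 0) : ∫ z, ∑ i, E i z ∂μ = 0 := by
  rw [integral_finsetSum _ fun i _ => (h i).1]
  exact Finset.sum_eq_zero fun i _ => (h i).2

/-- The Laplacian in space of a function on `ℝ × ℝⁿ`. -/
def spaceLaplacian (p : ℝ × EuclideanSpace ℝ (Fin n) → ℝ) (z : ℝ × EuclideanSpace ℝ (Fin n)) : ℝ :=
  ∑ i, spaceDeriv i (spaceDeriv i p) z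

theorem contDiff_spaceLaplacian {p : ℝ × EuclideanSpace ℝ (Fin n) → ℝ} (hp : ContDiff ℝ ∞ p) :
    ContDiff ℝ ∞ (spaceLaplacian p) := by
  unfold spaceLaplacian
  exact ContDiff.sum fun i _ => contDiff_spaceDeriv (contDiff_spaceDeriv hp i) i

/-- The first order part `2∇p·∇w + (Δp)w` of the commutator of the Laplacian with multiplication
by `p`. -/
def transportTerm (p w : ℝ × EuclideanSpace ℝ (Fin n) → ℝ)
    (D : Fin n → ℝ × EuclideanSpace ℝ (Fin n) → ℝ) (z : ℝ × EuclideanSpace ℝ (Fin n)) : ℝ :=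
  2 * ∑ i, spaceDeriv i p z * D i z + spaceLaplacian p z * w z

theorem HasParabolicDerivs.memLp_transportTerm (h : HasParabolicDerivs T Ω w wt D W γ)
    (hΩ : IsSmoothBoundedDomain Ω) {p : ℝ × EuclideanSpace ℝ (Fin n) → ℝ} (hp : ContDiff ℝ ∞ p) :
    MemLp (transportTerm p w D) 2 (volume.restrict (spaceTimeCyl T Ω)) := by
  have m1 : ∀ i, MemLp (fun z => spaceDeriv i p z * D i z) 2
      (volume.restrict (spaceTimeCyl T Ω)) := fun i =>
    hΩ.memLp_continuous_mul (contDiff_spaceDeriv hp i).continuous (h.lateral i).2.1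
  have m2 := hΩ.memLp_continuous_mul (contDiff_spaceLaplacian hp).continuous h.initial.1
  exact ((memLp_finsetSum _ fun i _ => m1 i).const_mul 2).add m2

theorem HasParabolicDerivs.memLp_laplacian (h : HasParabolicDerivs T Ω w wt D W γ) :
    MemLp (fun z => ∑ i, W i i z) 2 (volume.restrict (spaceTimeCyl T Ω)) :=
  memLp_finsetSum _ fun i _ => (h.second i i).2.1

theorem HasParabolicDerivs.integral_transportTerm_mul (h : HasParabolicDerivs T Ω w wt D W γ)
    (hΩ : IsSmoothBoundedDomain Ω) {p : ℝ × EuclideanSpace ℝ (Fin n) → ℝ} (hp : ContDiff ℝ ∞ p) :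
    ∫ z in spaceTimeCyl T Ω, transportTerm p w D z * w z = 0 := by
  rw [← integral_sum_eq_zero fun i => h.integral_transport hΩ (contDiff_spaceDeriv hp i) i]
  congr 1; ext z
  simp only [transportTerm, spaceLaplacian, Finset.sum_add_distrib, ← Finset.mul_sum,
    ← Finset.sum_mul]
  ring

theorem HasParabolicDerivs.integral_mul_transportTerm_mul (h : HasParabolicDerivs T Ω w wt D W γ)
    (hΩ : IsSmoothBoundedDomain Ω) {p : ℝ × EuclideanSpace ℝ (Fin n) → ℝ} (hp : ContDiff ℝ ∞ p)
    (hgrad : ∀ z ∈ spaceTimeCyl T Ω, ∑ i, spaceDeriv i p z ^ 2 = 1) :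
    ∫ z in spaceTimeCyl T Ω, p z * w z * transportTerm p w D z =
      -∫ z in spaceTimeCyl T Ω, w z ^ 2 := by
  have i1 : Integrable (fun z => p z * w z * transportTerm p w D z)
      (volume.restrict (spaceTimeCyl T Ω)) :=
    (hΩ.memLp_continuous_mul hp.continuous h.initial.1).integrable_fun_mul
      (h.memLp_transportTerm hΩ hp)
  have i2 := h.initial.1.integrable_sq
  have key := integral_sum_eq_zero fun i =>
    h.integral_transport hΩ (hp.mul (contDiff_spaceDeriv hp i)) i
  rw [eq_neg_iff_add_eq_zero, ← integral_add i1 i2, ← key]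
  refine setIntegral_congr_fun (hΩ.measurableSet_spaceTimeCyl T) fun z hz => ?_
  have e : ∀ i, 2 * (p z * spaceDeriv i p z * D i z * w z) +
      spaceDeriv i (fun z => p z * spaceDeriv i p z) z * w z * w z =
      (2 * (p z * w z)) * (spaceDeriv i p z * D i z) +
        (spaceDeriv i (spaceDeriv i p) z * (p z * w z * w z) +
        spaceDeriv i p z ^ 2 * (w z * w z)) := by
    intro i
    rw [spaceDeriv_mul hp (contDiff_spaceDeriv hp i)]
    ring
  simp only [e, Finset.sum_add_distrib, ← Finset.mul_sum, ← Finset.sum_mul, hgrad z hz]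
  simp only [transportTerm, spaceLaplacian]
  ring

theorem HasParabolicDerivs.integral_laplacian_mul (h : HasParabolicDerivs T Ω w wt D W γ)
    (hΩ : IsSmoothBoundedDomain Ω) :
    ∫ z in spaceTimeCyl T Ω, (∑ i, W i i z) * w z =
      -∫ z in spaceTimeCyl T Ω, ∑ i, D i z ^ 2 := by
  have i1 : Integrable (fun z => (∑ i, W i i z) * w z) (volume.restrict (spaceTimeCyl T Ω)) :=
    h.memLp_laplacian.integrable_fun_mul h.initial.1
  have i2 : Integrable (fun z => ∑ i, D i z ^ 2) (volume.restrict (spaceTimeCyl T Ω)) :=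
    integrable_finsetSum _ fun i _ => (h.lateral i).2.1.integrable_sq
  have key := integral_sum_eq_zero fun i => (h.second i i).pair_zero ((h.lateral i).weakTrace hΩ)
  rw [eq_neg_iff_add_eq_zero, ← integral_add i1 i2, ← key]
  congr 1; ext z
  simp only [Finset.sum_add_distrib, Finset.sum_mul, sq]
  ring

/-- Formally, `-∫ Δw ∂ₜw` is half the Dirichlet energy of `w` at the final time. That energy need not
be defined here; difference quotients in time replace the time derivative. -/
theorem HasParabolicDerivs.integral_laplacian_mul_timeDeriv_nonpos
    (h : HasParabolicDerivs T Ω w wt D W γ) (hΩ : IsSmoothBoundedDomain Ω) (hT : 0 < T) :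
    ∫ z in spaceTimeCyl T Ω, (∑ i, W i i z) * wt z ≤ 0 := by
  have hnn := h.initial.integral_mul_nonneg hΩ hT (f := fun z => -∑ i, W i i z)
    h.memLp_laplacian.neg ?_
  · simpa [integral_neg] using hnn
  intro s hs
  have hterm : ∀ i, Integrable (fun z => D i z * (D i z - delayed T Ω s (D i) z) +
      W i i z * (w z - delayed T Ω s w z)) (volume.restrict (spaceTimeCyl T Ω)) ∧
      ∫ z in spaceTimeCyl T Ω, (D i z * (D i z - delayed T Ω s (D i) z) +
      W i i z * (w z - delayed T Ω s w z)) = 0 := by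
    intro i
    have hw := (h.lateral i).weakTrace hΩ
    obtain ⟨i1, e1⟩ := (h.second i i).pair_zero hw
    obtain ⟨i2, e2⟩ := (h.second i i).pair_zero (hw.delayed hΩ hs.le)
    have he : ∀ z, D i z * (D i z - delayed T Ω s (D i) z) +
      W i i z * (w z - delayed T Ω s w z) = (D i z * D i z + W i i z * w z) -
        (D i z * delayed T Ω s (D i) z + W i i z * delayed T Ω s w z) := fun z => by ring
    simp only [he]
    exact ⟨i1.sub i2, by rw [integral_sub i1 i2, e1, e2, sub_zero]⟩
  have hD : ∀ i, Integrable (fun z => D i z * (D i z - delayed T Ω s (D i) z))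
      (volume.restrict (spaceTimeCyl T Ω)) := fun i =>
    (h.lateral i).2.1.integrable_fun_mul
      ((h.lateral i).2.1.sub (hΩ.memLp_delayed_restrict s (h.lateral i).2.1))
  have h1 : ∫ z in spaceTimeCyl T Ω, (-∑ i, W i i z) * (w z - delayed T Ω s w z) =
      ∑ i, ∫ z in spaceTimeCyl T Ω, D i z * (D i z - delayed T Ω s (D i) z) := by
    have key := integral_sum_eq_zero hterm
    have i1 : Integrable (fun z => (-∑ i, W i i z) * (w z - delayed T Ω s w z))
        (volume.restrict (spaceTimeCyl T Ω)) :=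
      h.memLp_laplacian.neg.integrable_fun_mul
        (h.initial.1.sub (hΩ.memLp_delayed_restrict s h.initial.1))
    have i2 : Integrable (fun z => ∑ i, (D i z * (D i z - delayed T Ω s (D i) z) +
      W i i z * (w z - delayed T Ω s w z))) (volume.restrict (spaceTimeCyl T Ω)) :=
      integrable_finsetSum _ fun i _ => (hterm i).1
    rw [← integral_finsetSum _ fun i _ => hD i, ← add_zero (∫ z in spaceTimeCyl T Ω, _), ← key,
      ← integral_add i1 i2]
    congr 1; ext z
    simp only [Finset.sum_add_distrib, ← Finset.sum_mul]
    ring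
  rw [h1]
  refine Finset.sum_nonneg fun i _ => ?_
  have := hΩ.setIntegral_mul_sub_delayed_nonneg (T := T) (h.lateral i).2.1
    (η := fun _ => 1) continuous_const (by simp) hs.le
  simpa using this

/-- The Rellich–Pohozaev identity for the multiplier `2∇p·∇w + (Δp)w`. -/
theorem HasParabolicDerivs.integral_laplacian_mul_transportTerm
    (h : HasParabolicDerivs T Ω w wt D W γ) (hΩ : IsSmoothBoundedDomain Ω)
    {p : ℝ × EuclideanSpace ℝ (Fin n) → ℝ} (hp : ContDiff ℝ ∞ p) :
    ∫ z in spaceTimeCyl T Ω, (∑ i, W i i z) * transportTerm p w D z =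
      (∫ z, (∑ i, normalComp Ω i z * γ i z) ^ 2 * ∑ j, spaceDeriv j p z * normalComp Ω j z
          ∂(lateralMeasure T Ω)) -
        2 * (∫ z in spaceTimeCyl T Ω,
          ∑ i, ∑ j, spaceDeriv i (spaceDeriv j p) z * D i z * D j z) +
        1 / 2 * ∫ z in spaceTimeCyl T Ω, spaceLaplacian (spaceLaplacian p) z * w z * w z := by
  have hpj := fun j => contDiff_spaceDeriv hp j
  have hd := contDiff_spaceLaplacian hp
  have hdi := fun i => contDiff_spaceDeriv hd i
  -- With `pⱼ = ∂ⱼp`: Green's formula for `∂ᵢ` and the pair `∂ᵢw`, `pⱼ ∂ⱼw`, for `∂ⱼ` and the pair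
  -- `∂ᵢw`, `pⱼ ∂ᵢw`, for `∂ᵢ` and the pair `∂ᵢw`, `(Δp)w`, and for `∂ᵢ` and the pair `w`, `(∂ᵢΔp)w`.
  -- The identity is their sum with the coefficients `2`, `-1`, `1`, `-1/2`.
  have c1 := fun i j => (h.second i i).pair
    (((h.second j i).weakTrace hΩ).contDiff_mul hΩ (hpj j)) hΩ
  have c2 := fun i j => (h.second i j).pair
    (((h.second i j).weakTrace hΩ).contDiff_mul hΩ (hpj j)) hΩ
  have c3 := fun i => (h.second i i).pair_zero (h.weakTrace_mul hΩ hd i)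
  have c4 := fun i => (h.lateral i).pair_zero (h.weakTrace_mul hΩ (hdi i) i)
  set Q := volume.restrict (spaceTimeCyl T Ω) with hQ
  set S := lateralMeasure T Ω with hS
  have hE : ∀ i j, Integrable (fun z =>
      2 * (D i z * (spaceDeriv j p z * W j i z + spaceDeriv i (spaceDeriv j p) z * D j z) +
        W i i z * (spaceDeriv j p z * D j z)) -
      (D i z * (spaceDeriv j p z * W i j z + spaceDeriv j (spaceDeriv j p) z * D i z) +
        W i j z * (spaceDeriv j p z * D i z))) Q := fun i j =>
    ((c1 i j).1.const_mul 2).sub (c2 i j).1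
  have hB : ∀ i j, Integrable (fun z =>
      2 * (γ i z * (spaceDeriv j p z * γ j z * normalComp Ω i z)) -
        γ i z * (spaceDeriv j p z * γ i z * normalComp Ω j z)) S := fun i j =>
    ((c1 i j).2.1.const_mul 2).sub (c2 i j).2.1
  have hEB : ∀ i j, ∫ z,
      (2 * (D i z * (spaceDeriv j p z * W j i z + spaceDeriv i (spaceDeriv j p) z * D j z) +
        W i i z * (spaceDeriv j p z * D j z)) -
      (D i z * (spaceDeriv j p z * W i j z + spaceDeriv j (spaceDeriv j p) z * D i z) +
        W i j z * (spaceDeriv j p z * D i z))) ∂Q = ∫ z,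
      (2 * (γ i z * (spaceDeriv j p z * γ j z * normalComp Ω i z)) -
        γ i z * (spaceDeriv j p z * γ i z * normalComp Ω j z)) ∂S := by
    intro i j
    rw [integral_sub ((c1 i j).1.const_mul 2) (c2 i j).1,
      integral_sub ((c1 i j).2.1.const_mul 2) (c2 i j).2.1, integral_const_mul, integral_const_mul,
      (c1 i j).2.2, (c2 i j).2.2]
  have hF : ∀ i, Integrable (fun z =>
      D i z * (spaceLaplacian p z * D i z + spaceDeriv i (spaceLaplacian p) z * w z) +
        W i i z * (spaceLaplacian p z * w z) -
      1 / 2 * (w z * (spaceDeriv i (spaceLaplacian p) z * D i z +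
        spaceDeriv i (spaceDeriv i (spaceLaplacian p)) z * w z) +
        D i z * (spaceDeriv i (spaceLaplacian p) z * w z))) Q ∧ ∫ z,
      (D i z * (spaceLaplacian p z * D i z + spaceDeriv i (spaceLaplacian p) z * w z) +
        W i i z * (spaceLaplacian p z * w z) -
      1 / 2 * (w z * (spaceDeriv i (spaceLaplacian p) z * D i z +
        spaceDeriv i (spaceDeriv i (spaceLaplacian p)) z * w z) +
        D i z * (spaceDeriv i (spaceLaplacian p) z * w z))) ∂Q = 0 := by
    intro i
    refine ⟨(c3 i).1.sub ((c4 i).1.const_mul _), ?_⟩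
    rw [integral_sub (c3 i).1 ((c4 i).1.const_mul _), integral_const_mul, (c3 i).2, (c4 i).2]
    ring
  have iH : Integrable (fun z => ∑ i, ∑ j, spaceDeriv i (spaceDeriv j p) z * D i z * D j z) Q :=
    integrable_finsetSum _ fun i _ => integrable_finsetSum _ fun j _ =>
      (hΩ.memLp_continuous_mul (contDiff_spaceDeriv (hpj j) i).continuous
        (h.lateral i).2.1).integrable_fun_mul (h.lateral j).2.1
  have iK : Integrable (fun z => spaceLaplacian (spaceLaplacian p) z * w z * w z) Q :=
    (hΩ.memLp_continuous_mul (contDiff_spaceLaplacian hd).continuous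
      h.initial.1).integrable_fun_mul h.initial.1
  have iL : Integrable (fun z => (∑ i, W i i z) * transportTerm p w D z) Q :=
    h.memLp_laplacian.integrable_fun_mul (h.memLp_transportTerm hΩ hp)
  have iEE := integrable_finsetSum Finset.univ fun i _ =>
    integrable_finsetSum Finset.univ fun j _ => hE i j
  have eEE := calc
    _ = _ := integral_finsetSum Finset.univ fun i _ =>
      integrable_finsetSum Finset.univ fun j _ => hE i j
    _ = _ := Finset.sum_congr rfl fun i _ => integral_finsetSum Finset.univ fun j _ => hE i j
    _ = _ := Finset.sum_congr rfl fun i _ => Finset.sum_congr rfl fun j _ => hEB i j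
    _ = _ := Finset.sum_congr rfl fun i _ =>
      (integral_finsetSum Finset.univ fun j _ => hB i j).symm
    _ = _ := (integral_finsetSum Finset.univ fun i _ =>
      integrable_finsetSum Finset.univ fun j _ => hB i j).symm
  have iF := integrable_finsetSum Finset.univ fun i _ => (hF i).1
  have eF := integral_sum_eq_zero hF
  have hsym : ∀ᵐ z ∂Q, ∀ i j, W i j z = W j i z := by
    rw [ae_all_iff]; intro i; rw [ae_all_iff]; exact fun j => h.second_symm hΩ i j
  have hbd : ∫ z, ∑ i, ∑ j, (2 * (γ i z * (spaceDeriv j p z * γ j z * normalComp Ω i z)) -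
        γ i z * (spaceDeriv j p z * γ i z * normalComp Ω j z)) ∂S =
      ∫ z, (∑ i, normalComp Ω i z * γ i z) ^ 2 * ∑ j, spaceDeriv j p z * normalComp Ω j z ∂S := by
    refine integral_congr_ae ?_
    filter_upwards [h.trace_eq hΩ, hΩ.ae_sum_normalComp_sq T] with z hz hν
    set g := ∑ i, normalComp Ω i z * γ i z
    have e : ∀ i j, 2 * (γ i z * (spaceDeriv j p z * γ j z * normalComp Ω i z)) -
        γ i z * (spaceDeriv j p z * γ i z * normalComp Ω j z) =
        normalComp Ω i z ^ 2 * (g ^ 2 * (spaceDeriv j p z * normalComp Ω j z)) := by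
      intro i j
      rw [hz i, hz j]
      ring
    simp only [e, ← Finset.mul_sum, ← Finset.sum_mul, hν, one_mul]
  have hQint : ∫ z, (∑ i, W i i z) * transportTerm p w D z ∂Q +
      2 * ∫ z, ∑ i, ∑ j, spaceDeriv i (spaceDeriv j p) z * D i z * D j z ∂Q -
      1 / 2 * ∫ z, spaceLaplacian (spaceLaplacian p) z * w z * w z ∂Q =
      ∫ z, ∑ i, ∑ j,
        (2 * (D i z * (spaceDeriv j p z * W j i z + spaceDeriv i (spaceDeriv j p) z * D j z) +
        W i i z * (spaceDeriv j p z * D j z)) -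
      (D i z * (spaceDeriv j p z * W i j z + spaceDeriv j (spaceDeriv j p) z * D i z) +
        W i j z * (spaceDeriv j p z * D i z))) ∂Q := by
    refine Eq.trans ?_ (add_zero _)
    rw [← eF, ← integral_add iEE iF, ← integral_const_mul,
      ← integral_const_mul, ← integral_add iL (iH.const_mul 2)]
    have iLH : Integrable (fun z => (∑ i, W i i z) * transportTerm p w D z +
      2 * ∑ i, ∑ j, spaceDeriv i (spaceDeriv j p) z * D i z * D j z) Q := iL.add (iH.const_mul 2)
    rw [← integral_sub iLH (iK.const_mul _)]
    refine integral_congr_ae ?_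
    filter_upwards [hsym] with z hz
    have e : ∀ i j,
        2 * (D i z * (spaceDeriv j p z * W j i z + spaceDeriv i (spaceDeriv j p) z * D j z) +
        W i i z * (spaceDeriv j p z * D j z)) -
      (D i z * (spaceDeriv j p z * W i j z + spaceDeriv j (spaceDeriv j p) z * D i z) +
        W i j z * (spaceDeriv j p z * D i z)) =
      2 * (spaceDeriv i (spaceDeriv j p) z * D i z * D j z) +
        2 * W i i z * (spaceDeriv j p z * D j z) - D i z ^ 2 * spaceDeriv j (spaceDeriv j p) z := by
      intro i j
      rw [hz j i]
      ring
    have e' : ∀ i, D i z * (spaceLaplacian p z * D i z + spaceDeriv i (spaceLaplacian p) z * w z) +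
        W i i z * (spaceLaplacian p z * w z) -
      1 / 2 * (w z * (spaceDeriv i (spaceLaplacian p) z * D i z +
        spaceDeriv i (spaceDeriv i (spaceLaplacian p)) z * w z) +
        D i z * (spaceDeriv i (spaceLaplacian p) z * w z)) =
      D i z ^ 2 * spaceLaplacian p z + W i i z * (spaceLaplacian p z * w z) -
        1 / 2 * w z ^ 2 * spaceDeriv i (spaceDeriv i (spaceLaplacian p)) z := fun i => by ring
    have hl : ∀ q : ℝ × EuclideanSpace ℝ (Fin n) → ℝ,
      ∑ j, spaceDeriv j (spaceDeriv j q) z = spaceLaplacian q z := fun q => rfl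
    simp only [e, e', Finset.sum_add_distrib, Finset.sum_sub_distrib, ← Finset.mul_sum,
      ← Finset.sum_mul, hl, transportTerm]
    ring
  rw [eEE, hbd] at hQint
  linarith

end Multipliers

/-! ### The Carleman estimate for the conjugated operator -/

section RealEstimate

variable {n : ℕ} {Ω : Set (EuclideanSpace ℝ (Fin n))} {T : ℝ}
  {w wt : ℝ × EuclideanSpace ℝ (Fin n) → ℝ} {D : Fin n → ℝ × EuclideanSpace ℝ (Fin n) → ℝ}
  {W : Fin n → Fin n → ℝ × EuclideanSpace ℝ (Fin n) → ℝ}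
  {γ : Fin n → ℝ × EuclideanSpace ℝ (Fin n) → ℝ}

/-- The first order part `∂ₜw - τ(2∇p·∇w + (Δp)w)` of the heat operator conjugated with
`exp(τ²t + τp)`, where `|∇p| = 1`. -/
def conjugatedFirstOrder (τ : ℝ) (p w wt : ℝ × EuclideanSpace ℝ (Fin n) → ℝ)
    (D : Fin n → ℝ × EuclideanSpace ℝ (Fin n) → ℝ) (z : ℝ × EuclideanSpace ℝ (Fin n)) : ℝ :=
  wt z - τ * transportTerm p w D z

/-- Algebraic absorption in the Carleman estimate. In the application `A = ‖w‖²`, `G = ‖∇w‖²`, `N`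
and `P` are the squared norms of the first order part and of the whole conjugated operator, `X` is
the pairing of the latter with `w`, `B` the boundary term, `H` the Hessian term and `K` the
bilaplacian term. -/
theorem carleman_absorption {A G N P X B H K R κ₁ κ₂ τ : ℝ} (hτ : 0 < τ) (hR : 0 < R)
    (hκ₁ : 0 < κ₁) (hA : 0 ≤ A) (hτκ : 4 * κ₂ * R ^ 2 ≤ τ)
    (hX : ∀ l, 0 < l → 2 * X ≤ l * P + l⁻¹ * A) (hG : G ≤ X)
    (hN : τ ^ 2 * A ≤ R ^ 2 * N) (hH : H ≤ κ₁ * G) (hK : -(κ₂ * A) ≤ K)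
    (hP : N + 2 * τ * B - 4 * τ * H + τ * K ≤ P) :
    τ ^ 2 * A / (2 * R ^ 2) + 2 * τ * B ≤ (1 + 16 * κ₁ ^ 2 * R ^ 2) * P := by
  have hR2 : 0 < R ^ 2 := by positivity
  -- this parameter makes the contribution of `A` a quarter of what `N` controls
  have h1 := hX (8 * κ₁ * R ^ 2 / τ) (by positivity)
  have h2 : 4 * τ * H ≤ 16 * κ₁ ^ 2 * R ^ 2 * P + τ ^ 2 * A / (4 * R ^ 2) := by
    calc 4 * τ * H ≤ 4 * τ * (κ₁ * X) := by
          have := hH.trans (mul_le_mul_of_nonneg_left hG hκ₁.le)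
          gcongr
      _ = 2 * τ * κ₁ * (2 * X) := by ring
      _ ≤ 2 * τ * κ₁ * (8 * κ₁ * R ^ 2 / τ * P + (8 * κ₁ * R ^ 2 / τ)⁻¹ * A) := by gcongr
      _ = _ := by field_simp; ring
  have h3 : τ ^ 2 * A / R ^ 2 ≤ N := by
    rw [div_le_iff₀ hR2]; linarith
  have h4 : τ * (κ₂ * A) ≤ τ ^ 2 * A / (4 * R ^ 2) := by
    rw [le_div_iff₀ (by positivity)]
    have := mul_le_mul_of_nonneg_right hτκ (mul_nonneg hτ.le hA)
    nlinarith
  have h5 : τ * -(κ₂ * A) ≤ τ * K := mul_le_mul_of_nonneg_left hK hτ.le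
  have h6 : τ ^ 2 * A / (2 * R ^ 2) = τ ^ 2 * A / R ^ 2 - 2 * (τ ^ 2 * A / (4 * R ^ 2)) := by
    field_simp; ring
  linarith

/-- The Carleman estimate for the conjugated heat operator. -/
theorem HasParabolicDerivs.carleman (h : HasParabolicDerivs T Ω w wt D W γ)
    (hΩ : IsSmoothBoundedDomain Ω) (hT : 0 < T) {η : EuclideanSpace ℝ (Fin n) → ℝ}
    (hη : ContDiff ℝ ∞ η) {p : ℝ × EuclideanSpace ℝ (Fin n) → ℝ} (hpη : ∀ z, p z = η z.2)
    (hgrad : ∀ z ∈ spaceTimeCyl T Ω, ∑ i, spaceDeriv i p z ^ 2 = 1) {R : ℝ} (hR : 0 < R)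
    (hη0 : ∀ x ∈ Ω, 0 ≤ η x) (hηR : ∀ x ∈ Ω, η x ≤ R) {κ₁ κ₂ : ℝ} (hκ₁ : 0 < κ₁)
    (hhess : ∀ z ∈ spaceTimeCyl T Ω, ∀ ξ : Fin n → ℝ,
      ∑ i, ∑ j, spaceDeriv i (spaceDeriv j p) z * ξ i * ξ j ≤ κ₁ * ∑ i, ξ i ^ 2)
    (hbilap : ∀ z ∈ spaceTimeCyl T Ω, -κ₂ ≤ spaceLaplacian (spaceLaplacian p) z) {τ : ℝ}
    (hτ : 0 < τ) (hτκ : 4 * κ₂ * R ^ 2 ≤ τ) :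
    τ ^ 2 * (∫ z in spaceTimeCyl T Ω, w z ^ 2) / (2 * R ^ 2) +
        2 * τ * (∫ z, (∑ i, normalComp Ω i z * γ i z) ^ 2 *
          ∑ j, spaceDeriv j p z * normalComp Ω j z ∂(lateralMeasure T Ω)) ≤
      (1 + 16 * κ₁ ^ 2 * R ^ 2) *
        ∫ z in spaceTimeCyl T Ω, (conjugatedFirstOrder τ p w wt D z - ∑ i, W i i z) ^ 2 := by
  have hQ := hΩ.measurableSet_spaceTimeCyl T
  have hp : ContDiff ℝ ∞ p := by
    have : p = fun z => η z.2 := funext hpη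
    rw [this]; exact hη.comp contDiff_snd
  have mw := h.initial.1
  have mwt := h.initial.2.1
  have mL := h.memLp_transportTerm hΩ hp
  have mW := h.memLp_laplacian
  have mN : MemLp (conjugatedFirstOrder τ p w wt D) 2 (volume.restrict (spaceTimeCyl T Ω)) :=
    mwt.sub (mL.const_mul τ)
  have mP : MemLp (fun z => conjugatedFirstOrder τ p w wt D z - ∑ i, W i i z) 2
      (volume.restrict (spaceTimeCyl T Ω)) := mN.sub mW
  have mpw := hΩ.memLp_continuous_mul hp.continuous mw
  have hww : 0 ≤ ∫ z in spaceTimeCyl T Ω, w z * wt z := by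
    have := h.initial.integral_weight_mul_nonneg hΩ hT (η := fun _ => 1) continuous_const (by simp)
    simpa using this
  have hpww : 0 ≤ ∫ z in spaceTimeCyl T Ω, p z * w z * wt z := by
    have := h.initial.integral_weight_mul_nonneg hΩ hT hη.continuous hη0
    simpa only [← hpη] using this
  have iD : Integrable (fun z => ∑ i, D i z ^ 2) (volume.restrict (spaceTimeCyl T Ω)) :=
    integrable_finsetSum _ fun i _ => (h.lateral i).2.1.integrable_sq
  have iH : Integrable (fun z => ∑ i, ∑ j, spaceDeriv i (spaceDeriv j p) z * D i z * D j z)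
      (volume.restrict (spaceTimeCyl T Ω)) :=
    integrable_finsetSum _ fun i _ => integrable_finsetSum _ fun j _ =>
      (hΩ.memLp_continuous_mul (contDiff_spaceDeriv (contDiff_spaceDeriv hp j) i).continuous
        (h.lateral i).2.1).integrable_fun_mul (h.lateral j).2.1
  have iK : Integrable (fun z => spaceLaplacian (spaceLaplacian p) z * w z * w z)
      (volume.restrict (spaceTimeCyl T Ω)) :=
    (hΩ.memLp_continuous_mul (contDiff_spaceLaplacian (contDiff_spaceLaplacian hp)).continuous
      mw).integrable_fun_mul mw
  have hLw := h.integral_transportTerm_mul hΩ hp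
  have hpLw := h.integral_mul_transportTerm_mul hΩ hp hgrad
  refine carleman_absorption (X := ∫ z in spaceTimeCyl T Ω,
      (conjugatedFirstOrder τ p w wt D z - ∑ i, W i i z) * w z)
    (G := ∫ z in spaceTimeCyl T Ω, ∑ i, D i z ^ 2)
    (N := ∫ z in spaceTimeCyl T Ω, conjugatedFirstOrder τ p w wt D z ^ 2)
    (H := ∫ z in spaceTimeCyl T Ω, ∑ i, ∑ j, spaceDeriv i (spaceDeriv j p) z * D i z * D j z)
    (K := ∫ z in spaceTimeCyl T Ω, spaceLaplacian (spaceLaplacian p) z * w z * w z)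
    hτ hR hκ₁ (integral_nonneg fun z => sq_nonneg _) hτκ
    (fun l hl => two_mul_integral_mul_le mP mw hl) ?_ ?_ ?_ ?_ ?_
  · have e : ∫ z in spaceTimeCyl T Ω, (conjugatedFirstOrder τ p w wt D z - ∑ i, W i i z) * w z =
        (∫ z in spaceTimeCyl T Ω, w z * wt z) -
          τ * (∫ z in spaceTimeCyl T Ω, transportTerm p w D z * w z) -
          ∫ z in spaceTimeCyl T Ω, (∑ i, W i i z) * w z := by
      rw [← integral_const_mul, ← integral_sub (mw.integrable_fun_mul mwt)
        ((mL.integrable_fun_mul mw).const_mul τ)]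
      have i1 : Integrable (fun z => w z * wt z - τ * (transportTerm p w D z * w z))
        (volume.restrict (spaceTimeCyl T Ω)) :=
        (mw.integrable_fun_mul mwt).sub ((mL.integrable_fun_mul mw).const_mul τ)
      rw [← integral_sub i1 (mW.integrable_fun_mul mw)]
      congr 1; ext z; rw [conjugatedFirstOrder]; ring
    rw [e, hLw, h.integral_laplacian_mul hΩ]
    linarith
  · have e : ∫ z in spaceTimeCyl T Ω, p z * w z * conjugatedFirstOrder τ p w wt D z =
        (∫ z in spaceTimeCyl T Ω, p z * w z * wt z) +
          τ * ∫ z in spaceTimeCyl T Ω, w z ^ 2 := by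
      rw [← neg_neg (∫ z in spaceTimeCyl T Ω, w z ^ 2), ← hpLw, mul_neg, ← sub_eq_add_neg,
        ← integral_const_mul, ← integral_sub (mpw.integrable_fun_mul mwt)
        ((mpw.integrable_fun_mul mL).const_mul τ)]
      congr 1; ext z; rw [conjugatedFirstOrder]; ring
    have hy := two_mul_integral_mul_le mpw mN (l := τ / R ^ 2) (by positivity)
    rw [e] at hy
    have hpw : ∫ z in spaceTimeCyl T Ω, (p z * w z) ^ 2 ≤
        R ^ 2 * ∫ z in spaceTimeCyl T Ω, w z ^ 2 := by
      rw [← integral_const_mul]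
      refine setIntegral_mono_on mpw.integrable_sq (mw.integrable_sq.const_mul _) hQ fun z hz => ?_
      rw [mul_pow, hpη]
      have h1 := hη0 _ hz.2
      have h2 := hηR _ hz.2
      gcongr
    have h3 : τ / R ^ 2 * ∫ z in spaceTimeCyl T Ω, (p z * w z) ^ 2 ≤
        τ * ∫ z in spaceTimeCyl T Ω, w z ^ 2 := by
      calc _ ≤ τ / R ^ 2 * (R ^ 2 * ∫ z in spaceTimeCyl T Ω, w z ^ 2) := by gcongr
        _ = _ := by field_simp
    have h4 : τ * (∫ z in spaceTimeCyl T Ω, w z ^ 2) ≤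
        (τ / R ^ 2)⁻¹ * ∫ z in spaceTimeCyl T Ω, conjugatedFirstOrder τ p w wt D z ^ 2 := by
      linarith
    calc _ = τ * (τ * ∫ z in spaceTimeCyl T Ω, w z ^ 2) := by ring
      _ ≤ τ * ((τ / R ^ 2)⁻¹ *
          ∫ z in spaceTimeCyl T Ω, conjugatedFirstOrder τ p w wt D z ^ 2) := by gcongr
      _ = _ := by field_simp
  · rw [← integral_const_mul]
    exact setIntegral_mono_on iH (iD.const_mul _) hQ fun z hz => hhess z hz fun i => D i z
  · rw [← integral_const_mul, ← integral_neg]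
    refine setIntegral_mono_on (mw.integrable_sq.const_mul _).neg iK hQ fun z hz => ?_
    have := mul_le_mul_of_nonneg_right (hbilap z hz) (sq_nonneg (w z))
    simp only [sq] at this ⊢
    linarith
  · have hWwt := h.integral_laplacian_mul_timeDeriv_nonpos hΩ hT
    have e1 : ∫ z in spaceTimeCyl T Ω, (conjugatedFirstOrder τ p w wt D z - ∑ i, W i i z) ^ 2 =
        (∫ z in spaceTimeCyl T Ω, conjugatedFirstOrder τ p w wt D z ^ 2) +
        (∫ z in spaceTimeCyl T Ω, (∑ i, W i i z) ^ 2) -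
        2 * ((∫ z in spaceTimeCyl T Ω, (∑ i, W i i z) * wt z) -
          τ * ∫ z in spaceTimeCyl T Ω, (∑ i, W i i z) * transportTerm p w D z) := by
      rw [← integral_const_mul, ← integral_sub (mW.integrable_fun_mul mwt)
        ((mW.integrable_fun_mul mL).const_mul τ),
        ← integral_add mN.integrable_sq mW.integrable_sq, ← integral_const_mul]
      have i1 : Integrable (fun z => conjugatedFirstOrder τ p w wt D z ^ 2 + (∑ i, W i i z) ^ 2)
        (volume.restrict (spaceTimeCyl T Ω)) := mN.integrable_sq.add mW.integrable_sq
      have i2 : Integrable (fun z => 2 * ((∑ i, W i i z) * wt z -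
        τ * ((∑ i, W i i z) * transportTerm p w D z))) (volume.restrict (spaceTimeCyl T Ω)) :=
        ((mW.integrable_fun_mul mwt).sub ((mW.integrable_fun_mul mL).const_mul τ)).const_mul 2
      rw [← integral_sub i1 i2]
      congr 1; ext z; rw [conjugatedFirstOrder]; ring
    have hsq : 0 ≤ ∫ z in spaceTimeCyl T Ω, (∑ i, W i i z) ^ 2 :=
      integral_nonneg fun z => sq_nonneg _
    rw [e1, h.integral_laplacian_mul_transportTerm hΩ hp]
    linarith

end RealEstimate

/-! ### The weight -/

section Weight

variable {n : ℕ} {Ω : Set (EuclideanSpace ℝ (Fin n))} {T : ℝ}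

theorem spaceDeriv_comp_snd {η : EuclideanSpace ℝ (Fin n) → ℝ} (hη : ContDiff ℝ ∞ η) (i : Fin n)
    (z : ℝ × EuclideanSpace ℝ (Fin n)) :
    spaceDeriv i (fun z => η z.2) z = fderiv ℝ η z.2 (EuclideanSpace.single i 1) := by
  have h := ((hη.differentiable (by simp) z.2).hasFDerivAt.comp z hasFDerivAt_snd).fderiv
  have h' : fderiv ℝ (fun z : ℝ × EuclideanSpace ℝ (Fin n) => η z.2) z = _ := h
  rw [spaceDeriv, h']
  rfl

theorem timeDeriv_comp_snd {η : EuclideanSpace ℝ (Fin n) → ℝ} (hη : ContDiff ℝ ∞ η)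
    (z : ℝ × EuclideanSpace ℝ (Fin n)) :
    fderiv ℝ (fun z : ℝ × EuclideanSpace ℝ (Fin n) => η z.2) z (timeDir n) = 0 := by
  have h := ((hη.differentiable (by simp) z.2).hasFDerivAt.comp z hasFDerivAt_snd).fderiv
  have h' : fderiv ℝ (fun z : ℝ × EuclideanSpace ℝ (Fin n) => η z.2) z = _ := h
  rw [h']
  simp [timeDir]

/-- Space derivatives of time independent functions are time independent; this makes the bounds on
the derivatives of the weight independent of `T`. -/
theorem exists_spaceDeriv_eq {η : EuclideanSpace ℝ (Fin n) → ℝ} (hη : ContDiff ℝ ∞ η) (i : Fin n) :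
    ∃ θ : EuclideanSpace ℝ (Fin n) → ℝ, ContDiff ℝ ∞ θ ∧
      spaceDeriv i (fun z : ℝ × EuclideanSpace ℝ (Fin n) => η z.2) = fun z => θ z.2 :=
  ⟨fun x => fderiv ℝ η x (EuclideanSpace.single i 1),
    (hη.fderiv_right (m := ∞) (by simp)).clm_apply contDiff_const,
    funext fun z => spaceDeriv_comp_snd hη i z⟩

theorem exists_spaceLaplacian_eq {η : EuclideanSpace ℝ (Fin n) → ℝ} (hη : ContDiff ℝ ∞ η) :
    ∃ θ : EuclideanSpace ℝ (Fin n) → ℝ, ContDiff ℝ ∞ θ ∧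
      spaceLaplacian (fun z : ℝ × EuclideanSpace ℝ (Fin n) => η z.2) = fun z => θ z.2 := by
  choose θ hθ hθe using fun i => exists_spaceDeriv_eq hη i
  choose ζ hζ hζe using fun i => exists_spaceDeriv_eq (hθ i) i
  refine ⟨fun x => ∑ i, ζ i x, ContDiff.sum fun i _ => hζ i, ?_⟩
  ext z
  simp only [spaceLaplacian, hθe, hζe]

theorem IsSmoothBoundedDomain.exists_hessian_le (hΩ : IsSmoothBoundedDomain Ω)
    {η : EuclideanSpace ℝ (Fin n) → ℝ} (hη : ContDiff ℝ ∞ η) :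
    ∃ κ : ℝ, 0 < κ ∧ ∀ z : ℝ × EuclideanSpace ℝ (Fin n), z.2 ∈ Ω → ∀ ξ : Fin n → ℝ,
      ∑ i, ∑ j, spaceDeriv i (spaceDeriv j fun z : ℝ × EuclideanSpace ℝ (Fin n) => η z.2) z *
        ξ i * ξ j ≤ κ * ∑ i, ξ i ^ 2 := by
  choose θ hθ hθe using fun j => exists_spaceDeriv_eq hη j
  choose ζ hζ hζe using fun i j => exists_spaceDeriv_eq (hθ j) i
  choose C hC using fun i j =>
    hΩ.isCompact_closure.exists_bound_of_continuousOn (hζ i j).continuous.continuousOn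
  refine ⟨1 + ∑ i, ∑ j, |C i j|, by positivity, fun z hz ξ => ?_⟩
  have hS : 0 ≤ ∑ i, ξ i ^ 2 := Finset.sum_nonneg fun i _ => sq_nonneg _
  have hle : ∀ i, ξ i ^ 2 ≤ ∑ i, ξ i ^ 2 := fun i =>
    Finset.single_le_sum (f := fun i => ξ i ^ 2) (fun i _ => sq_nonneg _) (Finset.mem_univ i)
  calc _ ≤ ∑ i, ∑ j, |C i j| * ∑ i, ξ i ^ 2 := by
        refine Finset.sum_le_sum fun i _ => Finset.sum_le_sum fun j _ => ?_
        simp only [hθe, hζe]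
        have h1 : |ζ i j z.2| ≤ |C i j| := (hC i j z.2 (subset_closure hz)).trans (le_abs_self _)
        have h2 : |ξ i * ξ j| ≤ ∑ i, ξ i ^ 2 := by
          rw [abs_mul]
          nlinarith [hle i, hle j, sq_nonneg (|ξ i| - |ξ j|), sq_abs (ξ i), sq_abs (ξ j)]
        calc _ ≤ |ζ i j z.2 * (ξ i * ξ j)| := by rw [← mul_assoc]; exact le_abs_self _
          _ = |ζ i j z.2| * |ξ i * ξ j| := abs_mul _ _
          _ ≤ _ := by gcongr
    _ = (∑ i, ∑ j, |C i j|) * ∑ i, ξ i ^ 2 := by simp only [← Finset.sum_mul]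
    _ ≤ _ := by gcongr; linarith

theorem IsSmoothBoundedDomain.exists_bilaplacian_ge (hΩ : IsSmoothBoundedDomain Ω)
    {η : EuclideanSpace ℝ (Fin n) → ℝ} (hη : ContDiff ℝ ∞ η) :
    ∃ κ : ℝ, 0 ≤ κ ∧ ∀ z : ℝ × EuclideanSpace ℝ (Fin n), z.2 ∈ Ω →
      -κ ≤ spaceLaplacian (spaceLaplacian fun z : ℝ × EuclideanSpace ℝ (Fin n) => η z.2) z := by
  obtain ⟨θ, hθ, hθe⟩ := exists_spaceLaplacian_eq hη
  obtain ⟨ζ, hζ, hζe⟩ := exists_spaceLaplacian_eq hθ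
  obtain ⟨C, hC⟩ := hΩ.isCompact_closure.exists_bound_of_continuousOn hζ.continuous.continuousOn
  refine ⟨|C|, abs_nonneg _, fun z hz => ?_⟩
  rw [hθe, hζe]
  exact (abs_le.1 ((hC z.2 (subset_closure hz)).trans (le_abs_self _))).1

/-- The distance to `x₀` agrees near any closed set not containing `x₀` with a function that is smooth
everywhere. -/
theorem exists_contDiff_eq_psi {K : Set (EuclideanSpace ℝ (Fin n))} (hK : IsClosed K)
    {x₀ : EuclideanSpace ℝ (Fin n)} (hx₀ : x₀ ∉ K) :
    ∃ η : EuclideanSpace ℝ (Fin n) → ℝ, ContDiff ℝ ∞ η ∧ ∀ x ∈ K, η =ᶠ[𝓝 x] psi x₀ := by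
  obtain ⟨r, hr, hball⟩ := Metric.isOpen_iff.1 hK.isOpen_compl x₀ hx₀
  let b : ContDiffBump x₀ := ⟨r / 4, r / 2, by positivity, by linarith⟩
  refine ⟨fun x => (1 - b x) * psi x₀ x, ?_, fun x hx => ?_⟩
  · rw [contDiff_iff_contDiffAt]
    intro x
    by_cases h : x = x₀
    · have : (fun x => (1 - b x) * psi x₀ x) =ᶠ[𝓝 x] fun _ => 0 := by
        rw [h]
        filter_upwards [b.eventuallyEq_one] with y hy
        rw [hy]
        simp
      exact contDiffAt_const.congr_of_eventuallyEq this
    · refine (contDiffAt_const.sub b.contDiff.contDiffAt).mul ?_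
      exact (contDiffAt_id.sub contDiffAt_const).norm ℝ (sub_ne_zero.2 h)
  · have hxr : r ≤ dist x x₀ := by
      by_contra! hlt
      exact hball (Metric.mem_ball.2 hlt) hx
    filter_upwards [Metric.ball_mem_nhds x (show 0 < r / 2 by positivity)] with y hy
    have hy' : r / 2 ≤ dist y x₀ := by
      have := dist_triangle x y x₀
      rw [Metric.mem_ball, dist_comm] at hy
      linarith
    rw [b.zero_of_le_dist hy']
    simp

/-- The derivative of the distance, obtained by differentiating its square. -/
theorem psi_mul_fderiv {x₀ x : EuclideanSpace ℝ (Fin n)} (hx : x ≠ x₀)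
    (e : EuclideanSpace ℝ (Fin n)) : psi x₀ x * fderiv ℝ (psi x₀) x e = inner ℝ (x - x₀) e := by
  have hd : HasFDerivAt (psi x₀) (fderiv ℝ (psi x₀) x) x :=
    ((differentiableAt_id.sub_const x₀).norm ℝ (sub_ne_zero.2 hx)).hasFDerivAt
  have h1 := hd.pow 2
  have h2 := ((hasFDerivAt_id (𝕜 := ℝ) x).sub_const x₀).norm_sq
  have h3 := congrArg (fun f => f e) (h1.unique h2)
  simp only [psi, id_eq, nsmul_eq_mul, Nat.cast_ofNat, smul_apply,
    smul_eq_mul, ContinuousLinearMap.comp_apply, ContinuousLinearMap.id_apply,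
    innerSL_apply_apply] at h3 ⊢
  simp at h3
  linarith

theorem sum_fderiv_psi_sq {x₀ x : EuclideanSpace ℝ (Fin n)} (hx : x ≠ x₀) :
    ∑ i, fderiv ℝ (psi x₀) x (EuclideanSpace.single i 1) ^ 2 = 1 := by
  have h0 : psi x₀ x ≠ 0 := norm_ne_zero_iff.2 (sub_ne_zero.2 hx)
  have h1 : psi x₀ x ^ 2 * ∑ i, fderiv ℝ (psi x₀) x (EuclideanSpace.single i 1) ^ 2 =
      psi x₀ x ^ 2 := by
    rw [Finset.mul_sum]
    simp only [← mul_pow, psi_mul_fderiv hx, EuclideanSpace.inner_single_right]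
    rw [psi, EuclideanSpace.norm_sq_eq]
    simp
  exact mul_left_cancel₀ (pow_ne_zero 2 h0) (h1.trans (mul_one _).symm)

/-- The square root `exp(-(τ²t + τp))` of the Carleman weight. -/
def sqrtWeight (τ : ℝ) (p : ℝ × EuclideanSpace ℝ (Fin n) → ℝ)
    (z : ℝ × EuclideanSpace ℝ (Fin n)) : ℝ :=
  Real.exp (-(τ ^ 2 * z.1 + τ * p z))

theorem contDiff_sqrtWeight {p : ℝ × EuclideanSpace ℝ (Fin n) → ℝ} (hp : ContDiff ℝ ∞ p) (τ : ℝ) :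
    ContDiff ℝ ∞ (sqrtWeight τ p) := by
  unfold sqrtWeight
  exact ((contDiff_const.mul contDiff_fst).add (contDiff_const.mul hp)).neg.exp

theorem fderiv_sqrtWeight {p : ℝ × EuclideanSpace ℝ (Fin n) → ℝ} (hp : ContDiff ℝ ∞ p) (τ : ℝ)
    (z e : ℝ × EuclideanSpace ℝ (Fin n)) :
    fderiv ℝ (sqrtWeight τ p) z e =
      -(τ ^ 2 * e.1 + τ * fderiv ℝ p z e) * sqrtWeight τ p z := by
  have hpd := (hp.differentiable (by simp) z).hasFDerivAt
  have h1 : HasFDerivAt (fun z : ℝ × EuclideanSpace ℝ (Fin n) => -(τ ^ 2 * z.1 + τ * p z))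
      (-(τ ^ 2 • ContinuousLinearMap.fst ℝ ℝ (EuclideanSpace ℝ (Fin n)) + τ • fderiv ℝ p z)) z :=
    ((hasFDerivAt_fst.const_mul _).add (hpd.const_mul _)).neg
  have h2 : fderiv ℝ (sqrtWeight τ p) z = _ := h1.exp.fderiv
  rw [h2]
  simp [sqrtWeight]
  ring

theorem spaceDeriv_sqrtWeight {p : ℝ × EuclideanSpace ℝ (Fin n) → ℝ} (hp : ContDiff ℝ ∞ p) (τ : ℝ)
    (i : Fin n) :
    spaceDeriv i (sqrtWeight τ p) = fun z => -τ * spaceDeriv i p z * sqrtWeight τ p z := by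
  ext z
  rw [spaceDeriv, fderiv_sqrtWeight hp, spaceDeriv]
  simp [spaceDir]

theorem spaceDeriv_spaceDeriv_sqrtWeight {p : ℝ × EuclideanSpace ℝ (Fin n) → ℝ}
    (hp : ContDiff ℝ ∞ p) (τ : ℝ) (i : Fin n) (z : ℝ × EuclideanSpace ℝ (Fin n)) :
    spaceDeriv i (spaceDeriv i (sqrtWeight τ p)) z =
      (τ ^ 2 * spaceDeriv i p z ^ 2 - τ * spaceDeriv i (spaceDeriv i p) z) * sqrtWeight τ p z := by
  have hc : ContDiff ℝ ∞ fun z => -τ * spaceDeriv i p z :=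
    contDiff_const.mul (contDiff_spaceDeriv hp i)
  have h1 : spaceDeriv i (fun z => -τ * spaceDeriv i p z) z =
      -τ * spaceDeriv i (spaceDeriv i p) z := by
    rw [spaceDeriv_mul contDiff_const (contDiff_spaceDeriv hp i)]
    simp [spaceDeriv]
  rw [spaceDeriv_sqrtWeight hp, spaceDeriv_mul hc (contDiff_sqrtWeight hp τ),
    spaceDeriv_sqrtWeight hp, h1]
  ring

variable {v vt : ℝ × EuclideanSpace ℝ (Fin n) → ℝ} {D : Fin n → ℝ × EuclideanSpace ℝ (Fin n) → ℝ}
  {W : Fin n → Fin n → ℝ × EuclideanSpace ℝ (Fin n) → ℝ}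
  {γ : Fin n → ℝ × EuclideanSpace ℝ (Fin n) → ℝ}

/-- The Carleman estimate for real functions, obtained by conjugation with the weight. -/
theorem HasParabolicDerivs.carleman_weighted (h : HasParabolicDerivs T Ω v vt D W γ)
    (hΩ : IsSmoothBoundedDomain Ω) (hT : 0 < T) {η : EuclideanSpace ℝ (Fin n) → ℝ}
    (hη : ContDiff ℝ ∞ η) {p : ℝ × EuclideanSpace ℝ (Fin n) → ℝ} (hpη : p = fun z => η z.2)
    (hgrad : ∀ z ∈ spaceTimeCyl T Ω, ∑ i, spaceDeriv i p z ^ 2 = 1) {R : ℝ} (hR : 0 < R)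
    (hη0 : ∀ x ∈ Ω, 0 ≤ η x) (hηR : ∀ x ∈ Ω, η x ≤ R) {κ₁ κ₂ : ℝ} (hκ₁ : 0 < κ₁)
    (hhess : ∀ z ∈ spaceTimeCyl T Ω, ∀ ξ : Fin n → ℝ,
      ∑ i, ∑ j, spaceDeriv i (spaceDeriv j p) z * ξ i * ξ j ≤ κ₁ * ∑ i, ξ i ^ 2)
    (hbilap : ∀ z ∈ spaceTimeCyl T Ω, -κ₂ ≤ spaceLaplacian (spaceLaplacian p) z) {τ : ℝ}
    (hτ : 0 < τ) (hτκ : 4 * κ₂ * R ^ 2 ≤ τ) :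
    τ ^ 2 * (∫ z in spaceTimeCyl T Ω, sqrtWeight τ p z ^ 2 * v z ^ 2) / (2 * R ^ 2) +
        2 * τ * (∫ z, sqrtWeight τ p z ^ 2 * (∑ i, normalComp Ω i z * γ i z) ^ 2 *
          ∑ j, spaceDeriv j p z * normalComp Ω j z ∂(lateralMeasure T Ω)) ≤
      (1 + 16 * κ₁ ^ 2 * R ^ 2) *
        ∫ z in spaceTimeCyl T Ω, sqrtWeight τ p z ^ 2 * (vt z - ∑ i, W i i z) ^ 2 := by
  have hp : ContDiff ℝ ∞ p := by rw [hpη]; exact hη.comp contDiff_snd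
  have key := (h.contDiff_mul hΩ (contDiff_sqrtWeight hp τ)).carleman hΩ hT hη
    (fun z => congrFun hpη z) hgrad hR hη0 hηR hκ₁ hhess hbilap hτ hτκ
  refine le_of_eq_of_le ?_ (key.trans_eq ?_)
  · congr 2
    · congr 2; ext z; ring
    · congr 2; ext z
      have e : ∀ i, normalComp Ω i z * (sqrtWeight τ p z * γ i z) =
        sqrtWeight τ p z * (normalComp Ω i z * γ i z) := fun i => by ring
      simp only [e, ← Finset.mul_sum]
      ring
  · congr 1
    refine setIntegral_congr_fun (hΩ.measurableSet_spaceTimeCyl T) fun z hz => ?_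
    have ht : fderiv ℝ (sqrtWeight τ p) z (timeDir n) = -τ ^ 2 * sqrtWeight τ p z := by
      rw [fderiv_sqrtWeight hp, hpη, timeDeriv_comp_snd hη]
      simp [timeDir]
    have e1 : ∀ i, sqrtWeight τ p z * W i i z + -τ * spaceDeriv i p z * sqrtWeight τ p z * D i z +
        (-τ * spaceDeriv i p z * sqrtWeight τ p z * D i z +
          (τ ^ 2 * spaceDeriv i p z ^ 2 - τ * spaceDeriv i (spaceDeriv i p) z) *
            sqrtWeight τ p z * v z) =
        sqrtWeight τ p z * W i i z - 2 * τ * sqrtWeight τ p z * (spaceDeriv i p z * D i z) +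
          (τ ^ 2 * sqrtWeight τ p z * v z) * spaceDeriv i p z ^ 2 -
          (τ * sqrtWeight τ p z * v z) * spaceDeriv i (spaceDeriv i p) z := fun i => by ring
    have e2 : ∀ i, spaceDeriv i p z * (sqrtWeight τ p z * D i z +
        -τ * spaceDeriv i p z * sqrtWeight τ p z * v z) =
        sqrtWeight τ p z * (spaceDeriv i p z * D i z) -
          (τ * sqrtWeight τ p z * v z) * spaceDeriv i p z ^ 2 := fun i => by ring
    have hl : ∑ i, spaceDeriv i (spaceDeriv i p) z = spaceLaplacian p z := rfl
    simp only [conjugatedFirstOrder, transportTerm, spaceDeriv_spaceDeriv_sqrtWeight hp, ht]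
    simp only [spaceDeriv_sqrtWeight hp, e1, e2, Finset.sum_add_distrib, Finset.sum_sub_distrib,
      ← Finset.mul_sum, hgrad z hz, hl]
    ring

end Weight

/-! ### Complex functions and potentials -/

section Complex

variable {n : ℕ} {Ω : Set (EuclideanSpace ℝ (Fin n))} {T : ℝ}

theorem hasParabolicDerivs_clm {v : ℝ × EuclideanSpace ℝ (Fin n) → ℂ}
    {γ : Fin n → ℝ × EuclideanSpace ℝ (Fin n) → ℂ} (hΩ : IsSmoothBoundedDomain Ω)
    (h1 : MemH1 T Ω v) (h2 : MemL2H2 T Ω v) (hlat : IsLateralTrace T Ω v 0)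
    (hini : IsInitialTrace T Ω v 0)
    (hγ : ∀ i, IsLateralTrace T Ω (weakDeriv (spaceTimeCyl T Ω) (spaceDir i) v) (γ i))
    {L : ℂ →L[ℝ] ℝ} (hL : ∀ c, |L c| ≤ ‖c‖) :
    HasParabolicDerivs T Ω (fun z => L (v z))
      (fun z => L (weakDeriv (spaceTimeCyl T Ω) (timeDir n) v z))
      (fun i z => L (weakDeriv (spaceTimeCyl T Ω) (spaceDir i) v z))
      (fun i j z => L (weakDeriv (spaceTimeCyl T Ω) (spaceDir j)
        (weakDeriv (spaceTimeCyl T Ω) (spaceDir i) v) z))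
      (fun i z => L (γ i z)) where
  initial := hini.initialZero h1 hL
  lateral i := by simpa using hlat.strongTrace hΩ h2.1 hL i
  second i j := (hγ i).strongTrace hΩ (h2.2 i) hL j

theorem norm_sq_eq_re_add_im (c : ℂ) : ‖c‖ ^ 2 = Complex.reCLM c ^ 2 + Complex.imCLM c ^ 2 := by
  rw [Complex.sq_norm, Complex.normSq_apply]
  simp [sq]

theorem abs_reCLM_le (c : ℂ) : |Complex.reCLM c| ≤ ‖c‖ := Complex.abs_re_le_norm c

theorem abs_imCLM_le (c : ℂ) : |Complex.imCLM c| ≤ ‖c‖ := Complex.abs_im_le_norm c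

/-- The integral of a weight times a squared modulus is the sum of the contributions of the real
and the imaginary part. -/
theorem integral_weight_mul_norm_sq {μ : Measure (ℝ × EuclideanSpace ℝ (Fin n))}
    {a : ℝ × EuclideanSpace ℝ (Fin n) → ℝ} {f : ℝ × EuclideanSpace ℝ (Fin n) → ℂ}
    (h : ∀ L : ℂ →L[ℝ] ℝ, Integrable (fun z => a z * L (f z) ^ 2) μ) :
    ∫ z, a z * ‖f z‖ ^ 2 ∂μ =
      (∫ z, a z * Complex.reCLM (f z) ^ 2 ∂μ) + ∫ z, a z * Complex.imCLM (f z) ^ 2 ∂μ := by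
  rw [← integral_add (h _) (h _)]
  congr 1; ext z
  rw [norm_sq_eq_re_add_im]
  ring

/-- `(∂ₜ - Δ)v` on the cylinder, in terms of weak derivatives. -/
def weakHeat (T : ℝ) (Ω : Set (EuclideanSpace ℝ (Fin n)))
    (v : ℝ × EuclideanSpace ℝ (Fin n) → ℂ) (z : ℝ × EuclideanSpace ℝ (Fin n)) : ℂ :=
  weakDeriv (spaceTimeCyl T Ω) (timeDir n) v z
    - ∑ i, weakDeriv (spaceTimeCyl T Ω) (spaceDir i)
        (weakDeriv (spaceTimeCyl T Ω) (spaceDir i) v) z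

theorem memLp_weakHeat {v : ℝ × EuclideanSpace ℝ (Fin n) → ℂ} (h1 : MemH1 T Ω v)
    (h2 : MemL2H2 T Ω v) : MemLp (weakHeat T Ω v) 2 (volume.restrict (spaceTimeCyl T Ω)) :=
  (h1.2.1.weakDeriv_spec).1.sub (memLp_finsetSum _ fun i _ => ((h2.2 i).2 i).weakDeriv_spec.1)

theorem IsSmoothBoundedDomain.integrable_weight_mul_sq (hΩ : IsSmoothBoundedDomain Ω)
    {a g : ℝ × EuclideanSpace ℝ (Fin n) → ℝ} (ha : Continuous a)
    (hg : MemLp g 2 (volume.restrict (spaceTimeCyl T Ω))) :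
    Integrable (fun z => a z ^ 2 * g z ^ 2) (volume.restrict (spaceTimeCyl T Ω)) := by
  simpa only [mul_pow] using (hΩ.memLp_continuous_mul ha hg).integrable_sq

/-- The normal trace `∑ᵢ νᵢ γᵢ` of a gradient with the complex traces `γᵢ`. -/
def complexNormalTrace (Ω : Set (EuclideanSpace ℝ (Fin n)))
    (γ : Fin n → ℝ × EuclideanSpace ℝ (Fin n) → ℂ) (z : ℝ × EuclideanSpace ℝ (Fin n)) : ℂ :=
  ∑ i, ((outwardNormal Ω z.2 i : ℝ) : ℂ) * γ i z

theorem clm_complexNormalTrace (L : ℂ →L[ℝ] ℝ) (γ : Fin n → ℝ × EuclideanSpace ℝ (Fin n) → ℂ)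
    (z : ℝ × EuclideanSpace ℝ (Fin n)) :
    L (complexNormalTrace Ω γ z) = ∑ i, normalComp Ω i z * L (γ i z) := by
  rw [complexNormalTrace, map_sum]
  refine Finset.sum_congr rfl fun i _ => ?_
  rw [← Complex.real_smul, map_smul, smul_eq_mul, normalComp]

theorem IsSmoothBoundedDomain.integrable_lateral_weight (hΩ : IsSmoothBoundedDomain Ω)
    {a : ℝ × EuclideanSpace ℝ (Fin n) → ℝ} (ha : Continuous a)
    {p : ℝ × EuclideanSpace ℝ (Fin n) → ℝ} (hp : ContDiff ℝ ∞ p)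
    {γ : Fin n → ℝ × EuclideanSpace ℝ (Fin n) → ℂ} (hγ : ∀ i, MemLp (γ i) 2 (lateralMeasure T Ω))
    (L : ℂ →L[ℝ] ℝ) :
    Integrable (fun z => (a z ^ 2 * ∑ j, spaceDeriv j p z * normalComp Ω j z) *
      L (complexNormalTrace Ω γ z) ^ 2) (lateralMeasure T Ω) := by
  have m1 : MemLp (fun z => ∑ i, L (γ i z) * normalComp Ω i z) 2 (lateralMeasure T Ω) :=
    memLp_finsetSum _ fun i _ => hΩ.memLp_mul_normalComp (L.comp_memLp' (hγ i))
  have m2 := hΩ.memLp_lateral_continuous_mul ha m1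
  have m3 := fun j => (hΩ.memLp_lateral_continuous_mul
    (contDiff_spaceDeriv hp j).continuous (hΩ.memLp_mul_normalComp (i := j) m2))
  have := integrable_finsetSum Finset.univ fun j _ => m2.integrable_fun_mul (m3 j)
  refine this.congr (Eventually.of_forall fun z => ?_)
  have hc : ∑ i, L (γ i z) * normalComp Ω i z = L (complexNormalTrace Ω γ z) := by
    rw [clm_complexNormalTrace]
    exact Finset.sum_congr rfl fun i _ => mul_comm _ _
  simp only [hc]
  rw [Finset.mul_sum, Finset.sum_mul]
  refine Finset.sum_congr rfl fun j _ => ?_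
  ring

/-- The Carleman estimate for complex functions, without potential, with the boundary terms of both
signs collected in one integral. -/
theorem carleman_complex (hΩ : IsSmoothBoundedDomain Ω) (hT : 0 < T)
    {v : ℝ × EuclideanSpace ℝ (Fin n) → ℂ} {γ : Fin n → ℝ × EuclideanSpace ℝ (Fin n) → ℂ}
    (h1 : MemH1 T Ω v) (h2 : MemL2H2 T Ω v) (hlat : IsLateralTrace T Ω v 0)
    (hini : IsInitialTrace T Ω v 0)
    (hγ : ∀ i, IsLateralTrace T Ω (weakDeriv (spaceTimeCyl T Ω) (spaceDir i) v) (γ i))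
    {η : EuclideanSpace ℝ (Fin n) → ℝ}
    (hη : ContDiff ℝ ∞ η) {p : ℝ × EuclideanSpace ℝ (Fin n) → ℝ} (hpη : p = fun z => η z.2)
    (hgrad : ∀ z ∈ spaceTimeCyl T Ω, ∑ i, spaceDeriv i p z ^ 2 = 1) {R : ℝ} (hR : 0 < R)
    (hη0 : ∀ x ∈ Ω, 0 ≤ η x) (hηR : ∀ x ∈ Ω, η x ≤ R) {κ₁ κ₂ : ℝ} (hκ₁ : 0 < κ₁)
    (hhess : ∀ z ∈ spaceTimeCyl T Ω, ∀ ξ : Fin n → ℝ,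
      ∑ i, ∑ j, spaceDeriv i (spaceDeriv j p) z * ξ i * ξ j ≤ κ₁ * ∑ i, ξ i ^ 2)
    (hbilap : ∀ z ∈ spaceTimeCyl T Ω, -κ₂ ≤ spaceLaplacian (spaceLaplacian p) z) {τ : ℝ}
    (hτ : 0 < τ) (hτκ : 4 * κ₂ * R ^ 2 ≤ τ) :
    τ ^ 2 * (∫ z in spaceTimeCyl T Ω, sqrtWeight τ p z ^ 2 * ‖v z‖ ^ 2) / (2 * R ^ 2) +
        2 * τ * (∫ z, (sqrtWeight τ p z ^ 2 * ∑ j, spaceDeriv j p z * normalComp Ω j z) *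
          ‖complexNormalTrace Ω γ z‖ ^ 2 ∂(lateralMeasure T Ω)) ≤
      (1 + 16 * κ₁ ^ 2 * R ^ 2) *
        ∫ z in spaceTimeCyl T Ω, sqrtWeight τ p z ^ 2 * ‖weakHeat T Ω v z‖ ^ 2 := by
  have hp : ContDiff ℝ ∞ p := by rw [hpη]; exact hη.comp contDiff_snd
  have ha := (contDiff_sqrtWeight hp τ).continuous
  have key : ∀ L : ℂ →L[ℝ] ℝ, (∀ c, |L c| ≤ ‖c‖) →
      τ ^ 2 * (∫ z in spaceTimeCyl T Ω, sqrtWeight τ p z ^ 2 * L (v z) ^ 2) / (2 * R ^ 2) +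
        2 * τ * (∫ z, (sqrtWeight τ p z ^ 2 * ∑ j, spaceDeriv j p z * normalComp Ω j z) *
          L (complexNormalTrace Ω γ z) ^ 2 ∂(lateralMeasure T Ω)) ≤
      (1 + 16 * κ₁ ^ 2 * R ^ 2) *
        ∫ z in spaceTimeCyl T Ω, sqrtWeight τ p z ^ 2 * L (weakHeat T Ω v z) ^ 2 := by
    intro L hL
    have := (hasParabolicDerivs_clm hΩ h1 h2 hlat hini hγ hL).carleman_weighted hΩ hT hη hpη hgrad
      hR hη0 hηR hκ₁ hhess hbilap hτ hτκ
    simp only [weakHeat, map_sub, map_sum, clm_complexNormalTrace]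
    simpa only [mul_right_comm] using this
  have e1 := integral_weight_mul_norm_sq (a := fun z => sqrtWeight τ p z ^ 2) (f := v)
    (μ := volume.restrict (spaceTimeCyl T Ω))
    fun L => hΩ.integrable_weight_mul_sq ha (L.comp_memLp' h1.1)
  have e2 := integral_weight_mul_norm_sq (a := fun z => sqrtWeight τ p z ^ 2)
    (f := weakHeat T Ω v) (μ := volume.restrict (spaceTimeCyl T Ω))
    fun L => hΩ.integrable_weight_mul_sq ha (L.comp_memLp' (memLp_weakHeat h1 h2))
  have e3 := integral_weight_mul_norm_sq
    (a := fun z => sqrtWeight τ p z ^ 2 * ∑ j, spaceDeriv j p z * normalComp Ω j z)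
    (f := complexNormalTrace Ω γ) (μ := lateralMeasure T Ω)
    fun L => hΩ.integrable_lateral_weight ha hp (fun i => (hγ i).1) L
  have k1 := key _ abs_reCLM_le
  have k2 := key _ abs_imCLM_le
  rw [e1, e2, e3, mul_add, mul_add, mul_add, add_div]
  linarith

/-- Passing from `∂ₜ - Δ` to the operator with a bounded potential costs a multiple of `‖v‖²`. -/
theorem IsSmoothBoundedDomain.integral_weight_weakHeat_le (hΩ : IsSmoothBoundedDomain Ω)
    {q v : ℝ × EuclideanSpace ℝ (Fin n) → ℂ} {M : ℝ} (hM : 0 ≤ M)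
    (hq : MemLp q ⊤ (volume.restrict (spaceTimeCyl T Ω)))
    (hqM : eLpNorm q ⊤ (volume.restrict (spaceTimeCyl T Ω)) ≤ ENNReal.ofReal M)
    (h1 : MemH1 T Ω v) (h2 : MemL2H2 T Ω v) {a : ℝ × EuclideanSpace ℝ (Fin n) → ℝ}
    (ha : Continuous a) :
    ∫ z in spaceTimeCyl T Ω, a z ^ 2 * ‖weakHeat T Ω v z‖ ^ 2 ≤
      2 * (∫ z in spaceTimeCyl T Ω, a z ^ 2 * ‖heatOp T Ω q v z‖ ^ 2) +
      2 * M ^ 2 * ∫ z in spaceTimeCyl T Ω, a z ^ 2 * ‖v z‖ ^ 2 := by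
  have hqa : ∀ᵐ z ∂(volume.restrict (spaceTimeCyl T Ω)), ‖q z‖ ≤ M := by
    rw [eLpNorm_exponent_top] at hqM
    filter_upwards [ae_le_eLpNormEssSup (f := q) (μ := volume.restrict (spaceTimeCyl T Ω))]
      with z hz
    have h := hz.trans hqM
    rw [← ofReal_norm] at h
    exact (ENNReal.ofReal_le_ofReal_iff hM).1 h
  have mh := memLp_weakHeat h1 h2
  have mqv : MemLp (fun z => q z * v z) 2 (volume.restrict (spaceTimeCyl T Ω)) := by
    refine MemLp.of_le_mul (c := M) h1.1 (hq.aestronglyMeasurable.mul h1.1.aestronglyMeasurable) ?_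
    filter_upwards [hqa] with z hz
    rw [norm_mul]
    gcongr
  have mho : MemLp (heatOp T Ω q v) 2 (volume.restrict (spaceTimeCyl T Ω)) := mh.add mqv
  have i1 := hΩ.integrable_weight_mul_sq ha mho.norm
  have i2 := hΩ.integrable_weight_mul_sq ha h1.1.norm
  rw [← integral_const_mul, ← integral_const_mul,
    ← integral_add (i1.const_mul _) (i2.const_mul _)]
  refine integral_mono_ae (hΩ.integrable_weight_mul_sq ha mh.norm)
    ((i1.const_mul _).add (i2.const_mul _)) ?_
  filter_upwards [hqa] with z hz
  have e : weakHeat T Ω v z = heatOp T Ω q v z - q z * v z := by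
    rw [weakHeat, heatOp]; ring
  have hn : ‖weakHeat T Ω v z‖ ≤ ‖heatOp T Ω q v z‖ + M * ‖v z‖ := by
    rw [e]
    refine (norm_sub_le _ _).trans ?_
    rw [norm_mul]
    gcongr
  have hsq : ‖weakHeat T Ω v z‖ ^ 2 ≤ 2 * ‖heatOp T Ω q v z‖ ^ 2 + 2 * (M * ‖v z‖) ^ 2 := by
    have := pow_le_pow_left₀ (norm_nonneg _) hn 2
    nlinarith [sq_nonneg (‖heatOp T Ω q v z‖ - M * ‖v z‖)]
  have := mul_le_mul_of_nonneg_left hsq (sq_nonneg (a z))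
  nlinarith

end Complex

/-! ### The two parts of the boundary -/

section Boundary

variable {n : ℕ} {Ω : Set (EuclideanSpace ℝ (Fin n))} {T : ℝ}

theorem IsSmoothBoundedDomain.isClosed_backSet (hΩ : IsSmoothBoundedDomain Ω)
    (x₀ : EuclideanSpace ℝ (Fin n)) : IsClosed (backSet Ω x₀) := by
  have : ContinuousOn (fun x => inner ℝ (x - x₀) (outwardNormal Ω x)) (frontier Ω) :=
    (continuousOn_id.sub continuousOn_const).inner hΩ.continuousOn_outwardNormal
  exact this.preimage_isClosed_of_isClosed isClosed_frontier isClosed_Ici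

theorem IsSmoothBoundedDomain.isClosed_frontSet (hΩ : IsSmoothBoundedDomain Ω)
    (x₀ : EuclideanSpace ℝ (Fin n)) : IsClosed (frontSet Ω x₀) := by
  have : ContinuousOn (fun x => inner ℝ (x - x₀) (outwardNormal Ω x)) (frontier Ω) :=
    (continuousOn_id.sub continuousOn_const).inner hΩ.continuousOn_outwardNormal
  exact this.preimage_isClosed_of_isClosed isClosed_frontier isClosed_Iic

theorem IsSmoothBoundedDomain.integral_lateral_indicator (hΩ : IsSmoothBoundedDomain Ω)
    {A : Set (EuclideanSpace ℝ (Fin n))} (hA : MeasurableSet A)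
    {F : ℝ × EuclideanSpace ℝ (Fin n) → ℝ} (hF : Integrable F (lateralMeasure T Ω)) :
    Integrable (fun z => A.indicator (fun x => F (z.1, x)) z.2) (lateralMeasure T Ω) ∧
    ∫ z, A.indicator (fun x => F (z.1, x)) z.2 ∂(lateralMeasure T Ω) =
      ∫ t in Ioo 0 T, ∫ x in A, F (t, x) ∂(surfaceMeasure Ω) := by
  have := hΩ.isFiniteMeasure_surfaceMeasure
  have he : (fun z : ℝ × EuclideanSpace ℝ (Fin n) => A.indicator (fun x => F (z.1, x)) z.2) =
      (Prod.snd ⁻¹' A).indicator F := by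
    ext z
    by_cases hz : z.2 ∈ A
    · rw [indicator_of_mem hz, indicator_of_mem (show z ∈ Prod.snd ⁻¹' A from hz)]
    · rw [indicator_of_notMem hz, indicator_of_notMem (show z ∉ Prod.snd ⁻¹' A from hz)]
  have hi : Integrable (fun z => A.indicator (fun x => F (z.1, x)) z.2) (lateralMeasure T Ω) := by
    rw [he]
    exact hF.indicator (measurable_snd hA)
  refine ⟨hi, ?_⟩
  rw [lateralMeasure] at hi ⊢
  rw [integral_prod _ hi]
  congr 1; ext t
  exact integral_indicator hA

/-- The boundary integral splits into the contributions of `Γ₊` and `Γ₋`; on their intersection the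
integrand vanishes. -/
theorem IsSmoothBoundedDomain.integral_lateral_eq_sub (hΩ : IsSmoothBoundedDomain Ω)
    {x₀ : EuclideanSpace ℝ (Fin n)} (hx₀ : x₀ ∉ frontier Ω)
    {f : ℝ × EuclideanSpace ℝ (Fin n) → ℝ} (hf : ∀ z, 0 ≤ f z)
    (hi : Integrable (fun z => f z * normalDeriv Ω (psi x₀) z.2) (lateralMeasure T Ω)) :
    ∫ z, f z * normalDeriv Ω (psi x₀) z.2 ∂(lateralMeasure T Ω) =
      (∫ t in Ioo 0 T, ∫ x in backSet Ω x₀, f (t, x) * |normalDeriv Ω (psi x₀) x|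
        ∂(surfaceMeasure Ω)) -
      ∫ t in Ioo 0 T, ∫ x in frontSet Ω x₀, f (t, x) * |normalDeriv Ω (psi x₀) x|
        ∂(surfaceMeasure Ω) := by
  have hF : Integrable (fun z => f z * |normalDeriv Ω (psi x₀) z.2|) (lateralMeasure T Ω) := by
    refine hi.norm.congr (Eventually.of_forall fun z => ?_)
    simp only [norm_mul, Real.norm_eq_abs, abs_of_nonneg (hf z)]
  obtain ⟨i1, e1⟩ := hΩ.integral_lateral_indicator (hΩ.isClosed_backSet x₀).measurableSet hF
  obtain ⟨i2, e2⟩ := hΩ.integral_lateral_indicator (hΩ.isClosed_frontSet x₀).measurableSet hF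
  rw [← e1, ← e2, ← integral_sub i1 i2]
  refine integral_congr_ae ?_
  filter_upwards [hΩ.ae_mem_lateral T] with z hz
  have hne : z.2 ≠ x₀ := fun h => hx₀ (h ▸ hz.2)
  have hpos : 0 < psi x₀ z.2 := norm_pos_iff.2 (sub_ne_zero.2 hne)
  have hinner : psi x₀ z.2 * normalDeriv Ω (psi x₀) z.2 =
      inner ℝ (z.2 - x₀) (outwardNormal Ω z.2) := psi_mul_fderiv hne _
  have hb : z.2 ∈ backSet Ω x₀ ↔ 0 ≤ normalDeriv Ω (psi x₀) z.2 := by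
    rw [backSet, mem_ofPred_eq, ← hinner, mul_nonneg_iff_of_pos_left hpos]
    exact and_iff_right hz.2
  have hfr : z.2 ∈ frontSet Ω x₀ ↔ normalDeriv Ω (psi x₀) z.2 ≤ 0 := by
    rw [frontSet, mem_ofPred_eq, ← hinner, mul_nonpos_iff_pos_imp_nonpos]
    exact ⟨fun h => h.2.1 hpos, fun h => ⟨hz.2, fun _ => h, fun _ => hpos.le⟩⟩
  rcases lt_trichotomy (normalDeriv Ω (psi x₀) z.2) 0 with h | h | h
  · rw [indicator_of_notMem (by rw [hb]; linarith), indicator_of_mem (hfr.2 h.le), abs_of_neg h]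
    ring
  · rw [indicator_of_mem (hb.2 h.ge), indicator_of_mem (hfr.2 h.le), h]
    simp
  · rw [indicator_of_mem (hb.2 h.le), indicator_of_notMem (by rw [hfr]; linarith), abs_of_pos h]
    ring

/-- The final absorption: for large `τ` the potential costs at most half of the term in `‖v‖²`. -/
theorem absorption_of_potential {V Hw Hh Bp Bm C₀ M R τ : ℝ} (hτ : 1 ≤ τ) (hR : 0 < R)
    (hC₀ : 0 < C₀) (hτM : 8 * C₀ * M ^ 2 * R ^ 2 ≤ τ) (hV : 0 ≤ V) (hHh : 0 ≤ Hh) (hBp : 0 ≤ Bp)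
    (hBm : 0 ≤ Bm) (hkey : τ ^ 2 * V / (2 * R ^ 2) + 2 * τ * (Bp - Bm) ≤ C₀ * Hw)
    (hpot : Hw ≤ 2 * Hh + 2 * M ^ 2 * V) :
    τ * Bp + τ ^ 2 * V ≤ max (2 * C₀) 2 / min (1 / (4 * R ^ 2)) 2 * (Hh + τ * Bm) := by
  have hτ0 : 0 < τ := by linarith
  have hcpos : 0 < min (1 / (4 * R ^ 2)) 2 := lt_min (by positivity) two_pos
  have h1 : C₀ * (2 * M ^ 2 * V) ≤ τ ^ 2 * V / (4 * R ^ 2) := by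
    rw [le_div_iff₀ (by positivity)]
    have : 8 * C₀ * M ^ 2 * R ^ 2 ≤ τ ^ 2 := by nlinarith
    nlinarith [mul_le_mul_of_nonneg_right this hV]
  have h2 := mul_le_mul_of_nonneg_left hpot hC₀.le
  have h3 : τ ^ 2 * V / (2 * R ^ 2) = 2 * (1 / (4 * R ^ 2) * (τ ^ 2 * V)) := by
    field_simp; norm_num
  have h4 : τ ^ 2 * V / (4 * R ^ 2) = 1 / (4 * R ^ 2) * (τ ^ 2 * V) := by ring
  have h5 : min (1 / (4 * R ^ 2)) 2 * (τ ^ 2 * V) ≤ 1 / (4 * R ^ 2) * (τ ^ 2 * V) :=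
    mul_le_mul_of_nonneg_right (min_le_left _ _) (by positivity)
  have h6 : min (1 / (4 * R ^ 2)) 2 * (τ * Bp) ≤ 2 * (τ * Bp) :=
    mul_le_mul_of_nonneg_right (min_le_right _ _) (by positivity)
  have h7 : 2 * C₀ * Hh ≤ max (2 * C₀) 2 * Hh :=
    mul_le_mul_of_nonneg_right (le_max_left _ _) hHh
  have h8 : 2 * (τ * Bm) ≤ max (2 * C₀) 2 * (τ * Bm) :=
    mul_le_mul_of_nonneg_right (le_max_right _ _) (by positivity)
  rw [div_mul_eq_mul_div, le_div_iff₀ hcpos]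
  linarith

theorem clm_apply_eq_sum (f : EuclideanSpace ℝ (Fin n) →L[ℝ] ℝ) (x : EuclideanSpace ℝ (Fin n)) :
    f x = ∑ j, f (EuclideanSpace.single j 1) * x j := by
  conv_lhs => rw [← (EuclideanSpace.basisFun (Fin n) ℝ).sum_repr x]
  simp [map_sum, mul_comm]

end Boundary

end

theorem lemma6p1 (n : ℕ) (hn : 3 ≤ n) (Ω : Set (EuclideanSpace ℝ (Fin n)))
    (hΩ : IsSmoothBoundedDomain Ω) (x₀ : EuclideanSpace ℝ (Fin n)) (hx₀ : x₀ ∉ closure Ω) :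
    ∃ C : ℝ, 0 < C ∧ ∀ T : ℝ, 0 < T → ∀ M : ℝ, 0 ≤ M → ∃ τ₀ : ℝ, 0 < τ₀ ∧
      ∀ q v w : ℝ × EuclideanSpace ℝ (Fin n) → ℂ,
        MemLp q ⊤ (volume.restrict (spaceTimeCyl T Ω)) →
        eLpNorm q ⊤ (volume.restrict (spaceTimeCyl T Ω)) ≤ ENNReal.ofReal M →
        MemH1 T Ω v → MemL2H2 T Ω v →
        IsLateralTrace T Ω v 0 → IsInitialTrace T Ω v 0 →
        IsNeumannTrace T Ω v w →
        ∀ τ : ℝ, τ₀ < τ →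
          τ * (∫ t in Ioo 0 T, ∫ x in backSet Ω x₀,
                carlemanWeight x₀ τ t x * ‖w (t, x)‖ ^ 2 * |normalDeriv Ω (psi x₀) x|
                  ∂(surfaceMeasure Ω))
            + τ ^ 2 * (∫ z in spaceTimeCyl T Ω, carlemanWeight x₀ τ z.1 z.2 * ‖v z‖ ^ 2)
          ≤ C * ((∫ z in spaceTimeCyl T Ω,
                    carlemanWeight x₀ τ z.1 z.2 * ‖heatOp T Ω q v z‖ ^ 2)
            + τ * (∫ t in Ioo 0 T, ∫ x in frontSet Ω x₀,
                carlemanWeight x₀ τ t x * ‖w (t, x)‖ ^ 2 * |normalDeriv Ω (psi x₀) x|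
                  ∂(surfaceMeasure Ω))) := by
  have hfr : x₀ ∉ frontier Ω := fun h => hx₀ (frontier_subset_closure h)
  have hne : ∀ x ∈ closure Ω, x ≠ x₀ := fun x hx h => hx₀ (h ▸ hx)
  obtain ⟨η, hη, hηe⟩ := exists_contDiff_eq_psi isClosed_closure hx₀
  set p : ℝ × EuclideanSpace ℝ (Fin n) → ℝ := fun z => η z.2 with hpη
  have hp : ContDiff ℝ ∞ p := hη.comp contDiff_snd
  have hval : ∀ x ∈ closure Ω, η x = psi x₀ x := fun x hx => (hηe x hx).eq_of_nhds
  have hder : ∀ z : ℝ × EuclideanSpace ℝ (Fin n), z.2 ∈ closure Ω → ∀ i,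
      spaceDeriv i p z = fderiv ℝ (psi x₀) z.2 (EuclideanSpace.single i 1) := fun z hz i => by
    rw [hpη, spaceDeriv_comp_snd hη, (hηe z.2 hz).fderiv_eq]
  obtain ⟨R₀, hR₀⟩ := hΩ.isCompact_closure.exists_bound_of_continuousOn hη.continuous.continuousOn
  obtain ⟨κ₁, hκ₁, hhess⟩ := hΩ.exists_hessian_le hη
  obtain ⟨κ₂, hκ₂, hbilap⟩ := hΩ.exists_bilaplacian_ge hη
  set R := |R₀| + 1 with hRdef
  have hR : 0 < R := by positivity
  set C₀ := 1 + 16 * κ₁ ^ 2 * R ^ 2 with hC₀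
  have hC₀pos : 0 < C₀ := by positivity
  have hcpos : 0 < min (1 / (4 * R ^ 2)) 2 := lt_min (by positivity) two_pos
  refine ⟨max (2 * C₀) 2 / min (1 / (4 * R ^ 2)) 2, by positivity, fun T hT M hM =>
    ⟨1 + 4 * κ₂ * R ^ 2 + 8 * C₀ * M ^ 2 * R ^ 2, by positivity, ?_⟩⟩
  intro q v w hq hqM h1 h2 hlat hini hneu τ hτ
  obtain ⟨γ, hγ, hw⟩ := hneu
  have hR2 : 0 ≤ 4 * κ₂ * R ^ 2 := by positivity
  have hMR : 0 ≤ 8 * C₀ * M ^ 2 * R ^ 2 := by positivity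
  have hτpos : 0 < τ := by linarith
  have ha := (contDiff_sqrtWeight hp τ).continuous
  have key := carleman_complex hΩ hT h1 h2 hlat hini hγ hη hpη
    (fun z hz => by simp only [hder z (subset_closure hz.2)]; exact
      sum_fderiv_psi_sq (hne z.2 (subset_closure hz.2))) hR
    (fun x hx => by rw [hval x (subset_closure hx)]; exact norm_nonneg _)
    (fun x hx => by
      have := (le_abs_self _).trans ((hR₀ x (subset_closure hx)).trans (le_abs_self R₀))
      linarith)
    hκ₁ (fun z hz => hhess z hz.2) (fun z hz => hbilap z hz.2) hτpos (by linarith)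
  have hpot := hΩ.integral_weight_weakHeat_le hM hq hqM h1 h2 ha
  have hweight : ∀ z : ℝ × EuclideanSpace ℝ (Fin n), z.2 ∈ closure Ω →
      sqrtWeight τ p z ^ 2 = carlemanWeight x₀ τ z.1 z.2 := by
    intro z hz
    rw [sqrtWeight, carlemanWeight, show p z = psi x₀ z.2 from hval z.2 hz, ← Real.exp_nat_mul]
    congr 1
    push_cast
    ring
  have hQw : ∀ g : ℝ × EuclideanSpace ℝ (Fin n) → ℝ,
      ∫ z in spaceTimeCyl T Ω, sqrtWeight τ p z ^ 2 * g z =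
        ∫ z in spaceTimeCyl T Ω, carlemanWeight x₀ τ z.1 z.2 * g z := fun g =>
    setIntegral_congr_fun (hΩ.measurableSet_spaceTimeCyl T) fun z hz => by
      simp only [hweight z (subset_closure hz.2)]
  have hae : (fun z => (sqrtWeight τ p z ^ 2 * ∑ j, spaceDeriv j p z * normalComp Ω j z) *
        ‖complexNormalTrace Ω γ z‖ ^ 2) =ᵐ[lateralMeasure T Ω]
      fun z => carlemanWeight x₀ τ z.1 z.2 * ‖w z‖ ^ 2 * normalDeriv Ω (psi x₀) z.2 := by
    filter_upwards [hw, hΩ.ae_mem_lateral T] with z hz hzl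
    have hcl := frontier_subset_closure hzl.2
    have hnd : ∑ j, spaceDeriv j p z * normalComp Ω j z = normalDeriv Ω (psi x₀) z.2 := by
      rw [normalDeriv, clm_apply_eq_sum]
      simp only [hder z hcl, normalComp]
    rw [hnd, hweight z hcl, hz, complexNormalTrace]
    ring
  have hint : Integrable (fun z => carlemanWeight x₀ τ z.1 z.2 * ‖w z‖ ^ 2 *
      normalDeriv Ω (psi x₀) z.2) (lateralMeasure T Ω) := by
    refine Integrable.congr ?_ hae
    have hI := fun L => hΩ.integrable_lateral_weight ha hp (fun i => (hγ i).1) L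
    refine ((hI Complex.reCLM).add (hI Complex.imCLM)).congr (Eventually.of_forall fun z => ?_)
    simp only [Pi.add_apply, norm_sq_eq_re_add_im, mul_add]
  have hf : ∀ z, 0 ≤ carlemanWeight x₀ τ z.1 z.2 * ‖w z‖ ^ 2 := fun z =>
    mul_nonneg (Real.exp_pos _).le (sq_nonneg _)
  rw [integral_congr_ae hae, hΩ.integral_lateral_eq_sub hfr hf hint] at key
  rw [hQw fun z => ‖v z‖ ^ 2] at hpot key
  rw [hQw fun z => ‖heatOp T Ω q v z‖ ^ 2] at hpot
  have hnn : ∀ A : Set (EuclideanSpace ℝ (Fin n)), 0 ≤ ∫ t in Ioo 0 T, ∫ x in A,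
      carlemanWeight x₀ τ t x * ‖w (t, x)‖ ^ 2 * |normalDeriv Ω (psi x₀) x|
        ∂(surfaceMeasure Ω) := fun A =>
    integral_nonneg fun t => integral_nonneg fun x =>
      mul_nonneg (mul_nonneg (Real.exp_pos _).le (sq_nonneg _)) (abs_nonneg _)
  have hnn' : ∀ g : ℝ × EuclideanSpace ℝ (Fin n) → ℂ,
      0 ≤ ∫ z in spaceTimeCyl T Ω, carlemanWeight x₀ τ z.1 z.2 * ‖g z‖ ^ 2 := fun g =>
    integral_nonneg fun z => mul_nonneg (Real.exp_pos _).le (sq_nonneg _)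
  exact absorption_of_potential (by linarith) hR hC₀pos (by linarith) (hnn' v) (hnn' _) (hnn _)
    (hnn _) key hpot
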